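/- **Setting.** Let $K\ge 2$ and let $G=([K],E)$ be a directed graph (self-loops allowed) that is strongly observable: every $i\in[K]$ satisfies $(i,i)\in E$, or $(j,i)\in E$ for all $j\ne i$. Let $\alpha$ be its independence number (largest set of vertices without an edge, in either direction, between two distinct members), $\widetilde\alpha$ the independence number after deleting all one-sided edges, and $M=\min\{\widetilde\alpha,\alpha\log K\}$. In each round $t=1,\dots,T$ an environment draws a loss vector $\ell_t\in[l_0,1]^K$, where $l_0\in[-1,0]$ is known (so $[0,1]$ and $[-1,1]$ are covered); its law may depend on the whole past. Independently of $\ell_t$ given the past, the learner draws $A_t$ and observes $\ell_{t,j}$ for all $j$ with $(A_t,j)\in E$. The learner works with $y_{t,j}=(\ell_{t,j}-l_0)/(1-l_0)\in[0,1]$. Put $\mathrm{Reg}(u)=\mathbb E\big[\sum_{t=1}^T(\ell_{t,A_t}-\ell_{t,u})\big]$. The *corrupted stochastic regime* with $x^\star\in[K]$, $\Delta>0$, $C_t\ge0$ means that for all $t\le T$ and $x\neq x^\star$, almost surely $\mathbb E[\ell_{t,x}-\ell_{t,x^\star}\mid\text{past before round }t]\ge\Delta-C_t$; then $C=\sum_{t\le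 T}C_t$. **Base algorithm** ($(1-1/\log K)$-Tsallis-INF on an arm set $S$). Let $\beta=1-1/\log K$ and $\psi(x)=-\sum_{i\in S}\frac{x_i^\beta}{\beta(1-\beta)}$. In round $t$ it gets an update probability $q_t\in(0,1]$, sets $\eta_t=\sqrt{\log K/\sum_{s\le t}\frac1{q_s}(1+M)}$ and $p_t\in\arg\min_{x\in\Delta(S)}\{\sum_{s<t}\langle x,\widehat\ell_s\rangle+\frac1{\eta_t}\psi(x)\}$, draws $A_t\sim p_t$, and receives the feedback with probability $q_t$, independently of $A_t$ given the past ($\mathrm{upd}_t=1$, otherwise $0$). With $N(i)=\{j\in S:(j,i)\in E\}$ and $I_t=\{i:(i,i)\notin E,\ p_{t,i}>\frac12\}$, $$\widehat\ell_{t,i}=\mathrm{upd}_t\frac{(y_{t,i}-\mathbb I\{i\in I_t\})\,\mathbb I\{A_t\in N(i)\}}{\sum_{j\in N(i)}p_{t,j}q_t}+\mathbb I\{i\in I_t\}.$$ It is $\frac12$-*iw-stable* on $S$ with constants $(c_1,c_2)$ if for all adaptive weights $q_t\in(0,1]$, all losses as above, all bounded stopping times $t'$ and all $u\in S$, $\mathbb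 E[\sum_{t\le t'}(\ell_{t,A_t}-\ell_{t,u})]\le\mathbb E\big[\sqrt{c_1\sum_{t\le t'}\frac1{q_t}}+\frac{c_2}{\min_{t\le t'}q_t}\big]$ (trivially true if the right side is $+\infty$). **Second reduction** (candidate $\widehat x$, constants $(c_1,0)$). Run the base algorithm on $S=[K]\setminus\{\widehat x\}$ with update probabilities $q_{t,2}$, where, with $z_\tau\in\mathbb R^2$ defined below and $B_{t}=\sqrt{c_1\sum_{\tau\le t}1/q_{\tau,2}}$ ($B_0=0$), $$\bar q_t\in\arg\min_{q\in\Delta_2}\Big\{\Big\langle q,\sum_{\tau<t}z_\tau-(0,B_{t-1})\Big\rangle-2(\sqrt t+8\sqrt{c_1})(\sqrt{q_1}+\sqrt{q_2})\Big\},\qquad q_t=\Big(1-\tfrac1{2t^2}\Big)\bar q_t+\tfrac1{4t^2}(1,1).$$ Draw $i_t\sim q_t$; play $A_t=\widehat x$ if $i_t=1$, else play an arm drawn from the base distribution $p_t$ and pass the feedback to the base algorithm (so $\mathrm{upd}_t=\mathbb I\{i_t=2\}$). Let $z_{t,i}=(\widetilde\ell_{t,A_t}+1)\mathbb I\{i_t=i\}/q_{t,i}-1$,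 with the (observable) surrogate losses $\widetilde\ell_{t,\widehat x}=y_{t,\widehat x}\mathbb I\{(\widehat x,\widehat x)\in E\}-\sum_{j\ne\widehat x}p_{t,j}y_{t,j}\mathbb I\{(j,j)\notin E\}$ and $\widetilde\ell_{t,j}=y_{t,j}\mathbb I\{(j,j)\in E\}-y_{t,\widehat x}\mathbb I\{(\widehat x,\widehat x)\notin E\}$ for $j\neq\widehat x$; these equal $y_t$ if all arms have self-loops. **First reduction.** Put $T_0=T_1=0$ and draw $\widehat x_1$ uniformly. In epoch $k$ start the second reduction afresh with candidate $\widehat x_k$. After a round $t$ in epoch $k$, if $t-T_k\ge2(T_k-T_{k-1})$ and some $x\ne\widehat x_k$ was played at least $\frac{t-T_k}2$ times in the epoch, let $\widehat x_{k+1}$ be such an $x$ (ties broken by any fixed rule), $T_{k+1}=t$, and begin epoch $k+1$. **Statement.** There is an absolute constant $\kappa_0>0$ such that for every $\kappa\ge\kappa_0$ there is a constant $c>0$, depending on $\kappa$ only, such that for all $K\ge2$ and all strongly observable $G$, with $c_1=\kappa M\log K$: 1. for every $\widehat x\in[K]$ the base algorithm on $[K]\setminus\{\widehat x\}$ is $\frac12$-iw-stable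 with constants $(c_1,0)$; 2. for all $T$ and all environments as above, the combined algorithm run with $c_1$ satisfies $\max_u\mathrm{Reg}(u)\le c\sqrt{M\,T\log K}$; 3. simultaneously, if $T\ge2$, then in every corrupted stochastic regime the same algorithm satisfies $$\max_u\mathrm{Reg}(u)\le c\left(\frac{M\log T\log K}{\Delta}+\sqrt{\frac{M\log T\log K}{\Delta}\,C}\right).$$ -/

import Mathlib

open MeasureTheory

universe u

namespace GraphBandit

/-! ## Feedback graphs

The arms are `Fin K`; `G.Adj a j` means that the loss of arm `j` is observed when `a` is played. -/

/-- Every arm observes itself or is observed by all other arms. -/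
def StronglyObservable {K : ℕ} (G : Digraph (Fin K)) : Prop :=
  ∀ i, G.Adj i i ∨ ∀ j, j ≠ i → G.Adj j i

/-- Independence number `α`: no edge, in either direction, between distinct members. -/
noncomputable def indepNumber {K : ℕ} (G : Digraph (Fin K)) : ℕ :=
  G.toSimpleGraphInclusive.indepNum

/-- Weak independence number `α̃`: the independence number after removing one-sided edges. -/
noncomputable def weakIndepNumber {K : ℕ} (G : Digraph (Fin K)) : ℕ :=
  G.toSimpleGraphStrict.indepNum

/-- `min {α̃, α log K}`. -/
noncomputable def complexity {K : ℕ} (G : Digraph (Fin K)) : ℝ :=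
  min (weakIndepNumber G : ℝ) (indepNumber G * Real.log K)

/-- The constant `c₁ = κ min {α̃, α log K} log K`. -/
noncomputable def stabConst {K : ℕ} (κ : ℝ) (G : Digraph (Fin K)) : ℝ :=
  κ * complexity G * Real.log K

open Classical in
/-- What the learner sees after playing `a` on the loss vector `l ∈ [lo, 1]^K`: the observed losses,
rescaled affinely from `[lo, 1]` to `[0, 1]`. Unobserved entries are masked by `0`. -/
noncomputable def feedback {K : ℕ} (G : Digraph (Fin K)) (lo : ℝ) (a : Fin K) (l : Fin K → ℝ) :
    Fin K → ℝ :=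
  fun j => if G.Adj a j then (l j - lo) / (1 - lo) else 0

/-- A minimizer of `f` on `s` (unspecified if there is none). -/
noncomputable def argminOn {X : Type*} [Nonempty X] (s : Set X) (f : X → ℝ) : X :=
  Classical.epsilon fun x => x ∈ s ∧ IsMinOn f s x

/-! ## Base algorithm: `(1 - 1 / log K)`-Tsallis-INF on a set `S` of arms -/

/-- State of the base algorithm: the cumulative loss estimates, and `∑ 1 / q_s` over past rounds. -/
structure BaseState (K : ℕ) where
  cumLoss : Fin K → ℝ
  cumWeight : ℝ

def BaseState.init (K : ℕ) : BaseState K := ⟨fun _ => 0, 0⟩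

/-- `β = 1 - 1 / log K`. -/
noncomputable def tsallisExponent (K : ℕ) : ℝ := 1 - 1 / Real.log K

/-- The (convex) Tsallis regularizer `ψ(x) = - ∑ x_i ^ β / (β (1 - β))`. -/
noncomputable def tsallis {K : ℕ} (S : Finset (Fin K)) (x : Fin K → ℝ) : ℝ :=
  -∑ i ∈ S, x i ^ tsallisExponent K / (tsallisExponent K * (1 - tsallisExponent K))

/-- Learning rate `η_t` in a round with update probability `q`. -/
noncomputable def baseRate {K : ℕ} (G : Digraph (Fin K)) (b : BaseState K) (q : ℝ) : ℝ :=
  √(Real.log K / ((b.cumWeight + 1 / q) * (1 + complexity G)))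

/-- The distribution `p_t` of the base algorithm in a round with update probability `q`. -/
noncomputable def basePlay {K : ℕ} (G : Digraph (Fin K)) (S : Finset (Fin K))
    (b : BaseState K) (q : ℝ) : Fin K → ℝ :=
  argminOn {x | x ∈ stdSimplex ℝ (Fin K) ∧ ∀ i, i ∉ S → x i = 0}
    fun x => ∑ i ∈ S, x i * b.cumLoss i + 1 / baseRate G b q * tsallis S x

open Classical in
/-- `N(i)`: the arms of `S` that observe `i`. -/
noncomputable def observers {K : ℕ} (G : Digraph (Fin K)) (S : Finset (Fin K)) (i : Fin K) :
    Finset (Fin K) :=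
  S.filter fun j => G.Adj j i

open Classical in
/-- Indicator of `i ∈ I_t`: `i` does not observe itself and has probability above `1/2`. -/
noncomputable def heavyIndicator {K : ℕ} (G : Digraph (Fin K)) (p : Fin K → ℝ) (i : Fin K) : ℝ :=
  if ¬ G.Adj i i ∧ 1 / 2 < p i then 1 else 0

open Classical in
/-- The importance-weighted loss estimate, when the base algorithm drew `a` from `p`, received
feedback (`upd`) with probability `q`, and the feedback was `y`. It only uses observed entries. -/
noncomputable def baseEstimate {K : ℕ} (G : Digraph (Fin K)) (S : Finset (Fin K))
    (p : Fin K → ℝ) (q : ℝ) (a : Fin K) (upd : Prop) (y : Fin K → ℝ) (i : Fin K) : ℝ :=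
  (if upd ∧ a ∈ observers G S i then
    (y i - heavyIndicator G p i) / (∑ j ∈ observers G S i, p j * q) else 0) + heavyIndicator G p i

/-- One round of the base algorithm. -/
noncomputable def baseStep {K : ℕ} (G : Digraph (Fin K)) (S : Finset (Fin K))
    (b : BaseState K) (q : ℝ) (a : Fin K) (upd : Prop) (y : Fin K → ℝ) : BaseState K where
  cumLoss := fun i => b.cumLoss i + baseEstimate G S (basePlay G S b q) q a upd y i
  cumWeight := b.cumWeight + 1 / q

/-! ## Importance-weighting stability of the base algorithm -/

/-- State of the base algorithm after `t` rounds with update probabilities `q`, losses `l`,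
actions `a`, and update indicators `upd`. -/
noncomputable def baseTrajectory {K : ℕ} (G : Digraph (Fin K)) (S : Finset (Fin K)) (lo : ℝ)
    (q : ℕ → ℝ) (l : ℕ → Fin K → ℝ) (a : ℕ → Fin K) (upd : ℕ → Prop) : ℕ → BaseState K
  | 0 => BaseState.init K
  | t + 1 => baseStep G S (baseTrajectory G S lo q l a upd t) (q t) (a t) (upd t)
      (feedback G lo (a t) (l t))

/-- `A` are the actions of the base algorithm, run for `T` rounds with adaptive update
probabilities `q` against losses `ℓ`. `ℱ t` is the information available before round `t`
(rounds are numbered from `0`). Given `ℱ t` and `ℓ t`, the action `A t` has law `p_t` and the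
feedback arrives with probability `q t`, independently of `A t`. -/
structure IsBaseRun {K : ℕ} (G : Digraph (Fin K)) (S : Finset (Fin K)) (lo : ℝ) (T : ℕ)
    {Ω : Type*} {m : MeasurableSpace Ω} (μ : Measure Ω) (ℱ : Filtration ℕ m)
    (q : ℕ → Ω → ℝ) (ℓ : ℕ → Ω → Fin K → ℝ) (A : ℕ → Ω → Fin K) (upd : ℕ → Ω → Prop) : Prop where
  weight_measurable : ∀ t < T, Measurable[ℱ t] (q t)
  weight_mem : ∀ t < T, ∀ ω, q t ω ∈ Set.Ioc (0 : ℝ) 1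
  loss_measurable : ∀ t < T, Measurable[ℱ (t + 1)] (ℓ t)
  loss_mem : ∀ t < T, ∀ ω v, ℓ t ω v ∈ Set.Icc lo 1
  action_measurable : ∀ t < T, Measurable[ℱ (t + 1)] (A t)
  upd_measurable : ∀ t < T, MeasurableSet[ℱ (t + 1)] {ω | upd t ω}
  action_law : ∀ t < T, ∀ a,
    μ[Set.indicator {ω | A t ω = a} (fun _ => (1 : ℝ)) |
        ℱ t ⊔ MeasurableSpace.comap (ℓ t) inferInstance] =ᵐ[μ]
      fun ω => basePlay G S (baseTrajectory G S lo (fun s => q s ω) (fun s => ℓ s ω)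
        (fun s => A s ω) (fun s => upd s ω) t) (q t ω) a
  action_upd_law : ∀ t < T, ∀ a,
    μ[Set.indicator {ω | A t ω = a ∧ upd t ω} (fun _ => (1 : ℝ)) |
        ℱ t ⊔ MeasurableSpace.comap (ℓ t) inferInstance] =ᵐ[μ]
      fun ω => basePlay G S (baseTrajectory G S lo (fun s => q s ω) (fun s => ℓ s ω)
        (fun s => A s ω) (fun s => upd s ω) t) (q t ω) a * q t ω

/-- `1/2`-iw-stability, with constants `c₁, c₂`, of Tsallis-INF on the arms `S`: for all adaptive
weights and losses, every bounded stopping time `τ` (the number of completed rounds) and every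
comparator `u ∈ S`. If the bound is not integrable, its expectation is `+∞`. -/
def IWStable {K : ℕ} (G : Digraph (Fin K)) (S : Finset (Fin K)) (c₁ c₂ : ℝ) : Prop :=
  ∀ (lo : ℝ), -1 ≤ lo → lo ≤ 0 → ∀ (T : ℕ) (Ω : Type u) (m : MeasurableSpace Ω)
    (μ : Measure Ω) (_ : IsProbabilityMeasure μ) (ℱ : Filtration ℕ m)
    (q : ℕ → Ω → ℝ) (ℓ : ℕ → Ω → Fin K → ℝ) (A : ℕ → Ω → Fin K) (upd : ℕ → Ω → Prop),
    IsBaseRun G S lo T μ ℱ q ℓ A upd →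
    ∀ τ : Ω → ℕ, IsStoppingTime ℱ (fun ω => ((τ ω : ℕ) : WithTop ℕ)) → (∀ ω, τ ω ≤ T) →
    ∀ u ∈ S,
    Integrable (fun ω => √(c₁ * ∑ t ∈ Finset.range (τ ω), 1 / q t ω)
      + c₂ / ⨅ t : Fin (τ ω), q t ω) μ →
    ∫ ω, ∑ t ∈ Finset.range (τ ω), (ℓ t ω (A t ω) - ℓ t ω u) ∂μ ≤
      ∫ ω, (√(c₁ * ∑ t ∈ Finset.range (τ ω), 1 / q t ω) + c₂ / ⨅ t : Fin (τ ω), q t ω) ∂μ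

/-! ## Second reduction: Corral over the candidate `x` and the base algorithm on the other arms

The base algorithm has `c₂ = 0`, so the log-barrier part of the Corral regularizer (weight
`1 / β = 8 c₂`) and the second bonus term `c₂ / min q` vanish. -/

/-- State of Corral: number of completed rounds, the sums `∑ z_{τ,i}`, and the base state, whose
`cumWeight` is `∑ 1 / q_{τ,2}`. Index `0` is the candidate, index `1` is the base algorithm. -/
structure CorralState (K : ℕ) where
  rounds : ℕ
  cumZ : Fin 2 → ℝ
  base : BaseState K

def CorralState.init (K : ℕ) : CorralState K := ⟨0, fun _ => 0, BaseState.init K⟩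

/-- The bonus `B_{t-1}`. -/
noncomputable def corralBonus {K : ℕ} (c₁ : ℝ) (s : CorralState K) : ℝ :=
  √(c₁ * s.base.cumWeight)

/-- `q̄_t`; here `1 / η_t = √t + 8 √c₁`, where `t` is the current round (numbered from `1`). -/
noncomputable def corralUnmixed {K : ℕ} (c₁ : ℝ) (s : CorralState K) : Fin 2 → ℝ :=
  argminOn (stdSimplex ℝ (Fin 2)) fun q =>
    q 0 * s.cumZ 0 + q 1 * (s.cumZ 1 - corralBonus c₁ s)
      - 2 * (√((s.rounds + 1 : ℕ) : ℝ) + 8 * √c₁) * ∑ i, √(q i)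

/-- `q_t = (1 - 1 / (2 t²)) q̄_t + 1 / (4 t²)`. -/
noncomputable def corralWeights {K : ℕ} (c₁ : ℝ) (s : CorralState K) (i : Fin 2) : ℝ :=
  (1 - 1 / (2 * ((s.rounds + 1 : ℕ) : ℝ) ^ 2)) * corralUnmixed c₁ s i
    + 1 / (4 * ((s.rounds + 1 : ℕ) : ℝ) ^ 2)

/-- The base algorithm's distribution on the arms other than `x`, with update probability
`q_{t,2}`. -/
noncomputable def corralBasePlay {K : ℕ} (G : Digraph (Fin K)) (c₁ : ℝ) (x : Fin K)
    (s : CorralState K) : Fin K → ℝ :=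
  basePlay G (Finset.univ.erase x) s.base (corralWeights c₁ s 1)

/-- The law of the action: draw `i_t ∼ q_t` and play `x` if it is the first index, else an arm
drawn from the base distribution. As the latter does not charge `x`, the outcome of `i_t` is
determined by whether the action is `x`. -/
noncomputable def corralPlay {K : ℕ} (G : Digraph (Fin K)) (c₁ : ℝ) (x : Fin K)
    (s : CorralState K) (a : Fin K) : ℝ :=
  if a = x then corralWeights c₁ s 0 else corralWeights c₁ s 1 * corralBasePlay G c₁ x s a

open Classical in
/-- The surrogate loss of the played arm `a`, for base distribution `p` and feedback `y`. It is the
loss of `a` if all arms observe themselves. In a strongly observable graph it only uses observed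
entries. -/
noncomputable def surrogate {K : ℕ} (G : Digraph (Fin K)) (x : Fin K) (p : Fin K → ℝ)
    (y : Fin K → ℝ) (a : Fin K) : ℝ :=
  if a = x then
    (if G.Adj x x then y x else 0)
      - ∑ j ∈ Finset.univ.erase x, if G.Adj j j then 0 else p j * y j
  else
    (if G.Adj a a then y a else 0) - (if G.Adj x x then 0 else y x)

/-- One round of Corral with candidate `x`, after playing `a` and receiving the feedback `y`. -/
noncomputable def corralStep {K : ℕ} (G : Digraph (Fin K)) (c₁ : ℝ) (x : Fin K)
    (s : CorralState K) (a : Fin K) (y : Fin K → ℝ) : CorralState K where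
  rounds := s.rounds + 1
  cumZ := fun i => s.cumZ i +
    ((surrogate G x (corralBasePlay G c₁ x s) y a + 1)
        * (if (i = 0 ↔ a = x) then 1 else 0) / corralWeights c₁ s i - 1)
  base := baseStep G (Finset.univ.erase x) s.base (corralWeights c₁ s 1) a (a ≠ x) y

/-! ## First reduction: epochs with a candidate arm -/

/-- State of the full algorithm: the candidate of the current epoch, the length of the previous
epoch, the counts `N_k`, and the state of Corral, restarted in each epoch. -/
structure AlgState (K : ℕ) where
  candidate : Fin K
  prevLength : ℕ
  count : Fin K → ℕ
  corral : CorralState K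

/-- Start of an epoch. -/
def AlgState.fresh {K : ℕ} (x : Fin K) (prevLength : ℕ) : AlgState K :=
  ⟨x, prevLength, fun _ => 0, CorralState.init K⟩

/-- The law of the action to be played. -/
noncomputable def algPlay {K : ℕ} (G : Digraph (Fin K)) (c₁ : ℝ) (s : AlgState K) :
    Fin K → ℝ :=
  corralPlay G c₁ s.candidate s.corral

/-- One round of the full algorithm: a new epoch begins once the current epoch is at least twice as
long as the previous one and some arm other than the candidate was played at least half of the
time. Among several such arms, `sel` picks the new candidate. -/
noncomputable def algStep {K : ℕ} (G : Digraph (Fin K)) (c₁ : ℝ)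
    (sel : Finset (Fin K) → Fin K) (s : AlgState K) (a : Fin K) (y : Fin K → ℝ) : AlgState K :=
  let corral := corralStep G c₁ s.candidate s.corral a y
  let count := Function.update s.count a (s.count a + 1)
  let frequent := (Finset.univ.erase s.candidate).filter fun x => corral.rounds ≤ 2 * count x
  if 2 * s.prevLength ≤ corral.rounds ∧ frequent.Nonempty then
    AlgState.fresh (sel frequent) corral.rounds
  else
    ⟨s.candidate, s.prevLength, count, corral⟩

/-- State of the full algorithm after `t` rounds with losses `l` and actions `a`, when the first
candidate is `x`. -/
noncomputable def algTrajectory {K : ℕ} (G : Digraph (Fin K)) (c₁ lo : ℝ)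
    (sel : Finset (Fin K) → Fin K) (x : Fin K) (l : ℕ → Fin K → ℝ) (a : ℕ → Fin K) :
    ℕ → AlgState K
  | 0 => AlgState.fresh x 0
  | t + 1 => algStep G c₁ sel (algTrajectory G c₁ lo sel x l a t) (a t)
      (feedback G lo (a t) (l t))

/-- `A` are the actions of the full algorithm, run for `T` rounds on the feedback graph `G` against
losses `ℓ` with values in `[lo, 1]`. `ℱ t` is the information available before round `t` (rounds
are numbered from `0`); the environment may choose `ℓ t` randomly and depending on all of the past.
The first candidate `x₁` is uniform; given `ℱ t` and `ℓ t`, the action `A t` has the law prescribed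
by the algorithm. -/
structure IsRun {K : ℕ} (G : Digraph (Fin K)) (c₁ lo : ℝ) (sel : Finset (Fin K) → Fin K) (T : ℕ)
    {Ω : Type*} {m : MeasurableSpace Ω} (μ : Measure Ω) (ℱ : Filtration ℕ m)
    (ℓ : ℕ → Ω → Fin K → ℝ) (x₁ : Ω → Fin K) (A : ℕ → Ω → Fin K) : Prop where
  init_measurable : Measurable[ℱ 0] x₁
  init_law : ∀ v, μ.real {ω | x₁ ω = v} = 1 / K
  loss_measurable : ∀ t < T, Measurable[ℱ (t + 1)] (ℓ t)
  loss_mem : ∀ t < T, ∀ ω v, ℓ t ω v ∈ Set.Icc lo 1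
  action_measurable : ∀ t < T, Measurable[ℱ (t + 1)] (A t)
  action_law : ∀ t < T, ∀ a,
    μ[Set.indicator {ω | A t ω = a} (fun _ => (1 : ℝ)) |
        ℱ t ⊔ MeasurableSpace.comap (ℓ t) inferInstance] =ᵐ[μ]
      fun ω => algPlay G c₁
        (algTrajectory G c₁ lo sel (x₁ ω) (fun s => ℓ s ω) (fun s => A s ω) t) a

/-- Pseudo-regret against the fixed arm `u`. -/
noncomputable def regret {K : ℕ} (T : ℕ) {Ω : Type*} {m : MeasurableSpace Ω} (μ : Measure Ω)
    (ℓ : ℕ → Ω → Fin K → ℝ) (A : ℕ → Ω → Fin K) (u : Fin K) : ℝ :=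
  ∫ ω, ∑ t ∈ Finset.range T, (ℓ t ω (A t ω) - ℓ t ω u) ∂μ

/-- The corrupted stochastic regime with optimal arm `x`, gap `Δ` and corruption levels `c`: given
the past, the expected loss of every other arm in round `t` exceeds that of `x` by at least
`Δ - c t`. -/
structure CorruptedStochastic {K : ℕ} (T : ℕ) {Ω : Type*} {m : MeasurableSpace Ω}
    (μ : Measure Ω) (ℱ : Filtration ℕ m) (ℓ : ℕ → Ω → Fin K → ℝ) (x : Fin K) (Δ : ℝ)
    (c : ℕ → ℝ) : Prop where
  gap_pos : 0 < Δ
  corruption_nonneg : ∀ t < T, 0 ≤ c t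
  gap : ∀ t < T, ∀ v, v ≠ x →
    ∀ᵐ ω ∂μ, Δ - c t ≤ (μ[fun ω => ℓ t ω v - ℓ t ω x | ℱ t]) ω

end GraphBandit

open GraphBandit

namespace GraphBandit

/-! ## Follow the regularized leader with Tsallis regularization -/

section FTRL

open Filter Topology

variable {ι : Type*} [Fintype ι]

/-! Every layer of the algorithm is controlled by a nonnegative potential whose conditional expected
increase in one round, plus the instantaneous regret in that round, is at most an explicit
observable rate. Summing over rounds and dropping the final potential gives the regret bounds. The
potential of follow-the-regularized-leader (FTRL) is the objective at the comparator minus its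
minimum (`ftrlPotential`). Its one-step inequality `ftrlPotential_add_le` has a penalty term from
the growing regularizer and a stability term.

For the base algorithm the exponent `1 - 1 / log K` keeps `∑ p_i ^ β` bounded by an absolute
constant. The second moment of the estimates, weighted by `p_i ^ (2 - β)`, is of order `M`. For
self-observing arms this is graph theory: a greedy independent set gives `α̃`
(`exists_indep_sum_div_le`), and a Cauchy–Schwarz argument with a telescoping power gives `α log K`
(`sum_rpow_div_inWeight_le`). An arm without a self-loop is observed with probability `1 - p_i`, and
its large weight near `p_i = 1` is tamed by shifting the losses (`exists_estimate_shift`). Hence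
`base_drift`: the regret is paid for by half the increments of `√(c₁ ∑ 1/q)`, which gives stability
after stopping (`iwStable_erase`). The regret bounds use the drift itself and not the stability
statement.

In the second reduction the bonus subtracted from the base algorithm's loss grows by exactly the
increments of `√(c₁ ∑ 1/q)`, so it pays for the base regret (`candidate_drift`). What remains is
`corralRate`, of order `√c₁ (√(q/t) + 1/√(∑ 1/q))` with `q` the probability of leaving the
candidate. It is at most of order `√(c₁/t)`. By the inequality of arithmetic and geometric means it
is also at most `√c₁` times `λ q` plus `1/λ` times increments of logarithms. The factor `√q` comes
from recentring the two-point loss before the stability bound is applied.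

Epoch lengths at least double, so square roots of past lengths sum geometrically, which yields the
`√T` bound. In the stochastic regime either the current candidate is `x⋆` and the logarithmic form
applies to the current epoch, or the current epoch is at most a constant times the number of plays
of other arms. Past epochs are charged to such plays in both cases (`exists_epoch_bound`,
`exists_count_bound`). Thus the regret is at most `√c₁ (1 + λ n + log T / λ)` up to a constant, with
`n` the expected number of plays of arms other than `x⋆`. The gap condition gives regret at least `Δ
n - C`, and optimizing `λ` closes the loop (`self_bounding_le`). -/

/-- The probability vectors supported on `S`. -/
def supportedSimplex (S : Finset ι) : Set (ι → ℝ) :=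
  {x | x ∈ stdSimplex ℝ ι ∧ ∀ i, i ∉ S → x i = 0}

theorem isCompact_supportedSimplex (S : Finset ι) : IsCompact (supportedSimplex S) := by
  refine (isCompact_stdSimplex ℝ ι).inter_right (t := {x | ∀ i, i ∉ S → x i = 0}) ?_
  simp only [Set.ofPred_forall]
  exact isClosed_iInter fun i => isClosed_iInter fun _ =>
    isClosed_eq (continuous_apply i) continuous_const

theorem single_mem_supportedSimplex [DecidableEq ι] {S : Finset ι} {i : ι} (hi : i ∈ S) :
    Pi.single i (1 : ℝ) ∈ supportedSimplex S := by
  refine ⟨single_mem_stdSimplex ℝ i, fun j hj => ?_⟩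
  rw [Pi.single_apply, if_neg]
  rintro rfl
  exact hj hi

theorem supportedSimplex_nonneg {S : Finset ι} {x : ι → ℝ} (hx : x ∈ supportedSimplex S) (i : ι) :
    0 ≤ x i := hx.1.1 i

theorem supportedSimplex_sum {S : Finset ι} {x : ι → ℝ} (hx : x ∈ supportedSimplex S) :
    ∑ i ∈ S, x i = 1 := by
  rw [← hx.1.2]
  exact Finset.sum_subset (Finset.subset_univ S) fun i _ hi => hx.2 i hi

theorem supportedSimplex_le_one {S : Finset ι} {x : ι → ℝ} (hx : x ∈ supportedSimplex S) (i : ι) :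
    x i ≤ 1 := by
  rw [← hx.1.2]
  exact Finset.single_le_sum (fun j _ => hx.1.1 j) (Finset.mem_univ i)

/-- Cumulative loss plus `r` times the (unnormalized) Tsallis regularizer with exponent `β`. -/
noncomputable def ftrlObj (S : Finset ι) (β r : ℝ) (L x : ι → ℝ) : ℝ :=
  ∑ i ∈ S, x i * L i - r * ∑ i ∈ S, x i ^ β

omit [Fintype ι] in
theorem ftrlObj_sub (S : Finset ι) (β r : ℝ) (L x p : ι → ℝ) :
    ftrlObj S β r L x - ftrlObj S β r L p
      = ∑ i ∈ S, ((x i - p i) * L i - r * (x i ^ β - p i ^ β)) := by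
  simp only [ftrlObj, sub_mul, mul_sub, Finset.sum_sub_distrib, Finset.mul_sum]
  ring

omit [Fintype ι] in
theorem continuous_ftrlObj (S : Finset ι) {β : ℝ} (hβ : 0 ≤ β) :
    Continuous fun z : ((ι → ℝ) × ℝ) × (ι → ℝ) => ftrlObj S β z.1.2 z.1.1 z.2 := by
  have h := Real.continuous_rpow_const hβ
  unfold ftrlObj
  fun_prop

theorem exists_isMinOn_ftrlObj {S : Finset ι} (hS : S.Nonempty) {β : ℝ} (hβ : 0 ≤ β) (r : ℝ)
    (L : ι → ℝ) : ∃ p ∈ supportedSimplex S, IsMinOn (ftrlObj S β r L) (supportedSimplex S) p := by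
  classical
  obtain ⟨i, hi⟩ := hS
  refine (isCompact_supportedSimplex S).exists_isMinOn ⟨_, single_mem_supportedSimplex hi⟩ ?_
  exact ((continuous_ftrlObj S hβ).comp
    (continuous_const.prodMk continuous_id : Continuous fun x => (((L, r), x)))).continuousOn

variable {S : Finset ι} {β r : ℝ} {L p : ι → ℝ}

/-- The slope of `x ^ β` is infinite at `0`: moving mass `ε` onto a null coordinate gains `r ε ^ β`
and costs only `O(ε)`. Interior minimizers make the first-order analysis below legitimate. -/
theorem ftrl_pos (hβ₀ : 0 < β) (hβ₁ : β < 1) (hr : 0 < r) (hp : p ∈ supportedSimplex S)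
    (hmin : IsMinOn (ftrlObj S β r L) (supportedSimplex S) p) {i : ι} (hi : i ∈ S) : 0 < p i := by
  classical
  by_contra hneg
  have hpi : p i = 0 := le_antisymm (not_lt.1 hneg) (supportedSimplex_nonneg hp i)
  obtain ⟨j, hj, hpj⟩ : ∃ j ∈ S, 0 < p j := by
    by_contra! h
    have := Finset.sum_nonpos h
    rw [supportedSimplex_sum hp] at this
    linarith
  have hij : i ≠ j := by rintro rfl; linarith
  -- The cost of the perturbation per unit of moved mass; `ε` is then taken so small that `ε ^ (1 -
  -- β) * C < r`.
  set C := L i - L j + r * p j ^ (β - 1)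
  have hlim : Tendsto (fun ε : ℝ => ε ^ (1 - β) * C) (𝓝[>] 0) (𝓝 0) := by
    have h := (Real.continuous_rpow_const (q := 1 - β) (by linarith)).tendsto 0
    rw [Real.zero_rpow (by linarith)] at h
    simpa using (h.mul_const C).mono_left nhdsWithin_le_nhds
  obtain ⟨ε, hε, hε₀, hε₁⟩ :=
    ((hlim.eventually (gt_mem_nhds hr)).and (Ioo_mem_nhdsGT hpj)).exists
  set x : ι → ℝ := fun k => p k + ε * ((if k = i then 1 else 0) - (if k = j then 1 else 0))
  have hxi : x i = ε := by simp [x, hij, hpi]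
  have hxj : x j = p j - ε := by simp [x, hij.symm]; ring
  have hxk : ∀ k, k ≠ i → k ≠ j → x k = p k := fun k h1 h2 => by simp [x, h1, h2]
  have hx : x ∈ supportedSimplex S := by
    refine ⟨⟨fun k => ?_, ?_⟩, fun k hk => ?_⟩
    · by_cases h1 : k = i
      · rw [h1, hxi]; exact hε₀.le
      by_cases h2 : k = j
      · rw [h2, hxj]; linarith
      rw [hxk k h1 h2]; exact supportedSimplex_nonneg hp k
    · simp [x, Finset.sum_add_distrib, ← Finset.mul_sum, hp.1.2]
    · rw [hxk k (by rintro rfl; exact hk hi) (by rintro rfl; exact hk hj), hp.2 k hk]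
  have hle : ftrlObj S β r L p ≤ ftrlObj S β r L x := hmin hx
  have hsub := ftrlObj_sub S β r L x p
  rw [Finset.sum_eq_add_of_mem i j hi hj hij
    (fun k _ hk => by rw [hxk k hk.1 hk.2]; ring), hxi, hxj, hpi, Real.zero_rpow hβ₀.ne'] at hsub
  -- This is `s ≤ s ^ β` on `[0, 1]` at `s = 1 - ε / p j`, multiplied by `p j ^ β`; no derivative is
  -- needed.
  have hchord : p j ^ β - ε * p j ^ (β - 1) ≤ (p j - ε) ^ β := by
    have h1 : (p j - ε) = p j * (1 - ε / p j) := by field_simp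
    have h0 : 0 ≤ 1 - ε / p j := by rw [sub_nonneg, div_le_one hpj]; exact hε₁.le
    rw [h1, Real.mul_rpow hpj.le h0]
    have h2 : (1 - ε / p j) ≤ (1 - ε / p j) ^ β := by
      apply Real.self_le_rpow_of_le_one h0 _ hβ₁.le
      have : 0 ≤ ε / p j := by positivity
      linarith
    have h3 := mul_le_mul_of_nonneg_left h2 (Real.rpow_nonneg hpj.le β)
    refine le_trans (le_of_eq ?_) h3
    rw [Real.rpow_sub_one hpj.ne']
    field_simp
  have hεβ : 0 < ε ^ β := Real.rpow_pos_of_pos hε₀ β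
  have hsplit : ε = ε ^ β * ε ^ (1 - β) := by
    rw [← Real.rpow_add hε₀]; simp
  have h1 : r * ε ^ β ≤ ε * C := by
    have := mul_le_mul_of_nonneg_left hchord hr.le
    simp only [C]
    nlinarith
  have h2 : ε * C = ε ^ β * (ε ^ (1 - β) * C) := by
    rw [← mul_assoc, ← hsplit]
  have h3 : ε ^ β * (ε ^ (1 - β) * C) < ε ^ β * r := mul_lt_mul_of_pos_left hε hεβ
  linarith

/-- The Bregman divergence of `x ↦ -x ^ β`. -/
noncomputable def tsallisDiv (β x p : ℝ) : ℝ := p ^ β - x ^ β + β * p ^ (β - 1) * (x - p)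

/-- Bernoulli's inequality for the ratio `x / p`. -/
theorem tsallisDiv_nonneg (hβ₀ : 0 ≤ β) (hβ₁ : β ≤ 1) {x p : ℝ} (hx : 0 ≤ x) (hp : 0 < p) :
    0 ≤ tsallisDiv β x p := by
  have h0 : (0 : ℝ) ≤ x / p := by positivity
  have h1 := rpow_one_add_le_one_add_mul_self (s := x / p - 1) (by linarith) hβ₀ hβ₁
  rw [add_sub_cancel, Real.div_rpow hx hp.le] at h1
  have hpβ := Real.rpow_pos_of_pos hp β
  rw [div_le_iff₀ hpβ] at h1
  unfold tsallisDiv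
  have h2 : β * p ^ (β - 1) * (x - p) = β * (x / p - 1) * p ^ β := by
    rw [Real.rpow_sub_one hp.ne']; field_simp
  rw [h2]
  linarith

/-- The difference of the two sides vanishes at `s = 1` and is monotone on `[0, 1]`; the sign of its
derivative reduces to `y ^ (β - 1) ≥ 1 + (1 - β)(1 - y)`, which follows from `exp z ≥ 1 + z` and
`log y ≤ y - 1`. -/
theorem tsallisDiv_unit_lower (hβ₀ : 0 < β) (hβ₁ : β < 1) {s : ℝ} (hs₀ : 0 ≤ s) (hs₁ : s ≤ 1) :
    β * (1 - β) / 2 * (1 - s) ^ 2 ≤ 1 - s ^ β - β * (1 - s) := by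
  set g : ℝ → ℝ := fun s => 1 - s ^ β - β * (1 - s) - β * (1 - β) / 2 * (1 - s) ^ 2
  have hder : ∀ y ∈ Set.Ioo (0 : ℝ) 1, HasDerivAt g
      (-(β * y ^ (β - 1)) + β + β * (1 - β) * (1 - y)) y := by
    intro y hy
    have h1 := Real.hasDerivAt_rpow_const (x := y) (p := β) (Or.inl hy.1.ne')
    have h2 : HasDerivAt (fun s : ℝ => 1 - s) (-1) y := by
      simpa using (hasDerivAt_id y).const_sub 1
    have h3 := (((h1.const_sub 1).sub (h2.const_mul β)).sub
      ((h2.pow 2).const_mul (β * (1 - β) / 2)))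
    refine h3.congr_deriv ?_
    simp
    ring
  have hcont : ContinuousOn g (Set.Icc 0 1) := by
    have := Real.continuous_rpow_const hβ₀.le
    refine Continuous.continuousOn ?_
    simp only [g]
    fun_prop
  have hanti : AntitoneOn g (Set.Icc 0 1) := by
    refine antitoneOn_of_deriv_nonpos (convex_Icc 0 1) hcont ?_ ?_
    · rw [interior_Icc]
      exact fun y hy => (hder y hy).differentiableAt.differentiableWithinAt
    · rw [interior_Icc]
      intro y hy
      rw [(hder y hy).deriv]
      have h1 : 1 + (1 - β) * (1 - y) ≤ y ^ (β - 1) := by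
        rw [Real.rpow_def_of_pos hy.1]
        have h2 := Real.add_one_le_exp (Real.log y * (β - 1))
        have h3 := Real.log_le_sub_one_of_pos hy.1
        nlinarith
      nlinarith
  have h := hanti ⟨hs₀, hs₁⟩ ⟨zero_le_one, le_rfl⟩ hs₁
  simp only [g, Real.one_rpow, sub_self] at h
  linarith

/-- Homogeneity of degree `β` reduces to `p = 1`. The quadratic bound is available only below `p`,
which is why loss vectors are shifted to be nonnegative in `tsallis_stability`. -/
theorem tsallisDiv_lower (hβ₀ : 0 < β) (hβ₁ : β < 1) {x p : ℝ} (hx : 0 ≤ x) (hp : 0 < p)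
    (hxp : x ≤ p) : β * (1 - β) / 2 * (x - p) ^ 2 * p ^ (β - 2) ≤ tsallisDiv β x p := by
  have h := tsallisDiv_unit_lower hβ₀ hβ₁ (div_nonneg hx hp.le) ((div_le_one hp).2 hxp)
  have hpβ := Real.rpow_pos_of_pos hp β
  rw [Real.div_rpow hx hp.le] at h
  have h2 := mul_le_mul_of_nonneg_right h hpβ.le
  have e1 : (1 - x ^ β / p ^ β - β * (1 - x / p)) * p ^ β = tsallisDiv β x p := by
    unfold tsallisDiv
    rw [Real.rpow_sub_one hp.ne']; field_simp; ring
  have e2 : β * (1 - β) / 2 * (1 - x / p) ^ 2 * p ^ β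
      = β * (1 - β) / 2 * (x - p) ^ 2 * p ^ (β - 2) := by
    have : p ^ (β - 2) = p ^ β / p ^ 2 := by
      rw [Real.rpow_sub hp]; norm_num
    rw [this]; field_simp; ring
  linarith

/-- The closed form for exponent `1/2` turns the Corral stability bound into an algebraic identity,
with no sign restriction on `x - p`. -/
theorem tsallisDiv_half (x p : ℝ) (hx : 0 ≤ x) (hp : 0 < p) :
    tsallisDiv (1 / 2) x p = (√x - √p) ^ 2 / (2 * √p) := by
  have h1 : p ^ ((1 : ℝ) / 2 - 1) = 1 / √p := by
    rw [show (1 : ℝ) / 2 - 1 = -(1 / 2) by norm_num, Real.rpow_neg hp.le, Real.sqrt_eq_rpow, one_div,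
      one_div]
  have hsp := Real.sqrt_pos.2 hp
  unfold tsallisDiv
  rw [h1, ← Real.sqrt_eq_rpow, ← Real.sqrt_eq_rpow]
  have e1 := Real.sq_sqrt hx
  have e2 := Real.sq_sqrt hp.le
  field_simp
  nlinarith

/-- At a minimizer the one-sided derivative towards any feasible `x` is nonnegative. The objective
gap minus this derivative is exactly `r` times the Bregman divergence. -/
theorem ftrlObj_sub_ge (hβ₀ : 0 < β) (hβ₁ : β < 1) (hr : 0 < r) (hp : p ∈ supportedSimplex S)
    (hmin : IsMinOn (ftrlObj S β r L) (supportedSimplex S) p) {x : ι → ℝ}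
    (hx : x ∈ supportedSimplex S) :
    r * ∑ i ∈ S, tsallisDiv β (x i) (p i) ≤ ftrlObj S β r L x - ftrlObj S β r L p := by
  have hpos : ∀ i ∈ S, 0 < p i := fun i hi => ftrl_pos hβ₀ hβ₁ hr hp hmin hi
  set y : ℝ → ι → ℝ := fun ε i => p i + ε * (x i - p i)
  have hy : ∀ ε ∈ Set.Ioo (0 : ℝ) 1, y ε ∈ supportedSimplex S := by
    intro ε hε
    refine ⟨⟨fun i => ?_, ?_⟩, fun i hi => ?_⟩
    · have h1 := supportedSimplex_nonneg hp i
      have h2 := supportedSimplex_nonneg hx i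
      have e : y ε i = (1 - ε) * p i + ε * x i := by simp only [y]; ring
      rw [e]
      have : 0 ≤ 1 - ε := by linarith [hε.2]
      have := hε.1.le
      positivity
    · simp [y, Finset.sum_add_distrib, ← Finset.mul_sum, hp.1.2, hx.1.2]
    · simp [y, hp.2 i hi, hx.2 i hi]
  -- Differentiability at `ε = 0` uses that every coordinate of `p` in `S` is positive.
  have hder : HasDerivAt (fun ε => ftrlObj S β r L (y ε))
      (∑ i ∈ S, (x i - p i) * L i - r * ∑ i ∈ S, (x i - p i) * β * p i ^ (β - 1)) 0 := by
    have hy' : ∀ i, HasDerivAt (fun ε => y ε i) (x i - p i) 0 := fun i =>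
      (((hasDerivAt_id (0 : ℝ)).mul_const (x i - p i)).const_add (p i)).congr_deriv (one_mul _)
    refine (HasDerivAt.fun_sum fun i _ => (hy' i).mul_const (L i)).sub
      ((HasDerivAt.fun_sum fun i hi => ?_).const_mul r)
    have h := (hy' i).rpow_const (p := β) (Or.inl (by simpa [y] using (hpos i hi).ne'))
    simpa [y] using h
  have hge := ge_of_tendsto hder.tendsto_slope_zero_right (b := 0) (by
    filter_upwards [Ioo_mem_nhdsGT (zero_lt_one (α := ℝ))] with ε hε
    have h1 : ftrlObj S β r L p ≤ ftrlObj S β r L (y ε) := hmin (hy ε hε)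
    have h2 : y 0 = p := by ext i; simp [y]
    rw [zero_add, h2]
    exact smul_nonneg (inv_nonneg.2 hε.1.le) (sub_nonneg.2 h1))
  rw [ftrlObj_sub]
  have e : ∑ i ∈ S, ((x i - p i) * L i - r * (x i ^ β - p i ^ β))
      - r * ∑ i ∈ S, tsallisDiv β (x i) (p i)
      = ∑ i ∈ S, (x i - p i) * L i - r * ∑ i ∈ S, (x i - p i) * β * p i ^ (β - 1) := by
    simp only [Finset.mul_sum, ← Finset.sum_sub_distrib]
    refine Finset.sum_congr rfl fun i _ => ?_
    unfold tsallisDiv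
    ring
  linarith

/-- Equal objective values force each divergence to vanish. The strict lower bound excludes `x i < p
i`, and since both vectors have total mass one, no coordinate can exceed `p i` either. Uniqueness
removes the arbitrariness of `argminOn` and underlies measurability. -/
theorem ftrl_unique (hβ₀ : 0 < β) (hβ₁ : β < 1) (hr : 0 < r) (hp : p ∈ supportedSimplex S)
    (hmin : IsMinOn (ftrlObj S β r L) (supportedSimplex S) p) {x : ι → ℝ}
    (hx : x ∈ supportedSimplex S)
    (hxmin : IsMinOn (ftrlObj S β r L) (supportedSimplex S) x) : x = p := by
  have hpos : ∀ i ∈ S, 0 < p i := fun i hi => ftrl_pos hβ₀ hβ₁ hr hp hmin hi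
  have h1 := ftrlObj_sub_ge hβ₀ hβ₁ hr hp hmin hx
  have h2 : ftrlObj S β r L x ≤ ftrlObj S β r L p := hxmin hp
  have h3 : ∑ i ∈ S, tsallisDiv β (x i) (p i) ≤ 0 := by
    by_contra! h
    have := mul_pos hr h
    linarith
  have hnn : ∀ i ∈ S, 0 ≤ tsallisDiv β (x i) (p i) := fun i hi =>
    tsallisDiv_nonneg hβ₀.le hβ₁.le (supportedSimplex_nonneg hx i) (hpos i hi)
  have h4 := (Finset.sum_eq_zero_iff_of_nonneg hnn).1 (le_antisymm h3 (Finset.sum_nonneg hnn))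
  have hle : ∀ i ∈ S, p i ≤ x i := by
    intro i hi
    by_contra! hlt
    have h5 := tsallisDiv_lower hβ₀ hβ₁ (supportedSimplex_nonneg hx i) (hpos i hi) hlt.le
    rw [h4 i hi] at h5
    have h6 := Real.rpow_pos_of_pos (hpos i hi) (β - 2)
    have h7 : 0 < (x i - p i) ^ 2 := by
      have : x i - p i ≠ 0 := by linarith
      positivity
    have h8 : 0 < β * (1 - β) / 2 * (x i - p i) ^ 2 * p i ^ (β - 2) := by
      have : 0 < 1 - β := by linarith
      positivity
    linarith
  have h9 := (Finset.sum_eq_sum_iff_of_le hle).1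
    (by rw [supportedSimplex_sum hp, supportedSimplex_sum hx])
  ext i
  by_cases hi : i ∈ S
  · exact (h9 i hi).symm
  · rw [hx.2 i hi, hp.2 i hi]

/-- In a compact simplex, any cluster point of minimizers minimizes the limiting objective, so by
uniqueness there is just one cluster point. -/
theorem continuousOn_ftrl (hβ₀ : 0 < β) (hβ₁ : β < 1) {φ : (ι → ℝ) × ℝ → ι → ℝ}
    (hφ : ∀ z, 0 < z.2 → φ z ∈ supportedSimplex S ∧
      IsMinOn (ftrlObj S β z.2 z.1) (supportedSimplex S) (φ z)) :
    ContinuousOn φ {z | 0 < z.2} := by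
  intro z hz
  have hcont := continuous_ftrlObj S hβ₀.le
  refine (isCompact_supportedSimplex S).tendsto_nhds_of_unique_mapClusterPt
    (eventually_mem_nhdsWithin.mono fun z hz => (hφ z hz).1) fun x hx hcl => ?_
  refine ftrl_unique hβ₀ hβ₁ hz (hφ z hz).1 (hφ z hz).2 hx fun y hy => ?_
  obtain ⟨U, hU, hUx⟩ := mapClusterPt_iff_ultrafilter.1 hcl
  have hUz : Tendsto (fun w : (ι → ℝ) × ℝ => w) U (𝓝 z) := hU.trans nhdsWithin_le_nhds
  refine le_of_tendsto_of_tendsto (hcont.tendsto (z, x) |>.comp (hUz.prodMk_nhds hUx))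
    (hcont.tendsto (z, y) |>.comp (hUz.prodMk_nhds tendsto_const_nhds)) ?_
  filter_upwards [hU self_mem_nhdsWithin] with w hw
  exact (hφ w hw).2 hy

/-- The minimal value of the FTRL objective. -/
noncomputable def ftrlValue (S : Finset ι) (β r : ℝ) (L : ι → ℝ) : ℝ :=
  sInf (ftrlObj S β r L '' supportedSimplex S)

theorem continuous_ftrlValue (S : Finset ι) (hβ : 0 ≤ β) :
    Continuous fun z : (ι → ℝ) × ℝ => ftrlValue S β z.2 z.1 :=
  (isCompact_supportedSimplex S).continuous_sInf (f := fun z : (ι → ℝ) × ℝ => ftrlObj S β z.2 z.1)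
    (continuous_ftrlObj S hβ)

theorem ftrlValue_le (hβ : 0 ≤ β) {x : ι → ℝ} (hx : x ∈ supportedSimplex S) :
    ftrlValue S β r L ≤ ftrlObj S β r L x := by
  refine csInf_le (IsCompact.bddBelow ((isCompact_supportedSimplex S).image ?_)) ⟨x, hx, rfl⟩
  exact (continuous_ftrlObj S hβ).comp
    (continuous_const.prodMk continuous_id : Continuous fun x => (((L, r), x)))

theorem le_ftrlValue (hS : (supportedSimplex S).Nonempty) {c : ℝ}
    (h : ∀ x ∈ supportedSimplex S, c ≤ ftrlObj S β r L x) : c ≤ ftrlValue S β r L :=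
  le_csInf (hS.image _) (by rintro _ ⟨x, hx, rfl⟩; exact h x hx)

/-- The negative of the regret of FTRL against arm `u` that can still be accounted for: the
difference between the value of the objective at `u` and its minimum. -/
noncomputable def ftrlPotential (S : Finset ι) (β r : ℝ) (L : ι → ℝ) (u : ι) : ℝ :=
  L u - r - ftrlValue S β r L

omit [Fintype ι] in
theorem ftrlObj_single [DecidableEq ι] (hβ : β ≠ 0) {u : ι} (hu : u ∈ S) :
    ftrlObj S β r L (Pi.single u 1) = L u - r := by
  unfold ftrlObj
  rw [Finset.sum_eq_single_of_mem u hu (fun i _ hi => by simp [hi]),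
    Finset.sum_eq_single_of_mem u hu (fun i _ hi => by simp [hi, Real.zero_rpow hβ])]
  simp

theorem ftrlPotential_nonneg (hβ : 0 < β) {u : ι} (hu : u ∈ S) :
    0 ≤ ftrlPotential S β r L u := by
  classical
  have := ftrlValue_le (r := r) (L := L) hβ.le (single_mem_supportedSimplex hu)
  rw [ftrlObj_single hβ.ne' hu] at this
  unfold ftrlPotential
  linarith

theorem ftrlPotential_zero {u : ι} (hu : u ∈ S) :
    ftrlPotential S β 0 (fun _ => 0) u = 0 := by
  classical
  have h : ftrlObj S β 0 (fun _ => 0) '' supportedSimplex S = {0} := by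
    have : ∀ x, ftrlObj S β 0 (fun _ => 0) x = 0 := fun x => by simp [ftrlObj]
    ext y
    constructor
    · rintro ⟨x, _, rfl⟩
      exact this x
    · rintro rfl
      exact ⟨_, single_mem_supportedSimplex hu, this _⟩
  simp [ftrlPotential, ftrlValue, h]

/-- The minimum before the round is estimated by testing with `p`, the minimum after it by
`ftrlObj_sub_ge`. Raising the scale from `r` to `r'` costs `∑ p ^ β`, less the `1` already charged
at the vertex `u`; `σ` is the stability term. -/
theorem ftrlPotential_add_le (hβ₀ : 0 < β) (hβ₁ : β < 1) {r' σ : ℝ} (hr' : 0 < r')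
    (hp : p ∈ supportedSimplex S) (hmin : IsMinOn (ftrlObj S β r' L) (supportedSimplex S) p)
    {v : ι → ℝ} (u : ι)
    (hσ : ∀ x ∈ supportedSimplex S,
      ∑ i ∈ S, (p i - x i) * v i - r' * ∑ i ∈ S, tsallisDiv β (x i) (p i) ≤ σ) :
    ftrlPotential S β r' (fun i => L i + v i) u ≤ ftrlPotential S β r L u
      - (∑ i ∈ S, p i * v i - v u) + (r' - r) * (∑ i ∈ S, p i ^ β - 1) + σ := by
  have h1 : ftrlValue S β r L ≤ ftrlObj S β r' L p + (r' - r) * ∑ i ∈ S, p i ^ β := by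
    refine (ftrlValue_le hβ₀.le hp).trans (le_of_eq ?_)
    unfold ftrlObj; ring
  have h2 : ftrlObj S β r' L p + ∑ i ∈ S, p i * v i - σ
      ≤ ftrlValue S β r' (fun i => L i + v i) := by
    refine le_ftrlValue ⟨p, hp⟩ fun x hx => ?_
    have h3 := hσ x hx
    have h4 := ftrlObj_sub_ge hβ₀ hβ₁ hr' hp hmin hx
    have h5 : ftrlObj S β r' (fun i => L i + v i) x
        = ftrlObj S β r' L x + ∑ i ∈ S, x i * v i := by
      simp only [ftrlObj, mul_add, Finset.sum_add_distrib]; ring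
    simp only [sub_mul, Finset.sum_sub_distrib] at h3
    linarith
  unfold ftrlPotential
  linarith

end FTRL

end GraphBandit

namespace GraphBandit

/-! ## Weighted in-degree sums and independent sets -/

section Independence

open Classical in
/-- The weight of the closed in-neighbourhood of `i` within `V`. -/
noncomputable def inWeight {ι : Type*} (V : Finset ι) (R : ι → ι → Prop) (p : ι → ℝ) (i : ι) : ℝ :=
  ∑ j ∈ V.filter fun j => j = i ∨ R j i, p j

variable {ι : Type*} {V : Finset ι} {R : ι → ι → Prop} {p : ι → ℝ}

theorem inWeight_le_sum {T : Finset ι} {i : ι} (hT : ∀ j ∈ V, j = i ∨ R j i → j ∈ T)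
    (hp : ∀ j ∈ T, 0 ≤ p j) : inWeight V R p i ≤ ∑ j ∈ T, p j := by
  classical
  refine Finset.sum_le_sum_of_subset_of_nonneg (fun j hj => ?_) fun j hj _ => hp j hj
  exact hT j (Finset.mem_filter.1 hj).1 (Finset.mem_filter.1 hj).2

theorem inWeight_mono {W : Finset ι} (hp : ∀ i ∈ V, 0 < p i) (h : W ⊆ V) (i : ι) :
    inWeight W R p i ≤ inWeight V R p i := by
  classical
  exact Finset.sum_le_sum_of_subset_of_nonneg (Finset.filter_subset_filter _ h)
    fun j hj _ => (hp j (Finset.mem_filter.1 hj).1).le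

theorem self_le_inWeight (hp : ∀ i ∈ V, 0 < p i) {i : ι} (hi : i ∈ V) :
    p i ≤ inWeight V R p i := by
  classical
  exact Finset.single_le_sum (f := p) (fun j hj => (hp j (Finset.mem_filter.1 hj).1).le)
    (Finset.mem_filter.2 ⟨hi, Or.inl rfl⟩)

theorem sum_div_inWeight_anti {W : Finset ι} (hp : ∀ i ∈ V, 0 < p i) (h : W ⊆ V) {f : ι → ℝ}
    (hf : ∀ i ∈ W, 0 ≤ f i) :
    ∑ i ∈ W, f i / inWeight V R p i ≤ ∑ i ∈ W, f i / inWeight W R p i :=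
  Finset.sum_le_sum fun i hi => div_le_div_of_nonneg_left (hf i hi)
    ((hp i (h hi)).trans_le (self_le_inWeight (fun j hj => hp j (h hj)) hi))
    (inWeight_mono hp h i)

/-- Greedy construction: the closed neighbourhood of a vertex of least neighbourhood weight
contributes at most `1`. Putting that vertex into the independent set and deleting its neighbourhood
only decreases the remaining denominators. -/
theorem exists_indep_sum_div_le (G : SimpleGraph ι) (V : Finset ι) (hp : ∀ i ∈ V, 0 < p i) :
    ∃ I ⊆ V, G.IsIndepSet I ∧ ∑ i ∈ V, p i / inWeight V G.Adj p i ≤ I.card := by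
  classical
  induction V using Finset.strongInduction with
  | H V ih =>
    rcases V.eq_empty_or_nonempty with rfl | hne
    · exact ⟨∅, subset_rfl, by simp [SimpleGraph.IsIndepSet], by simp⟩
    obtain ⟨i, hi, hmin⟩ := V.exists_min_image (inWeight V G.Adj p) hne
    set N := V.filter fun j => j = i ∨ G.Adj j i
    have hNV : N ⊆ V := Finset.filter_subset _ _
    have hiN : i ∈ N := Finset.mem_filter.2 ⟨hi, Or.inl rfl⟩
    have hWV : V \ N ⊆ V := Finset.sdiff_subset
    obtain ⟨I, hI, hind, hsum⟩ := ih (V \ N)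
      (Finset.ssubset_iff_subset_ne.2 ⟨hWV, fun h => by
        rw [← h] at hi; exact (Finset.mem_sdiff.1 hi).2 hiN⟩) fun j hj => hp j (hWV hj)
    have hiI : i ∉ I := fun h => (Finset.mem_sdiff.1 (hI h)).2 hiN
    have hadj : ∀ j ∈ I, ¬ G.Adj j i := fun j hj h =>
      (Finset.mem_sdiff.1 (hI hj)).2 (Finset.mem_filter.2 ⟨hWV (hI hj), Or.inr h⟩)
    refine ⟨insert i I, Finset.insert_subset hi (hI.trans hWV), ?_, ?_⟩
    · rw [SimpleGraph.IsIndepSet, Finset.coe_insert, Set.pairwise_insert]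
      exact ⟨hind, fun j hj _ => ⟨fun h => hadj j hj h.symm, hadj j hj⟩⟩
    · rw [Finset.card_insert_of_notMem hiI, ← Finset.sum_sdiff hNV]
      push_cast
      have hiw : 0 < inWeight V G.Adj p i := (hp i hi).trans_le (self_le_inWeight hp hi)
      have h1 : ∑ j ∈ N, p j / inWeight V G.Adj p j ≤ 1 := by
        calc ∑ j ∈ N, p j / inWeight V G.Adj p j
            ≤ ∑ j ∈ N, p j / inWeight V G.Adj p i := Finset.sum_le_sum fun j hj =>
              div_le_div_of_nonneg_left (hp j (hNV hj)).le hiw (hmin j (hNV hj))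
          _ = 1 := by rw [← Finset.sum_div]; exact div_self hiw.ne'
      have h2 := sum_div_inWeight_anti (R := G.Adj) hp hWV fun j hj => (hp j (hWV hj)).le
      linarith

/-- Concavity of `s ↦ s ^ δ`, in the form that telescopes when vertices are removed one by one. -/
theorem rpow_sub_rpow_ge {δ : ℝ} (hδ₀ : 0 < δ) (hδ₁ : δ ≤ 1) {a P : ℝ} (ha : 0 < a)
    (haP : a ≤ P) : δ * (a ^ (1 + δ) / P) ≤ P ^ δ - (P - a) ^ δ := by
  have hP : 0 < P := ha.trans_le haP
  have h0 : 0 ≤ 1 - a / P := by rw [sub_nonneg, div_le_one hP]; exact haP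
  have h1 := rpow_one_add_le_one_add_mul_self (s := -(a / P)) (by linarith) hδ₀.le hδ₁
  rw [← sub_eq_add_neg] at h1
  have h2 : (P - a) ^ δ = P ^ δ * (1 - a / P) ^ δ := by
    rw [← Real.mul_rpow hP.le h0]; congr 1; field_simp
  have h3 := mul_le_mul_of_nonneg_left h1 (Real.rpow_nonneg hP.le δ)
  have h4 : a ^ δ ≤ P ^ δ := Real.rpow_le_rpow ha.le haP hδ₀.le
  have h5 : a ^ (1 + δ) / P = a ^ δ * (a / P) := by
    rw [Real.rpow_add ha, Real.rpow_one]; ring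
  have h6 := mul_le_mul_of_nonneg_right h4 (by positivity : 0 ≤ δ * (a / P))
  rw [h5, h2]
  nlinarith

/-- If every in-weight were below `P / (2 α)`, Cauchy–Schwarz would fail: `P ^ 2` is at most `∑ p_i
/ w_i` times `∑ p_i w_i` for the undirected weights `w`. The first factor is at most `α` by the
greedy bound, the second at most twice the directed sum. -/
theorem exists_inWeight_ge {α : ℝ} (hV : V.Nonempty) (hp : ∀ i ∈ V, 0 < p i)
    (hα : ∀ I ⊆ V, (SimpleGraph.fromRel R).IsIndepSet I → (I.card : ℝ) ≤ α) :
    ∃ i ∈ V, ∑ j ∈ V, p j ≤ 2 * α * inWeight V R p i := by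
  classical
  by_contra! hlt
  set P := ∑ j ∈ V, p j
  have hP : 0 < P := Finset.sum_pos hp hV
  obtain ⟨I, hIV, hI, hsum⟩ := exists_indep_sum_div_le (SimpleGraph.fromRel R) V hp
  have hα' := hsum.trans (hα I hIV hI)
  have hcs := Finset.sum_sq_le_sum_mul_sum_of_sq_le_mul V (r := p)
    (f := fun i => p i / inWeight V (SimpleGraph.fromRel R).Adj p i)
    (g := fun i => p i * inWeight V (SimpleGraph.fromRel R).Adj p i)
    (fun i hi => div_nonneg (hp i hi).le ((hp i hi).le.trans (self_le_inWeight hp hi)))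
    (fun i hi => mul_nonneg (hp i hi).le ((hp i hi).le.trans (self_le_inWeight hp hi)))
    (fun i hi => by
      have := (hp i hi).trans_le (self_le_inWeight (R := (SimpleGraph.fromRel R).Adj) hp hi)
      field_simp
      exact le_rfl)
  -- Each undirected pair is an edge in at least one direction, so the directed double sum together
  -- with its transpose dominates the undirected one.
  have hdouble : ∑ i ∈ V, p i * inWeight V (SimpleGraph.fromRel R).Adj p i
      ≤ 2 * ∑ i ∈ V, p i * inWeight V R p i := by
    have e : ∀ R' : ι → ι → Prop, ∑ i ∈ V, p i * inWeight V R' p i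
        = ∑ i ∈ V, ∑ j ∈ V, if j = i ∨ R' j i then p i * p j else 0 := fun R' => by
      simp only [inWeight, Finset.mul_sum, Finset.sum_filter, mul_ite, mul_zero]
    have e2 : ∑ i ∈ V, p i * inWeight V R p i
        = ∑ i ∈ V, ∑ j ∈ V, if i = j ∨ R i j then p j * p i else 0 := by
      rw [e, Finset.sum_comm]
    rw [two_mul]
    nth_rewrite 2 [e2]
    rw [e, e, ← Finset.sum_add_distrib]
    refine Finset.sum_le_sum fun i hi => ?_
    rw [← Finset.sum_add_distrib]
    refine Finset.sum_le_sum fun j hj => ?_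
    have hij := (mul_pos (hp i hi) (hp j hj)).le
    have hji := mul_comm (p i) (p j)
    have hsymm : (j = i ∨ (SimpleGraph.fromRel R).Adj j i) → (j = i ∨ R j i) ∨ i = j ∨ R i j := by
      rw [SimpleGraph.fromRel_adj]; tauto
    split_ifs with h1 h2 h3 h3 h2 h3 h3 <;> first | linarith | exact absurd (hsymm h1) (by tauto)
  have hnn : 0 ≤ ∑ i ∈ V, p i * inWeight V (SimpleGraph.fromRel R).Adj p i :=
    Finset.sum_nonneg fun i hi =>
      mul_nonneg (hp i hi).le ((hp i hi).le.trans (self_le_inWeight hp hi))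
  have hα₀ : 0 ≤ α := le_trans (Finset.sum_nonneg fun i hi =>
      div_nonneg (hp i hi).le ((hp i hi).le.trans (self_le_inWeight hp hi))) hα'
  have hbig : P ^ 2 ≤ ∑ i ∈ V, p i * (2 * α * inWeight V R p i) := by
    calc P ^ 2 ≤ _ := hcs
      _ ≤ α * (2 * ∑ i ∈ V, p i * inWeight V R p i) := mul_le_mul hα' hdouble hnn hα₀
      _ = _ := by simp only [Finset.mul_sum]; exact Finset.sum_congr rfl fun i _ => by ring
  have hsmall : ∑ i ∈ V, p i * (2 * α * inWeight V R p i) < ∑ i ∈ V, p i * P :=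
    Finset.sum_lt_sum_of_nonempty hV fun i hi => mul_lt_mul_of_pos_left (hlt i hi) (hp i hi)
  rw [← Finset.sum_mul] at hsmall
  nlinarith

/-- Remove a vertex whose in-weight is at least `P / (2 α)`: its term is bounded by a multiple of `P
^ δ - (P - p i) ^ δ`, and these telescope. The extra power `δ` replaces the logarithm of a smallest
probability in the usual directed-graph bound. -/
theorem sum_rpow_div_inWeight_le {α δ : ℝ} (hδ₀ : 0 < δ) (hδ₁ : δ ≤ 1) (V : Finset ι)
    (hp : ∀ i ∈ V, 0 < p i)
    (hα : ∀ I ⊆ V, (SimpleGraph.fromRel R).IsIndepSet I → (I.card : ℝ) ≤ α) :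
    ∑ i ∈ V, p i ^ (1 + δ) / inWeight V R p i ≤ 2 * α / δ * (∑ i ∈ V, p i) ^ δ := by
  classical
  induction V using Finset.strongInduction with
  | H V ih =>
    rcases V.eq_empty_or_nonempty with rfl | hne
    · simp [Real.zero_rpow hδ₀.ne']
    have hα₀ : 0 ≤ α := by
      simpa using hα ∅ (Finset.empty_subset _) (by simp [SimpleGraph.IsIndepSet])
    obtain ⟨i, hi, hle⟩ := exists_inWeight_ge hne hp hα
    have hWV := Finset.erase_subset i V
    have h1 := ih (V.erase i) (Finset.erase_ssubset hi) (fun j hj => hp j (hWV hj))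
      fun I hI => hα I (hI.trans hWV)
    have h2 := sum_div_inWeight_anti (R := R) (f := fun i => p i ^ (1 + δ)) hp hWV
      fun j hj => Real.rpow_nonneg (hp j (hWV hj)).le _
    have hsplit : ∑ j ∈ V.erase i, p j = ∑ j ∈ V, p j - p i := by
      rw [← Finset.sum_erase_add _ _ hi]; ring
    have hiP : p i ≤ ∑ j ∈ V, p j := Finset.single_le_sum (fun j hj => (hp j hj).le) hi
    have hPpos := (hp i hi).trans_le hiP
    have hiw : 0 < inWeight V R p i := (hp i hi).trans_le (self_le_inWeight hp hi)
    have h3 := rpow_sub_rpow_ge hδ₀ hδ₁ (hp i hi) hiP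
    have h4 : p i ^ (1 + δ) / inWeight V R p i ≤ 2 * α * (p i ^ (1 + δ) / ∑ j ∈ V, p j) := by
      rw [← mul_div_assoc, div_le_div_iff₀ hiw hPpos]
      have := mul_le_mul_of_nonneg_left hle (Real.rpow_nonneg (hp i hi).le (1 + δ))
      linarith
    rw [← Finset.sum_erase_add _ _ hi]
    rw [hsplit] at h1
    have h5 := mul_le_mul_of_nonneg_left h3 (by positivity : 0 ≤ 2 * α / δ)
    have h6 : 2 * α / δ * (δ * (p i ^ (1 + δ) / ∑ j ∈ V, p j))
        = 2 * α * (p i ^ (1 + δ) / ∑ j ∈ V, p j) := by field_simp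
    linarith

end Independence

end GraphBandit

namespace GraphBandit

/-! ## The base algorithm: one-step regret inequality -/

theorem argminOn_spec {X : Type*} [Nonempty X] {s : Set X} {f : X → ℝ}
    (h : ∃ x ∈ s, IsMinOn f s x) : argminOn s f ∈ s ∧ IsMinOn f s (argminOn s f) :=
  Classical.epsilon_spec (p := fun x => x ∈ s ∧ IsMinOn f s x) h

/-! ### Numerical constants and the FTRL form of the base algorithm. -/

section Constants

variable {K : ℕ}

/-- For `K ≥ 3` this makes `log K > 1`, so the Tsallis exponent lies in `(0, 1)`. It is negative for
`K = 2`, but the base algorithm then has a single arm and its play is forced. -/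
theorem log_three_gt : (1.09 : ℝ) < Real.log 3 := by
  have h1 := Real.exp_one_lt_d9
  have h2 : Real.log 3 = 1 + Real.log (3 / Real.exp 1) := by
    rw [Real.log_div (by norm_num) (Real.exp_pos 1).ne', Real.log_exp]; ring
  have h3 := Real.one_sub_inv_le_log_of_pos (x := 3 / Real.exp 1) (by positivity)
  rw [inv_div] at h3
  linarith

theorem log_card_gt (hK : 3 ≤ K) : (1.09 : ℝ) < Real.log K :=
  log_three_gt.trans_le (Real.log_le_log (by norm_num) (by exact_mod_cast hK))

theorem one_sub_tsallisExponent (K : ℕ) : 1 - tsallisExponent K = 1 / Real.log K := by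
  unfold tsallisExponent; ring

theorem tsallisExponent_lt_one (hK : 3 ≤ K) : tsallisExponent K < 1 := by
  have h := log_card_gt hK
  have : 0 < 1 / Real.log K := by positivity
  unfold tsallisExponent
  linarith

theorem tsallisExponent_ge (hK : 3 ≤ K) : 1 / 13 ≤ tsallisExponent K := by
  have h := log_card_gt hK
  have : 1 / Real.log K ≤ 12 / 13 := by
    rw [div_le_div_iff₀ (by linarith) (by norm_num)]; linarith
  unfold tsallisExponent
  linarith

theorem tsallisExponent_pos (hK : 3 ≤ K) : 0 < tsallisExponent K :=
  lt_of_lt_of_le (by norm_num) (tsallisExponent_ge hK)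

theorem one_le_indepNum (hK : 0 < K) (H : SimpleGraph (Fin K)) : 1 ≤ H.indepNum := by
  have h : H.IsIndepSet ((({⟨0, hK⟩} : Finset (Fin K))) : Set (Fin K)) := by
    simp [SimpleGraph.IsIndepSet]
  simpa using h.card_le_indepNum

theorem complexity_ge (hK : 2 ≤ K) (G : Digraph (Fin K)) {c : ℝ} (hc : c ≤ 1)
    (hc' : c ≤ Real.log K) : c ≤ complexity G := by
  have h1 := one_le_indepNum (by omega) G.toSimpleGraphStrict
  have h2 := one_le_indepNum (by omega) G.toSimpleGraphInclusive
  have h3 : 0 ≤ Real.log K := Real.log_natCast_nonneg K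
  refine le_min ?_ ?_
  · have : (1 : ℝ) ≤ weakIndepNumber G := by exact_mod_cast h1
    linarith
  · have : (1 : ℝ) ≤ indepNumber G := by exact_mod_cast h2
    nlinarith

theorem one_le_complexity (hK : 3 ≤ K) (G : Digraph (Fin K)) : 1 ≤ complexity G :=
  complexity_ge (by omega) G le_rfl (by linarith [log_card_gt hK])

/-- The factor of `-∑ x ^ β` in the objective of the base algorithm when `∑ 1 / q_s` is `W`. -/
noncomputable def tsallisScale (G : Digraph (Fin K)) (W : ℝ) : ℝ :=
  √(W * (1 + complexity G) / Real.log K) / (tsallisExponent K * (1 - tsallisExponent K))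

theorem tsallisScale_pos (hK : 3 ≤ K) (G : Digraph (Fin K)) {W : ℝ} (hW : 0 < W) :
    0 < tsallisScale G W := by
  have h1 := log_card_gt hK
  have h2 := one_le_complexity hK G
  have h3 := tsallisExponent_pos hK
  have h4 : 0 < 1 - tsallisExponent K := by linarith [tsallisExponent_lt_one hK]
  unfold tsallisScale
  positivity

theorem basePlay_objective (G : Digraph (Fin K)) (S : Finset (Fin K)) (b : BaseState K) (q : ℝ)
    (x : Fin K → ℝ) :
    ∑ i ∈ S, x i * b.cumLoss i + 1 / baseRate G b q * tsallis S x
      = ftrlObj S (tsallisExponent K) (tsallisScale G (b.cumWeight + 1 / q)) b.cumLoss x := by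
  unfold ftrlObj tsallis tsallisScale baseRate
  rw [← Finset.sum_div, one_div (√_), ← Real.sqrt_inv, inv_div]
  ring

theorem basePlay_spec (hK : 3 ≤ K) (G : Digraph (Fin K)) {S : Finset (Fin K)} (hS : S.Nonempty)
    (b : BaseState K) (q : ℝ) :
    basePlay G S b q ∈ supportedSimplex S ∧
      IsMinOn (ftrlObj S (tsallisExponent K) (tsallisScale G (b.cumWeight + 1 / q)) b.cumLoss)
        (supportedSimplex S) (basePlay G S b q) := by
  have h := exists_isMinOn_ftrlObj hS (tsallisExponent_pos hK).le
    (tsallisScale G (b.cumWeight + 1 / q)) b.cumLoss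
  unfold basePlay
  simp only [basePlay_objective]
  exact argminOn_spec h

/-- The exponent is chosen so that `(1/K) ^ β = e / K`. Coordinates below `1/K` contribute at most
`e / K` each and the others at most `e p_i`, in total at most `2 e < 6`. -/
theorem sum_rpow_tsallisExponent_le (hK : 3 ≤ K) {S : Finset (Fin K)} {p : Fin K → ℝ}
    (hp : p ∈ supportedSimplex S) : ∑ i ∈ S, p i ^ tsallisExponent K ≤ 6 := by
  have hlog := log_card_gt hK
  have hK₀ : (0 : ℝ) < K := by exact_mod_cast (by omega : 0 < K)
  have hβ₀ := tsallisExponent_pos hK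
  have hβ₁ := tsallisExponent_lt_one hK
  have hinv : ((K : ℝ)⁻¹) ^ tsallisExponent K = Real.exp 1 * (K : ℝ)⁻¹ := by
    have h1 : tsallisExponent K = -(1 / Real.log K) + 1 := by unfold tsallisExponent; ring
    have hlog' : Real.log K ≠ 0 := by linarith
    rw [h1, Real.rpow_add (by positivity), Real.rpow_one, Real.inv_rpow hK₀.le,
      ← Real.rpow_neg hK₀.le, neg_neg, Real.rpow_def_of_pos hK₀, mul_one_div_cancel hlog']
  have hterm : ∀ i ∈ S, p i ^ tsallisExponent K ≤ Real.exp 1 * (p i + (K : ℝ)⁻¹) := by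
    intro i hi
    have hpi := supportedSimplex_nonneg hp i
    have he := Real.exp_pos 1
    rcases le_total (p i) (K : ℝ)⁻¹ with h | h
    · have := Real.rpow_le_rpow hpi h hβ₀.le
      rw [hinv] at this
      nlinarith
    · have hKi : (0 : ℝ) < (K : ℝ)⁻¹ := by positivity
      have hpos := hKi.trans_le h
      have h2 := Real.rpow_le_rpow_of_nonpos hKi h (by linarith : tsallisExponent K - 1 ≤ 0)
      rw [Real.rpow_sub_one hpos.ne', Real.rpow_sub_one hKi.ne', hinv,
        mul_div_cancel_right₀ _ hKi.ne', div_le_iff₀ hpos] at h2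
      nlinarith
  have hcard : (S.card : ℝ) * (K : ℝ)⁻¹ ≤ 1 := by
    rw [← div_eq_mul_inv, div_le_one hK₀]
    exact_mod_cast (Finset.card_le_univ S).trans_eq (Fintype.card_fin K)
  have h1 := Finset.sum_le_sum hterm
  rw [← Finset.mul_sum, Finset.sum_add_distrib, supportedSimplex_sum hp, Finset.sum_const,
    nsmul_eq_mul] at h1
  have := Real.exp_one_lt_d9
  nlinarith [Real.exp_pos 1]

end Constants

/-- A constant shift `c` is invisible because `p` and `x` have the same mass. With `v - c ≥ 0` the
coordinates where `x i ≥ p i` help, and elsewhere `tsallisDiv_lower` allows completing a square. -/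
theorem tsallis_stability {ι : Type*} [Fintype ι] {S : Finset ι} {β r : ℝ} (hβ₀ : 0 < β)
    (hβ₁ : β < 1) (hr : 0 < r) {p x v : ι → ℝ} (hp : p ∈ supportedSimplex S)
    (hpos : ∀ i ∈ S, 0 < p i) (hx : x ∈ supportedSimplex S) (c : ℝ) (hv : ∀ i ∈ S, 0 ≤ v i - c) :
    ∑ i ∈ S, (p i - x i) * v i - r * ∑ i ∈ S, tsallisDiv β (x i) (p i)
      ≤ 1 / (2 * (r * (β * (1 - β)))) * ∑ i ∈ S, p i ^ (2 - β) * (v i - c) ^ 2 := by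
  have hβ₂ : 0 < 1 - β := by linarith
  have hshift : ∑ i ∈ S, (p i - x i) * v i = ∑ i ∈ S, (p i - x i) * (v i - c) := by
    simp only [mul_sub, Finset.sum_sub_distrib, ← Finset.sum_mul]
    rw [supportedSimplex_sum hp, supportedSimplex_sum hx]
    ring
  rw [hshift, Finset.mul_sum, Finset.mul_sum, ← Finset.sum_sub_distrib]
  refine Finset.sum_le_sum fun i hi => ?_
  have hpi := hpos i hi
  have hxi := supportedSimplex_nonneg hx i
  set w := v i - c
  have hw : 0 ≤ w := hv i hi
  have hP : 0 < p i ^ (2 - β) := Real.rpow_pos_of_pos hpi _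
  have hA : 0 < r * (β * (1 - β)) := by positivity
  have hrhs : 0 ≤ 1 / (2 * (r * (β * (1 - β)))) * (p i ^ (2 - β) * w ^ 2) := by positivity
  rcases le_total (p i) (x i) with h | h
  · have h1 := tsallisDiv_nonneg hβ₀.le hβ₁.le hxi hpi
    have h2 : (p i - x i) * w ≤ 0 := mul_nonpos_of_nonpos_of_nonneg (by linarith) hw
    have h3 := mul_nonneg hr.le h1
    linarith
  · have h1 := mul_le_mul_of_nonneg_left (tsallisDiv_lower hβ₀ hβ₁ hxi hpi h) hr.le
    have h2 : p i ^ (β - 2) = 1 / p i ^ (2 - β) := by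
      rw [one_div, ← Real.rpow_neg hpi.le]; congr 1; ring
    rw [h2] at h1
    set A := r * (β * (1 - β))
    set P := p i ^ (2 - β)
    have h3 : (p i - x i) * w ≤ A / 2 * (x i - p i) ^ 2 * (1 / P) + 1 / (2 * A) * (P * w ^ 2) := by
      have h4 : A / 2 * (x i - p i) ^ 2 * (1 / P) + 1 / (2 * A) * (P * w ^ 2) - (p i - x i) * w
          = (A * (p i - x i) - P * w) ^ 2 / (2 * A * P) := by
        field_simp
        ring
      have h5 : 0 ≤ (A * (p i - x i) - P * w) ^ 2 / (2 * A * P) := by positivity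
      linarith
    have h6 : r * (β * (1 - β) / 2 * (x i - p i) ^ 2 * (1 / P))
        = A / 2 * (x i - p i) ^ 2 * (1 / P) := by simp only [A]; ring
    linarith

/-! ### Observation probabilities and the independence numbers. -/

section Estimate

variable {K : ℕ} {G : Digraph (Fin K)} {S : Finset (Fin K)} {p : Fin K → ℝ}

/-- The probability that the loss of `i` is observed. -/
noncomputable def obsWeight (G : Digraph (Fin K)) (S : Finset (Fin K)) (p : Fin K → ℝ)
    (i : Fin K) : ℝ := ∑ j ∈ observers G S i, p j

theorem mem_observers {i j : Fin K} : j ∈ observers G S i ↔ j ∈ S ∧ G.Adj j i := by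
  classical
  unfold observers
  rw [Finset.mem_filter]

/-- By strong observability, an arm without a self-loop is observed by exactly the other arms. -/
theorem obsWeight_of_not_self (hG : StronglyObservable G) (hp : p ∈ supportedSimplex S)
    {i : Fin K} (hi : i ∈ S) (hii : ¬ G.Adj i i) : obsWeight G S p i = 1 - p i := by
  have h : observers G S i = S.erase i := by
    ext j
    rw [mem_observers, Finset.mem_erase]
    constructor
    · rintro ⟨h1, h2⟩
      exact ⟨by rintro rfl; exact hii h2, h1⟩
    · rintro ⟨h1, h2⟩
      exact ⟨h2, (hG i).resolve_left hii j h1⟩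
  rw [obsWeight, h, ← supportedSimplex_sum hp, ← Finset.sum_erase_add _ _ hi]
  ring

theorem obsWeight_of_self_ge (hp : p ∈ supportedSimplex S) {i : Fin K} (hi : i ∈ S)
    (hii : G.Adj i i) : p i ≤ obsWeight G S p i :=
  Finset.single_le_sum (f := p) (fun j _ => supportedSimplex_nonneg hp j)
    (mem_observers.2 ⟨hi, hii⟩)

theorem lt_one_of_two_le_card (hS : 2 ≤ S.card) (hp : p ∈ supportedSimplex S)
    (hpos : ∀ i ∈ S, 0 < p i) {i : Fin K} (hi : i ∈ S) : p i < 1 := by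
  obtain ⟨j, hj, hji⟩ := Finset.exists_mem_ne (by omega : 1 < S.card) i
  rw [← supportedSimplex_sum hp]
  exact Finset.single_lt_sum hji hi hj (hpos j hj) fun k _ _ => supportedSimplex_nonneg hp k

theorem obsWeight_pos (hG : StronglyObservable G) (hS : 2 ≤ S.card) (hp : p ∈ supportedSimplex S)
    (hpos : ∀ i ∈ S, 0 < p i) {i : Fin K} (hi : i ∈ S) : 0 < obsWeight G S p i := by
  by_cases hii : G.Adj i i
  · exact (hpos i hi).trans_le (obsWeight_of_self_ge hp hi hii)
  · rw [obsWeight_of_not_self hG hp hi hii]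
    linarith [lt_one_of_two_le_card hS hp hpos hi]

/-- For `α̃`, drop one-sided edges and use `p ^ (2 - β) ≤ p` with the greedy bound. For `α log K`,
keep the directed graph and use the extra power `δ = 1 - β = 1 / log K`, whose inverse produces the
logarithm. -/
theorem sum_self_observing_le (hK : 3 ≤ K) (G : Digraph (Fin K)) [DecidablePred fun i => G.Adj i i]
    (hp : p ∈ supportedSimplex S) (hpos : ∀ i ∈ S, 0 < p i) :
    ∑ i ∈ S.filter (fun i => G.Adj i i), p i ^ (2 - tsallisExponent K) / obsWeight G S p i
      ≤ 2 * complexity G := by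
  classical
  have hlog := log_card_gt hK
  have hβ₁ := tsallisExponent_lt_one hK
  set V := S.filter fun i => G.Adj i i
  have hVpos : ∀ i ∈ V, 0 < p i := fun i hi => hpos i (Finset.mem_filter.1 hi).1
  have hobs : ∀ R : Fin K → Fin K → Prop, (∀ j i, R j i → G.Adj j i) → ∀ i ∈ V,
      p i ^ (2 - tsallisExponent K) / obsWeight G S p i
        ≤ p i ^ (2 - tsallisExponent K) / inWeight V R p i := by
    intro R hR i hi
    refine div_le_div_of_nonneg_left (Real.rpow_nonneg (hVpos i hi).le _)
      ((hVpos i hi).trans_le (self_le_inWeight hVpos hi)) ?_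
    refine inWeight_le_sum (fun j hj hji => ?_) fun j _ => supportedSimplex_nonneg hp j
    refine mem_observers.2 ⟨(Finset.mem_filter.1 hj).1, ?_⟩
    rcases hji with rfl | h
    · exact (Finset.mem_filter.1 hj).2
    · exact hR _ _ h
  have hfirst : ∑ i ∈ V, p i ^ (2 - tsallisExponent K) / obsWeight G S p i
      ≤ weakIndepNumber G := by
    obtain ⟨I, -, hI, hsum⟩ := exists_indep_sum_div_le G.toSimpleGraphStrict V hVpos
    refine ((Finset.sum_le_sum (hobs G.toSimpleGraphStrict.Adj fun j i h => h.2.1)).trans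
      (Finset.sum_le_sum fun i hi => ?_)).trans (hsum.trans ?_)
    · refine div_le_div_of_nonneg_right ?_
        ((hVpos i hi).le.trans (self_le_inWeight hVpos hi))
      refine Real.rpow_le_self_of_le_one (hVpos i hi).le (supportedSimplex_le_one hp i) ?_
      linarith
    · exact_mod_cast hI.card_le_indepNum
  have hsecond : ∑ i ∈ V, p i ^ (2 - tsallisExponent K) / obsWeight G S p i
      ≤ 2 * (indepNumber G * Real.log K) := by
    have h := sum_rpow_div_inWeight_le (R := G.Adj) (α := indepNumber G)
      (δ := 1 / Real.log K) (by positivity) (by rw [div_le_one] <;> linarith) V hVpos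
      (fun I _ hI => Nat.cast_le.2 hI.card_le_indepNum)
    rw [show 1 + 1 / Real.log K = 2 - tsallisExponent K by unfold tsallisExponent; ring] at h
    refine (Finset.sum_le_sum (hobs G.Adj fun _ _ h => h)).trans (h.trans ?_)
    have hle : ∑ i ∈ V, p i ≤ 1 := by
      rw [← supportedSimplex_sum hp]
      exact Finset.sum_le_sum_of_subset_of_nonneg (Finset.filter_subset _ _)
        fun j _ _ => supportedSimplex_nonneg hp j
    have h1 := Real.rpow_le_one (Finset.sum_nonneg fun i hi => (hVpos i hi).le) hle
      (by positivity : 0 ≤ 1 / Real.log K)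
    have h2 : 2 * (indepNumber G : ℝ) / (1 / Real.log K) = 2 * (indepNumber G * Real.log K) := by
      field_simp
    rw [h2]
    exact mul_le_of_le_one_right (by positivity) h1
  have h0 : (0 : ℝ) ≤ weakIndepNumber G := Nat.cast_nonneg _
  have h0' : (0 : ℝ) ≤ indepNumber G * Real.log K := by positivity
  unfold complexity
  rw [mul_min_of_nonneg _ _ zero_le_two]
  exact le_min (by linarith) hsecond

end Estimate

end GraphBandit

namespace GraphBandit

/-! ### Moments of the importance-weighted loss estimates. -/

section Estimate

variable {K : ℕ} {G : Digraph (Fin K)} {S : Finset (Fin K)} {p : Fin K → ℝ}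

open Classical in
/-- The importance weight of arm `i` when `a` is played and the feedback is received. -/
noncomputable def iwFactor (G : Digraph (Fin K)) (S : Finset (Fin K)) (p : Fin K → ℝ) (q : ℝ)
    (a i : Fin K) : ℝ := if a ∈ observers G S i then 1 / (obsWeight G S p i * q) else 0

theorem baseEstimate_true (q : ℝ) {y Y : Fin K → ℝ} {a : Fin K}
    (hY : ∀ j, G.Adj a j → Y j = y j) (i : Fin K) :
    baseEstimate G S p q a True Y i
      = (y i - heavyIndicator G p i) * iwFactor G S p q a i + heavyIndicator G p i := by
  unfold baseEstimate iwFactor obsWeight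
  rw [Finset.sum_mul]
  by_cases h : a ∈ observers G S i
  · rw [if_pos ⟨trivial, h⟩, if_pos h, hY i (mem_observers.1 h).2, mul_one_div]
  · rw [if_neg (fun h' => h h'.2), if_neg h, mul_zero]

theorem baseEstimate_false (q : ℝ) (Y : Fin K → ℝ) (a i : Fin K) :
    baseEstimate G S p q a False Y i = heavyIndicator G p i := by
  simp [baseEstimate]

theorem heavyIndicator_mem (G : Digraph (Fin K)) (p : Fin K → ℝ) (i : Fin K) :
    heavyIndicator G p i = 0 ∨ heavyIndicator G p i = 1 ∧ ¬ G.Adj i i ∧ 1 / 2 < p i := by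
  classical
  unfold heavyIndicator
  split_ifs with h
  · exact Or.inr ⟨rfl, h⟩
  · exact Or.inl rfl

theorem iwFactor_nonneg (hp : p ∈ supportedSimplex S) {q : ℝ} (hq : 0 < q) (a i : Fin K) :
    0 ≤ iwFactor G S p q a i := by
  classical
  unfold iwFactor
  split_ifs
  · have : 0 ≤ obsWeight G S p i := Finset.sum_nonneg fun j _ => supportedSimplex_nonneg hp j
    positivity
  · exact le_rfl

theorem sum_mul_iwFactor_pow {q : ℝ} (n : ℕ) (i : Fin K) (hn : n ≠ 0) :
    ∑ a, p a * iwFactor G S p q a i ^ n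
      = obsWeight G S p i * (1 / (obsWeight G S p i * q)) ^ n := by
  classical
  have h : ∀ a, p a * iwFactor G S p q a i ^ n
      = if a ∈ observers G S i then p a * (1 / (obsWeight G S p i * q)) ^ n else 0 := by
    intro a
    unfold iwFactor
    split_ifs <;> simp [hn]
  rw [Finset.sum_congr rfl fun a _ => h a, Finset.sum_ite_mem, Finset.univ_inter,
    ← Finset.sum_mul]
  rfl

/-- Unbiasedness of the importance weights, averaged over both the action and the arrival of
feedback. -/
theorem mul_sum_iwFactor {q : ℝ} (hq : 0 < q) {i : Fin K} (hi : 0 < obsWeight G S p i) :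
    q * ∑ a, p a * iwFactor G S p q a i = 1 := by
  have h := sum_mul_iwFactor_pow (G := G) (S := S) (p := p) (q := q) 1 i one_ne_zero
  simp only [pow_one] at h
  rw [h]
  field_simp

theorem mul_sum_iwFactor_sq {q : ℝ} (hq : 0 < q) {i : Fin K} (hi : 0 < obsWeight G S p i) :
    q * ∑ a, p a * iwFactor G S p q a i ^ 2 = 1 / (obsWeight G S p i * q) := by
  rw [sum_mul_iwFactor_pow (G := G) (S := S) (p := p) (q := q) 2 i two_ne_zero]
  field_simp

/-- Shifting the loss estimates makes them nonnegative and keeps their second moment small. -/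
theorem exists_estimate_shift {β : ℝ} (hβ : β < 1) (hp : p ∈ supportedSimplex S)
    (hpos : ∀ i ∈ S, 0 < p i) {X y : Fin K → ℝ} (hX : ∀ i, 0 ≤ X i)
    (hy : ∀ i, y i ∈ Set.Icc (0 : ℝ) 1) :
    ∃ c : ℝ, (∀ i ∈ S,
        0 ≤ (y i - heavyIndicator G p i) * X i + heavyIndicator G p i - c) ∧
      ∑ i ∈ S, p i ^ (2 - β)
          * ((y i - heavyIndicator G p i) * X i + heavyIndicator G p i - c) ^ 2
        ≤ 1 + 2 * ∑ i ∈ S, (p i ^ (2 - β) * (1 - heavyIndicator G p i)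
            + heavyIndicator G p i * (1 - p i)) * X i ^ 2 := by
  have hP : ∀ i ∈ S, 0 ≤ p i ^ (2 - β) ∧ p i ^ (2 - β) ≤ p i := fun i hi =>
    ⟨Real.rpow_nonneg (hpos i hi).le _,
      Real.rpow_le_self_of_le_one (hpos i hi).le (supportedSimplex_le_one hp i) (by linarith)⟩
  -- At most one arm can be heavy, since its probability exceeds `1/2`; only its estimate can be
  -- negative.
  by_cases hheavy : ∃ i ∈ S, ¬ G.Adj i i ∧ 1 / 2 < p i
  · obtain ⟨k, hk, hkk, hpk⟩ := hheavy
    have hhk : heavyIndicator G p k = 1 := by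
      classical
      exact if_pos ⟨hkk, hpk⟩
    have hrest : ∑ i ∈ S.erase k, p i = 1 - p k := by
      rw [← supportedSimplex_sum hp, ← Finset.sum_erase_add _ _ hk]; ring
    have hother : ∀ i ∈ S.erase k, heavyIndicator G p i = 0 := by
      intro i hi
      refine (heavyIndicator_mem G p i).resolve_right fun h => ?_
      have := Finset.single_le_sum (f := p) (fun j _ => supportedSimplex_nonneg hp j) hi
      linarith [h.2.2]
    -- The least nonnegative shift making the heavy estimate `1 - (1 - y k) X k` nonnegative. The
    -- shifted heavy estimate is at most `1`, and the other arms pay `m ≤ X k` with total weight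
    -- only `1 - p k`.
    set m := max 0 ((1 - y k) * X k - 1)
    have hXk := hX k
    have hyk := hy k
    have hm₀ : 0 ≤ m := le_max_left _ _
    have hm₁ : m ≤ X k := max_le hXk (by nlinarith [hyk.1, hyk.2])
    have hkval : (y k - heavyIndicator G p k) * X k + heavyIndicator G p k - -m
        = max (1 - (1 - y k) * X k) 0 := by
      rw [hhk]
      simp only [m]
      rcases le_total ((1 - y k) * X k - 1) 0 with h | h
      · rw [max_eq_left h, max_eq_left (by linarith)]; ring
      · rw [max_eq_right h, max_eq_right (by linarith)]; ring
    have hval : ∀ i ∈ S.erase k, (y i - heavyIndicator G p i) * X i + heavyIndicator G p i - -m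
        = y i * X i + m := fun i hi => by rw [hother i hi]; ring
    refine ⟨-m, fun i hi => ?_, ?_⟩
    · by_cases hik : i = k
      · rw [hik, hkval]; exact le_max_right _ _
      · rw [hval i (Finset.mem_erase.2 ⟨hik, hi⟩)]
        have := mul_nonneg (hy i).1 (hX i)
        linarith
    · rw [← Finset.sum_erase_add _ _ hk, ← Finset.sum_erase_add S
        (fun i => (p i ^ (2 - β) * (1 - heavyIndicator G p i)
            + heavyIndicator G p i * (1 - p i)) * X i ^ 2) hk, hkval, hhk]
      have h1 : p k ^ (2 - β) * max (1 - (1 - y k) * X k) 0 ^ 2 ≤ 1 := by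
        have h2 : max (1 - (1 - y k) * X k) 0 ≤ 1 :=
          max_le (by nlinarith [hyk.1, hyk.2]) zero_le_one
        have h3 : max (1 - (1 - y k) * X k) 0 ^ 2 ≤ 1 := pow_le_one₀ (le_max_right _ _) h2
        exact mul_le_one₀ ((hP k hk).2.trans (supportedSimplex_le_one hp k)) (sq_nonneg _) h3
      have h2 : ∀ i ∈ S.erase k, p i ^ (2 - β)
          * ((y i - heavyIndicator G p i) * X i + heavyIndicator G p i - -m) ^ 2
          ≤ 2 * ((p i ^ (2 - β) * (1 - heavyIndicator G p i)
            + heavyIndicator G p i * (1 - p i)) * X i ^ 2) + 2 * X k ^ 2 * p i := by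
        intro i hi
        rw [hval i hi, hother i hi]
        obtain ⟨hP0, hP1⟩ := hP i (Finset.mem_of_mem_erase hi)
        have hXi := hX i
        have hyi := hy i
        have e1 : (y i * X i + m) ^ 2 ≤ 2 * X i ^ 2 + 2 * X k ^ 2 := by
          have h4 : y i * X i ≤ X i := mul_le_of_le_one_left hXi hyi.2
          have h5 : 0 ≤ y i * X i := mul_nonneg hyi.1 hXi
          have h6 : (y i * X i + m) ^ 2 ≤ (X i + X k) ^ 2 :=
            pow_le_pow_left₀ (by linarith) (by linarith) 2
          nlinarith [sq_nonneg (X i - X k)]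
        have e2 := mul_le_mul_of_nonneg_left e1 hP0
        have e3 := mul_le_mul_of_nonneg_right hP1 (by positivity : 0 ≤ 2 * X k ^ 2)
        linarith
      have h3 := Finset.sum_le_sum h2
      rw [Finset.sum_add_distrib, ← Finset.mul_sum, ← Finset.mul_sum, hrest] at h3
      linarith
  · have hzero : ∀ i ∈ S, heavyIndicator G p i = 0 := fun i hi =>
      (heavyIndicator_mem G p i).resolve_right fun h => hheavy ⟨i, hi, h.2⟩
    refine ⟨0, fun i hi => ?_, ?_⟩
    · rw [hzero i hi]
      have := mul_nonneg (hy i).1 (hX i)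
      linarith
    · rw [Finset.mul_sum]
      have h1 : ∀ i ∈ S, p i ^ (2 - β)
          * ((y i - heavyIndicator G p i) * X i + heavyIndicator G p i - 0) ^ 2
          ≤ 2 * ((p i ^ (2 - β) * (1 - heavyIndicator G p i)
            + heavyIndicator G p i * (1 - p i)) * X i ^ 2) := by
        intro i hi
        rw [hzero i hi]
        have h4 : y i * X i ≤ X i := mul_le_of_le_one_left (hX i) (hy i).2
        have h5 : 0 ≤ y i * X i := mul_nonneg (hy i).1 (hX i)
        have h6 := pow_le_pow_left₀ h5 h4 2
        have h7 := mul_le_mul_of_nonneg_left h6 (hP i hi).1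
        have h8 := mul_nonneg (hP i hi).1 (sq_nonneg (X i))
        calc _ = p i ^ (2 - β) * (y i * X i) ^ 2 := by ring
          _ ≤ _ := by linarith
      have := Finset.sum_le_sum h1
      linarith

/-- Self-observing arms contribute the graph bound. For an arm without a self-loop the denominator
is `1 - p i`: in the heavy case the numerator is also `1 - p i`, and otherwise `1 - p i ≥ 1/2`; both
cases are `O(p i)`. -/
theorem sum_second_moment_le (hK : 3 ≤ K) (hG : StronglyObservable G) (hS : 2 ≤ S.card)
    (hp : p ∈ supportedSimplex S) (hpos : ∀ i ∈ S, 0 < p i) :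
    ∑ i ∈ S, (p i ^ (2 - tsallisExponent K) * (1 - heavyIndicator G p i)
        + heavyIndicator G p i * (1 - p i)) / obsWeight G S p i ≤ 2 * complexity G + 4 := by
  classical
  have hβ₁ := tsallisExponent_lt_one hK
  rw [← Finset.sum_filter_add_sum_filter_not S fun i => G.Adj i i]
  have h1 : ∑ i ∈ S.filter (fun i => G.Adj i i),
      (p i ^ (2 - tsallisExponent K) * (1 - heavyIndicator G p i)
        + heavyIndicator G p i * (1 - p i)) / obsWeight G S p i ≤ 2 * complexity G := by
    refine le_trans (le_of_eq ?_) (sum_self_observing_le hK G hp hpos)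
    refine Finset.sum_congr rfl fun i hi => ?_
    rw [(heavyIndicator_mem G p i).resolve_right fun h => h.2.1 (Finset.mem_filter.1 hi).2]
    simp
  have h2 : ∑ i ∈ S.filter (fun i => ¬ G.Adj i i),
      (p i ^ (2 - tsallisExponent K) * (1 - heavyIndicator G p i)
        + heavyIndicator G p i * (1 - p i)) / obsWeight G S p i
      ≤ ∑ i ∈ S.filter (fun i => ¬ G.Adj i i), 4 * p i := by
    refine Finset.sum_le_sum fun i hi => ?_
    obtain ⟨hiS, hii⟩ := Finset.mem_filter.1 hi
    have hlt := lt_one_of_two_le_card hS hp hpos hiS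
    have hP := Real.rpow_le_self_of_le_one (y := 2 - tsallisExponent K) (hpos i hiS).le
      (supportedSimplex_le_one hp i) (by linarith)
    have hpi := hpos i hiS
    rw [obsWeight_of_not_self hG hp hiS hii, div_le_iff₀ (by linarith)]
    by_cases h : 1 / 2 < p i
    · have e : heavyIndicator G p i = 1 := if_pos ⟨hii, h⟩
      rw [e]
      nlinarith
    · have e : heavyIndicator G p i = 0 := if_neg fun h' => h h'.2
      rw [e]
      nlinarith
  have h3 : ∑ i ∈ S.filter (fun i => ¬ G.Adj i i), 4 * p i ≤ 4 := by
    rw [← Finset.mul_sum]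
    have : ∑ i ∈ S.filter (fun i => ¬ G.Adj i i), p i ≤ 1 := by
      rw [← supportedSimplex_sum hp]
      exact Finset.sum_le_sum_of_subset_of_nonneg (Finset.filter_subset _ _)
        fun j _ _ => supportedSimplex_nonneg hp j
    linarith
  linarith

end Estimate

/-! ### Drift of the base potential. -/

section BaseDrift

variable {K : ℕ} {G : Digraph (Fin K)} {S : Finset (Fin K)}

/-- The potential of the base algorithm with respect to the comparator `u`. -/
noncomputable def basePotential (G : Digraph (Fin K)) (S : Finset (Fin K)) (u : Fin K)
    (b : BaseState K) : ℝ :=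
  ftrlPotential S (tsallisExponent K) (tsallisScale G b.cumWeight) b.cumLoss u

/-- Makes the stability terms `(1/q) / √(∑ 1/q)` telescope. -/
theorem sqrt_add_sub_sqrt_ge {W d : ℝ} (hW : 0 ≤ W) (hd : 0 < d) :
    d / √(W + d) ≤ 2 * (√(W + d) - √W) := by
  have h1 := Real.sqrt_pos.2 (by linarith : 0 < W + d)
  have h2 := Real.sqrt_nonneg W
  have h3 := Real.sq_sqrt (by linarith : 0 ≤ W + d)
  have h4 := Real.sq_sqrt hW
  rw [div_le_iff₀ h1]
  nlinarith [sq_nonneg (√(W + d) - √W)]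

/-- The FTRL inequality is applied to each outcome separately and averaged over the action and the
update. Linear terms become true losses by unbiasedness, quadratic terms become
`sum_second_moment_le`. The shift depends on the outcome but occurs only inside `tsallis_stability`,
so the average does not see it. -/
theorem base_drift_aux (hK : 3 ≤ K) (hG : StronglyObservable G) (hS : 2 ≤ S.card)
    {b : BaseState K} (hW : 0 ≤ b.cumWeight) {q : ℝ} (hq₀ : 0 < q) (hq₁ : q ≤ 1)
    {y : Fin K → ℝ} (hy : ∀ i, y i ∈ Set.Icc (0 : ℝ) 1) {u : Fin K} (hu : u ∈ S)
    {Y : Fin K → Fin K → ℝ} (hY : ∀ a j, G.Adj a j → Y a j = y j) (a₀ : Fin K) (y₀ : Fin K → ℝ) :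
    q * ∑ a, basePlay G S b q a * basePotential G S u (baseStep G S b q a True (Y a))
        + (1 - q) * basePotential G S u (baseStep G S b q a₀ False y₀)
      ≤ basePotential G S u b - (∑ i ∈ S, basePlay G S b q i * y i - y u)
        + 5 * (tsallisScale G (b.cumWeight + 1 / q) - tsallisScale G b.cumWeight)
        + 1 / (2 * √((b.cumWeight + 1 / q) * (1 + complexity G) / Real.log K))
          * ((9 + 4 * complexity G) / q) := by
  obtain ⟨hp, hmin⟩ := basePlay_spec hK G (S := S) (Finset.card_pos.1 (by omega)) b q
  set p := basePlay G S b q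
  set β := tsallisExponent K
  set W' := b.cumWeight + 1 / q
  have hW' : 0 < W' := by have : 0 < 1 / q := by positivity
                          simp only [W']; linarith
  have hβ₀ : 0 < β := tsallisExponent_pos hK
  have hβ₁ : β < 1 := tsallisExponent_lt_one hK
  have hr := tsallisScale_pos hK G hW'
  have hpos : ∀ i ∈ S, 0 < p i := fun i hi => ftrl_pos hβ₀ hβ₁ hr hp hmin hi
  have hβ₂ : 0 < 1 - β := by linarith
  have hM := one_le_complexity hK G
  have hlog := log_card_gt hK
  set w := √(W' * (1 + complexity G) / Real.log K)
  have hw : 0 < w := Real.sqrt_pos.2 (by positivity)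
  have hscale : tsallisScale G W' * (β * (1 - β)) = w := by
    unfold tsallisScale
    rw [div_mul_cancel₀ _ (by positivity)]
  have hmono : tsallisScale G b.cumWeight ≤ tsallisScale G W' := by
    unfold tsallisScale
    have : b.cumWeight ≤ W' := by have : 0 < 1 / q := by positivity
                                  simp only [W']; linarith
    gcongr
  set h := heavyIndicator G p
  have hsum6 := sum_rpow_tsallisExponent_le hK hp
  -- the inequality for one outcome, with importance weights `X`
  have key : ∀ X : Fin K → ℝ, (∀ i, 0 ≤ X i) →
      ftrlPotential S β (tsallisScale G W') (fun i => b.cumLoss i + ((y i - h i) * X i + h i)) u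
        ≤ basePotential G S u b
          - (∑ i ∈ S, p i * ((y i - h i) * X i + h i) - ((y u - h u) * X u + h u))
          + 5 * (tsallisScale G W' - tsallisScale G b.cumWeight)
          + 1 / (2 * w) * (1 + 2 * ∑ i ∈ S, (p i ^ (2 - β) * (1 - h i) + h i * (1 - p i))
            * X i ^ 2) := by
    intro X hX
    obtain ⟨c, hc₀, hc₁⟩ := exists_estimate_shift (G := G) hβ₁ hp hpos hX hy
    have h1 := ftrlPotential_add_le (r := tsallisScale G b.cumWeight) hβ₀ hβ₁ hr hp hmin
      (v := fun i => (y i - h i) * X i + h i) u fun x hx =>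
        tsallis_stability hβ₀ hβ₁ hr hp hpos hx c hc₀
    rw [hscale] at h1
    have h2 := mul_le_mul_of_nonneg_left hc₁ (by positivity : 0 ≤ 1 / (2 * w))
    have h3 : (tsallisScale G W' - tsallisScale G b.cumWeight) * (∑ i ∈ S, p i ^ β - 1)
        ≤ (tsallisScale G W' - tsallisScale G b.cumWeight) * 5 :=
      mul_le_mul_of_nonneg_left (by linarith) (by linarith)
    unfold basePotential
    linarith
  have hstepT : ∀ a, basePotential G S u (baseStep G S b q a True (Y a))
      = ftrlPotential S β (tsallisScale G W')
        (fun i => b.cumLoss i + ((y i - h i) * iwFactor G S p q a i + h i)) u := by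
    intro a
    simp only [basePotential, baseStep]
    congr 1
    ext i
    rw [baseEstimate_true q (hY a)]
  have hstepF : basePotential G S u (baseStep G S b q a₀ False y₀)
      = ftrlPotential S β (tsallisScale G W')
        (fun i => b.cumLoss i + ((y i - h i) * 0 + h i)) u := by
    simp only [basePotential, baseStep]
    congr 1
    ext i
    rw [baseEstimate_false, mul_zero, zero_add]
  have hpuniv : ∑ a, p a = 1 := hp.1.2
  have hT : ∀ a, p a * basePotential G S u (baseStep G S b q a True (Y a)) ≤ _ := fun a =>
    mul_le_mul_of_nonneg_left ((hstepT a).le.trans (key _ fun i => iwFactor_nonneg hp hq₀ a i))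
      (supportedSimplex_nonneg hp a)
  have hTsum := mul_le_mul_of_nonneg_left (Finset.sum_le_sum fun a (_ : a ∈ Finset.univ) => hT a)
    hq₀.le
  have hF := mul_le_mul_of_nonneg_left (hstepF.le.trans (key (fun _ => 0) fun _ => le_rfl))
    (by linarith : 0 ≤ 1 - q)
  refine (add_le_add hTsum hF).trans ?_
  -- expected values
  have hmean : ∀ i ∈ S, q * ∑ a, p a * iwFactor G S p q a i = 1 := fun i hi =>
    mul_sum_iwFactor hq₀ (obsWeight_pos hG hS hp hpos hi)
  have hsq : ∀ i ∈ S, q * ∑ a, p a * iwFactor G S p q a i ^ 2 = 1 / (obsWeight G S p i * q) :=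
    fun i hi => mul_sum_iwFactor_sq hq₀ (obsWeight_pos hG hS hp hpos hi)
  have hlin : ∀ f : Fin K → ℝ, q * ∑ a, p a * ∑ i ∈ S, f i * iwFactor G S p q a i
      = ∑ i ∈ S, f i := by
    intro f
    simp only [Finset.mul_sum]
    rw [Finset.sum_comm]
    refine Finset.sum_congr rfl fun i hi => ?_
    have : f i * (q * ∑ a, p a * iwFactor G S p q a i) = f i := by rw [hmean i hi, mul_one]
    refine Eq.trans ?_ this
    simp only [Finset.mul_sum]
    exact Finset.sum_congr rfl fun a _ => by ring
  have hquad : ∀ f : Fin K → ℝ, q * ∑ a, p a * ∑ i ∈ S, f i * iwFactor G S p q a i ^ 2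
      = (∑ i ∈ S, f i / obsWeight G S p i) / q := by
    intro f
    simp only [Finset.mul_sum, Finset.sum_div]
    rw [Finset.sum_comm]
    refine Finset.sum_congr rfl fun i hi => ?_
    rw [div_div, ← mul_one_div (f i), ← hsq i hi]
    simp only [Finset.mul_sum]
    exact Finset.sum_congr rfl fun a _ => by ring
  set B := basePotential G S u b
  set D := 5 * (tsallisScale G W' - tsallisScale G b.cumWeight)
  set f : Fin K → ℝ := fun i => p i ^ (2 - β) * (1 - h i) + h i * (1 - p i)
  have e1 : ∀ a, p a * (B - (∑ i ∈ S, p i * ((y i - h i) * iwFactor G S p q a i + h i)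
        - ((y u - h u) * iwFactor G S p q a u + h u)) + D
        + 1 / (2 * w) * (1 + 2 * ∑ i ∈ S, f i * iwFactor G S p q a i ^ 2))
      = p a * (B - ∑ i ∈ S, p i * h i + h u + D + 1 / (2 * w))
        - p a * (∑ i ∈ S, p i * (y i - h i) * iwFactor G S p q a i)
        + (y u - h u) * (p a * iwFactor G S p q a u)
        + 1 / w * (p a * ∑ i ∈ S, f i * iwFactor G S p q a i ^ 2) := by
    intro a
    have : ∑ i ∈ S, p i * ((y i - h i) * iwFactor G S p q a i + h i)
        = ∑ i ∈ S, p i * (y i - h i) * iwFactor G S p q a i + ∑ i ∈ S, p i * h i := by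
      rw [← Finset.sum_add_distrib]
      exact Finset.sum_congr rfl fun i _ => by ring
    rw [this]
    field_simp
    ring
  have e2 : q * ∑ a, p a * (B - (∑ i ∈ S, p i * ((y i - h i) * iwFactor G S p q a i + h i)
        - ((y u - h u) * iwFactor G S p q a u + h u)) + D
        + 1 / (2 * w) * (1 + 2 * ∑ i ∈ S, f i * iwFactor G S p q a i ^ 2))
      = q * (B - ∑ i ∈ S, p i * h i + h u + D + 1 / (2 * w)) - ∑ i ∈ S, p i * (y i - h i)
        + (y u - h u) + 1 / w * ((∑ i ∈ S, f i / obsWeight G S p i) / q) := by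
    rw [Finset.sum_congr rfl fun a _ => e1 a, Finset.sum_add_distrib, Finset.sum_add_distrib,
      Finset.sum_sub_distrib, ← Finset.sum_mul, hpuniv, ← Finset.mul_sum, ← Finset.mul_sum,
      mul_add, mul_add, mul_sub, hlin, mul_left_comm q (y u - h u), mul_left_comm q (1 / w), hmean u hu, hquad]
    ring
  have e3 : ∑ i ∈ S, p i * (y i - h i) = ∑ i ∈ S, p i * y i - ∑ i ∈ S, p i * h i := by
    rw [← Finset.sum_sub_distrib]
    exact Finset.sum_congr rfl fun i _ => by ring
  have e4 : ∑ i ∈ S, f i * (0 : ℝ) ^ 2 = 0 := by simp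
  have e5 : ∑ i ∈ S, p i * ((y i - h i) * 0 + h i) = ∑ i ∈ S, p i * h i := by simp
  rw [e2, e3, e4, e5]
  have hmom := sum_second_moment_le hK hG hS hp hpos
  have e6 : 1 / w * ((∑ i ∈ S, f i / obsWeight G S p i) / q)
      ≤ 1 / w * ((2 * complexity G + 4) / q) := by
    have : ∑ i ∈ S, f i / obsWeight G S p i ≤ 2 * complexity G + 4 := hmom
    gcongr
  have e7 : 1 / (2 * w) ≤ 1 / (2 * w) * (1 / q) := by
    refine le_mul_of_one_le_right (by positivity) ?_
    rw [le_div_iff₀ hq₀]; linarith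
  -- The `9 + 4 M` is `1 + 2 (2 M + 4)`: the `1` from the heavy arm, the rest twice the
  -- second-moment bound.
  have e8 : 1 / (2 * w) * ((9 + 4 * complexity G) / q)
      = 1 / (2 * w) * (1 / q) + 1 / w * ((2 * complexity G + 4) / q) := by
    field_simp
    ring
  rw [e8]
  linarith

/-- Penalty and stability are both multiples of `√(M log K)` times the increment of `√(∑ 1/q)`. Only
half of the increment of `√(c₁ ∑ 1/q)` is used, which leaves room for the factor `1 - lo ≤ 2` when
losses are scaled back in `iwStable_erase`. -/
theorem base_drift (hK : 3 ≤ K) (hG : StronglyObservable G) (hS : 2 ≤ S.card) {κ : ℝ}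
    (hκ : 90000 ≤ κ) {b : BaseState K} (hW : 0 ≤ b.cumWeight) {q : ℝ} (hq₀ : 0 < q) (hq₁ : q ≤ 1)
    {y : Fin K → ℝ} (hy : ∀ i, y i ∈ Set.Icc (0 : ℝ) 1) {u : Fin K} (hu : u ∈ S)
    {Y : Fin K → Fin K → ℝ} (hY : ∀ a j, G.Adj a j → Y a j = y j) (a₀ : Fin K) (y₀ : Fin K → ℝ) :
    q * ∑ a, basePlay G S b q a * basePotential G S u (baseStep G S b q a True (Y a))
        + (1 - q) * basePotential G S u (baseStep G S b q a₀ False y₀)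
      ≤ basePotential G S u b - (∑ i ∈ S, basePlay G S b q i * y i - y u)
        + (√(stabConst κ G * (b.cumWeight + 1 / q)) - √(stabConst κ G * b.cumWeight)) / 2 := by
  refine (base_drift_aux hK hG hS hW hq₀ hq₁ hy hu hY a₀ y₀).trans ?_
  have hM := one_le_complexity hK G
  have hlog := log_card_gt hK
  have hβ := tsallisExponent_ge hK
  have hβ₁ := tsallisExponent_lt_one hK
  set M := complexity G
  set W := b.cumWeight
  set Λ := Real.log K
  have hd : 0 < 1 / q := by positivity
  have hdiff := sqrt_add_sub_sqrt_ge hW hd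
  have hsW' := Real.sqrt_pos.2 (by linarith : 0 < W + 1 / q)
  set R := √((1 + M) * Λ)
  have hR : 0 < R := Real.sqrt_pos.2 (by positivity)
  have hsc : ∀ V : ℝ, 0 ≤ V → √(V * (1 + M) / Λ) = √V * R / Λ := by
    intro V hV
    have : V * (1 + M) / Λ = V * ((1 + M) * Λ) / Λ ^ 2 := by field_simp
    rw [this, Real.sqrt_div (by positivity), Real.sqrt_sq (by linarith), Real.sqrt_mul hV]
  have hst : ∀ V : ℝ, 0 ≤ V → √(stabConst κ G * V) = √(κ * (M * Λ)) * √V := by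
    intro V hV
    rw [← Real.sqrt_mul (by positivity)]
    congr 1
    unfold stabConst
    ring
  -- This is where `κ ≥ 90000 = 300 ^ 2` enters: the total `(5 * 13 + 7) * 3 / 2 = 108` must be
  -- below `300 / 2`.
  have hcoef : 300 * √(M * Λ) ≤ √(κ * (M * Λ)) := by
    rw [Real.sqrt_mul (by linarith : 0 ≤ κ)]
    have : (300 : ℝ) ≤ √κ := Real.le_sqrt_of_sq_le (by linarith)
    gcongr
  have hRM : R ≤ 3 / 2 * √(M * Λ) := by
    refine Real.sqrt_le_iff.2 ⟨by positivity, ?_⟩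
    rw [mul_pow, Real.sq_sqrt (by positivity)]
    nlinarith [mul_nonneg (sub_nonneg.2 hM) (by linarith : 0 ≤ Λ)]
  have h1 : tsallisScale G (W + 1 / q) - tsallisScale G W ≤ 13 * R * (√(W + 1 / q) - √W) := by
    unfold tsallisScale
    rw [hsc _ (by linarith), hsc _ hW, one_sub_tsallisExponent]
    have hpos : 0 ≤ √(W + 1 / q) - √W := by
      rw [sub_nonneg]; exact Real.sqrt_le_sqrt (by linarith)
    have e : √(W + 1 / q) * R / Λ / (tsallisExponent K * (1 / Λ))
        - √W * R / Λ / (tsallisExponent K * (1 / Λ))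
        = 1 / tsallisExponent K * (R * (√(W + 1 / q) - √W)) := by
      have : tsallisExponent K ≠ 0 := by linarith
      field_simp
    rw [e, mul_assoc]
    refine mul_le_mul_of_nonneg_right ?_ (by positivity)
    rw [div_le_iff₀ (by linarith)]
    linarith
  have h2 : 1 / (2 * √((W + 1 / q) * (1 + M) / Λ)) * ((9 + 4 * M) / q)
      ≤ 7 * R * (√(W + 1 / q) - √W) := by
    rw [hsc _ (by linarith)]
    have hRsq : R ^ 2 = (1 + M) * Λ := Real.sq_sqrt (by positivity)
    have e : 1 / (2 * (√(W + 1 / q) * R / Λ)) * ((9 + 4 * M) / q)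
        = (9 + 4 * M) * Λ / (2 * R) * (1 / q / √(W + 1 / q)) := by field_simp
    rw [e]
    have h3 : (9 + 4 * M) * Λ / (2 * R) ≤ 7 / 2 * R := by
      rw [div_le_iff₀ (by positivity)]
      nlinarith [mul_nonneg (sub_nonneg.2 hM) (by linarith : 0 ≤ Λ)]
    calc _ ≤ 7 / 2 * R * (1 / q / √(W + 1 / q)) := by gcongr
      _ ≤ 7 / 2 * R * (2 * (√(W + 1 / q) - √W)) := by gcongr
      _ = _ := by ring
  rw [hst _ (by linarith), hst _ hW]
  have hpos : 0 ≤ √(W + 1 / q) - √W := by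
    rw [sub_nonneg]; exact Real.sqrt_le_sqrt (by linarith)
  have h3 : 72 * R * (√(W + 1 / q) - √W) ≤ √(κ * (M * Λ)) / 2 * (√(W + 1 / q) - √W) := by
    refine mul_le_mul_of_nonneg_right ?_ hpos
    linarith
  linarith

end BaseDrift

end GraphBandit

namespace GraphBandit

/-! ## The second reduction: one-step regret inequality -/

/-- In the variables `√p`, `√x` the gap is a square plus `(√x - √p) ^ 2` times a quantity made
nonnegative by `hv`. Thus moderately negative losses are allowed, as needed for the bonus. -/
theorem sqrt_tsallis_stability {ι : Type*} [Fintype ι] {S : Finset ι} {w : ℝ} (hw : 0 < w)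
    {p x v : ι → ℝ} (hp : p ∈ supportedSimplex S) (hpos : ∀ i ∈ S, 0 < p i)
    (hx : x ∈ supportedSimplex S) (c : ℝ) (hv : ∀ i ∈ S, -(w / 2) ≤ (v i - c) * √(p i)) :
    ∑ i ∈ S, (p i - x i) * v i - 2 * w * ∑ i ∈ S, tsallisDiv (1 / 2) (x i) (p i)
      ≤ 2 / w * ∑ i ∈ S, p i * √(p i) * (v i - c) ^ 2 := by
  have hshift : ∑ i ∈ S, (p i - x i) * v i = ∑ i ∈ S, (p i - x i) * (v i - c) := by
    simp only [mul_sub, Finset.sum_sub_distrib, ← Finset.sum_mul]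
    rw [supportedSimplex_sum hp, supportedSimplex_sum hx]
    ring
  rw [hshift, Finset.mul_sum, Finset.mul_sum, ← Finset.sum_sub_distrib]
  refine Finset.sum_le_sum fun i hi => ?_
  have hxi := supportedSimplex_nonneg hx i
  rw [tsallisDiv_half _ _ hxi (hpos i hi)]
  have ha := Real.sqrt_pos.2 (hpos i hi)
  have hvi := hv i hi
  have e1 := Real.sq_sqrt hxi
  have e2 := Real.sq_sqrt (hpos i hi).le
  set a := √(p i)
  set s := √(x i)
  set m := v i - c
  rw [← e1, ← e2]
  have h1 : 0 ≤ w / (2 * a) + m := by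
    have : w / (2 * a) + m = (w / 2 + m * a) / a := by field_simp
    rw [this]
    exact div_nonneg (by linarith) ha.le
  have h2 : 2 / w * (a ^ 2 * a * m ^ 2) - ((a ^ 2 - s ^ 2) * m
      - 2 * w * ((s - a) ^ 2 / (2 * a)))
      = (w * (s - a) + 2 * a ^ 2 * m) ^ 2 / (2 * w * a)
        + (s - a) ^ 2 * (w / (2 * a) + m) := by
    field_simp
    ring
  have h3 : 0 ≤ (w * (s - a) + 2 * a ^ 2 * m) ^ 2 / (2 * w * a)
        + (s - a) ^ 2 * (w / (2 * a) + m) := by positivity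
  linarith

/-! ### Corral weights, bonus increments and surrogate losses. -/

section Corral

variable {K : ℕ} {G : Digraph (Fin K)} {c₁ : ℝ}

/-- The cumulative losses minus the bonus. -/
noncomputable def corralLoss (c₁ : ℝ) (s : CorralState K) (i : Fin 2) : ℝ :=
  s.cumZ i - if i = 1 then corralBonus c₁ s else 0

/-- The factor of the regularizer after `n` rounds. -/
noncomputable def corralScale (c₁ : ℝ) (n : ℕ) : ℝ :=
  if n = 0 then 0 else 2 * (√(n : ℝ) + 8 * √c₁)

/-- The potential of the second reduction with respect to comparator `i`. -/
noncomputable def corralPotential (c₁ : ℝ) (i : Fin 2) (s : CorralState K) : ℝ :=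
  ftrlPotential Finset.univ (1 / 2) (corralScale c₁ s.rounds) (corralLoss c₁ s) i

theorem corralScale_succ_pos (c₁ : ℝ) (n : ℕ) : 0 < corralScale c₁ (n + 1) := by
  unfold corralScale
  rw [if_neg (Nat.succ_ne_zero n)]
  positivity

theorem corralUnmixed_spec (c₁ : ℝ) (s : CorralState K) :
    corralUnmixed c₁ s ∈ supportedSimplex Finset.univ ∧
      IsMinOn (ftrlObj Finset.univ (1 / 2) (corralScale c₁ (s.rounds + 1)) (corralLoss c₁ s))
        (supportedSimplex Finset.univ) (corralUnmixed c₁ s) := by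
  have h := exists_isMinOn_ftrlObj (S := (Finset.univ : Finset (Fin 2))) Finset.univ_nonempty
    (β := 1 / 2) (by norm_num) (corralScale c₁ (s.rounds + 1)) (corralLoss c₁ s)
  have hs : supportedSimplex (Finset.univ : Finset (Fin 2)) = stdSimplex ℝ (Fin 2) := by
    ext x; simp [supportedSimplex]
  have hobj : ∀ q : Fin 2 → ℝ, q 0 * s.cumZ 0 + q 1 * (s.cumZ 1 - corralBonus c₁ s)
      - 2 * (√((s.rounds + 1 : ℕ) : ℝ) + 8 * √c₁) * ∑ i, √(q i)
      = ftrlObj Finset.univ (1 / 2) (corralScale c₁ (s.rounds + 1)) (corralLoss c₁ s) q := by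
    intro q
    simp [ftrlObj, corralScale, corralLoss, Real.sqrt_eq_rpow]
  rw [hs] at h ⊢
  unfold corralUnmixed
  simp only [hobj]
  exact argminOn_spec h

theorem corralUnmixed_pos (c₁ : ℝ) (s : CorralState K) (i : Fin 2) : 0 < corralUnmixed c₁ s i :=
  ftrl_pos (by norm_num) (by norm_num) (corralScale_succ_pos c₁ _) (corralUnmixed_spec c₁ s).1
    (corralUnmixed_spec c₁ s).2 (Finset.mem_univ i)

theorem corralUnmixed_sum (c₁ : ℝ) (s : CorralState K) :
    corralUnmixed c₁ s 0 + corralUnmixed c₁ s 1 = 1 := by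
  simpa using (corralUnmixed_spec c₁ s).1.1.2

theorem corralWeights_sum (c₁ : ℝ) (s : CorralState K) :
    corralWeights c₁ s 0 + corralWeights c₁ s 1 = 1 := by
  have h := corralUnmixed_sum c₁ s
  unfold corralWeights
  have ht : (((s.rounds + 1 : ℕ) : ℝ)) ≠ 0 := by positivity
  field_simp
  linear_combination (2 * ((s.rounds + 1 : ℕ) : ℝ) ^ 2 - 1) * 4 * h

theorem one_div_sq_round_le (s : CorralState K) : 1 / (2 * ((s.rounds + 1 : ℕ) : ℝ) ^ 2) ≤ 1 / 2 := by
  have ht : (1 : ℝ) ≤ ((s.rounds + 1 : ℕ) : ℝ) := by simp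
  rw [div_le_div_iff₀ (by positivity) (by norm_num)]
  nlinarith

/-- The mixing coefficient is at most `1/2`, even in the initial round, so mixed and unmixed weights
are interchangeable up to a factor in this direction. -/
theorem corralUnmixed_le (c₁ : ℝ) (s : CorralState K) (i : Fin 2) :
    corralUnmixed c₁ s i ≤ 2 * corralWeights c₁ s i := by
  have h1 := one_div_sq_round_le s
  have h2 := corralUnmixed_pos c₁ s i
  have h3 : 0 ≤ 1 / (4 * ((s.rounds + 1 : ℕ) : ℝ) ^ 2) := by positivity
  unfold corralWeights
  nlinarith

theorem corralWeights_ge (c₁ : ℝ) (s : CorralState K) (i : Fin 2) :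
    1 / (4 * ((s.rounds + 1 : ℕ) : ℝ) ^ 2) ≤ corralWeights c₁ s i := by
  have h1 := one_div_sq_round_le s
  have h2 := corralUnmixed_pos c₁ s i
  unfold corralWeights
  nlinarith

theorem corralWeights_pos (c₁ : ℝ) (s : CorralState K) (i : Fin 2) : 0 < corralWeights c₁ s i :=
  lt_of_lt_of_le (by positivity) (corralWeights_ge c₁ s i)

theorem corralWeights_le_one (c₁ : ℝ) (s : CorralState K) (i : Fin 2) :
    corralWeights c₁ s i ≤ 1 := by
  have h := corralWeights_sum c₁ s
  have h0 := corralWeights_pos c₁ s 0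
  have h1 := corralWeights_pos c₁ s 1
  fin_cases i
  · show corralWeights c₁ s 0 ≤ 1
    linarith
  · show corralWeights c₁ s 1 ≤ 1
    linarith

theorem abs_corralWeights_sub_le (c₁ : ℝ) (s : CorralState K) (i : Fin 2) :
    |corralWeights c₁ s i - corralUnmixed c₁ s i| ≤ 1 / (4 * ((s.rounds + 1 : ℕ) : ℝ) ^ 2) := by
  have h1 := supportedSimplex_le_one (corralUnmixed_spec c₁ s).1 i
  have h2 := corralUnmixed_pos c₁ s i
  have e : 1 / (2 * ((s.rounds + 1 : ℕ) : ℝ) ^ 2) = 2 * (1 / (4 * ((s.rounds + 1 : ℕ) : ℝ) ^ 2)) := by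
    field_simp; norm_num
  have h3 : 0 ≤ 1 / (4 * ((s.rounds + 1 : ℕ) : ℝ) ^ 2) := by positivity
  unfold corralWeights
  rw [e, abs_le]
  constructor <;> nlinarith

/-- Bound on the one-step regret of the second reduction. -/
noncomputable def corralRate (c₁ : ℝ) (s : CorralState K) : ℝ :=
  108 * √c₁ * (√(corralWeights c₁ s 1 / ((s.rounds + 1 : ℕ) : ℝ))
    + 1 / √(s.base.cumWeight + 1 / corralWeights c₁ s 1))

/-- The bonus increment. -/
noncomputable def corralBonusIncr (c₁ : ℝ) (s : CorralState K) : ℝ :=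
  √(c₁ * (s.base.cumWeight + 1 / corralWeights c₁ s 1)) - √(c₁ * s.base.cumWeight)

theorem corralBonusIncr_eq (hc : 0 ≤ c₁) (s : CorralState K) : corralBonusIncr c₁ s
    = √c₁ * (√(s.base.cumWeight + 1 / corralWeights c₁ s 1) - √s.base.cumWeight) := by
  unfold corralBonusIncr
  rw [Real.sqrt_mul hc, Real.sqrt_mul hc]
  ring

theorem corralBonusIncr_nonneg (hc : 0 ≤ c₁) (s : CorralState K) :
    0 ≤ corralBonusIncr c₁ s := by
  have := corralWeights_pos c₁ s 1
  have h : 0 ≤ 1 / corralWeights c₁ s 1 := by positivity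
  unfold corralBonusIncr
  rw [sub_nonneg]
  exact Real.sqrt_le_sqrt (by nlinarith)

/-- The increment `√(W + 1/q) - √W` is at most `(1/q) / √(W + 1/q)`. -/
theorem corralBonusIncr_mul_weight_le (hc : 0 ≤ c₁) (s : CorralState K)
    (hW : 0 ≤ s.base.cumWeight) : corralBonusIncr c₁ s * corralWeights c₁ s 1
      ≤ √c₁ * (1 / √(s.base.cumWeight + 1 / corralWeights c₁ s 1)) := by
  have hq := corralWeights_pos c₁ s 1
  rw [corralBonusIncr_eq hc]
  set W := s.base.cumWeight
  set q := corralWeights c₁ s 1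
  have hd : 0 < 1 / q := by positivity
  have h1 := Real.sqrt_pos.2 (by linarith : 0 < W + 1 / q)
  have h2 := Real.sq_sqrt (by linarith : 0 ≤ W + 1 / q)
  have h3 := Real.sq_sqrt hW
  have h4 : √W ≤ √(W + 1 / q) := Real.sqrt_le_sqrt (by linarith)
  rw [mul_assoc]
  refine mul_le_mul_of_nonneg_left ?_ (Real.sqrt_nonneg _)
  rw [le_div_iff₀ h1]
  have h5 : (√(W + 1 / q) - √W) * √(W + 1 / q) ≤ 1 / q := by nlinarith [Real.sqrt_nonneg W]
  calc (√(W + 1 / q) - √W) * q * √(W + 1 / q) = (√(W + 1 / q) - √W) * √(W + 1 / q) * q := by ring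
    _ ≤ 1 / q * q := by gcongr
    _ = 1 := by field_simp

/-- Subadditivity of the square root bounds the increment by `√(c₁ / q)`. In the local norm of the
regularizer it is therefore `O(√c₁)`, which the summand `8 √c₁` of the inverse learning rate
dominates. -/
theorem corralBonusIncr_mul_sqrt_le (hc : 0 ≤ c₁) (s : CorralState K)
    (hW : 0 ≤ s.base.cumWeight) :
    corralBonusIncr c₁ s * √(corralUnmixed c₁ s 1) ≤ 3 / 2 * √c₁ := by
  have hq := corralWeights_pos c₁ s 1
  have hle : √(corralUnmixed c₁ s 1) ≤ √2 * √(corralWeights c₁ s 1) := by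
    rw [← Real.sqrt_mul zero_le_two]
    exact Real.sqrt_le_sqrt (corralUnmixed_le c₁ s 1)
  have hb := corralBonusIncr_nonneg hc s
  have h1 : corralBonusIncr c₁ s ≤ √c₁ * √(1 / corralWeights c₁ s 1) := by
    rw [corralBonusIncr_eq hc]
    refine mul_le_mul_of_nonneg_left ?_ (Real.sqrt_nonneg _)
    have hd : 0 ≤ 1 / corralWeights c₁ s 1 := by positivity
    rw [sub_le_iff_le_add, Real.sqrt_le_left (by positivity), add_sq, Real.sq_sqrt hd,
      Real.sq_sqrt hW]
    nlinarith [mul_nonneg (Real.sqrt_nonneg (1 / corralWeights c₁ s 1))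
      (Real.sqrt_nonneg s.base.cumWeight)]
  have h2 : √(1 / corralWeights c₁ s 1) * √(corralWeights c₁ s 1) = 1 := by
    rw [← Real.sqrt_mul (by positivity), one_div_mul_cancel hq.ne', Real.sqrt_one]
  have h3 : √2 ≤ 3 / 2 := by
    rw [Real.sqrt_le_left (by norm_num)]; norm_num
  calc corralBonusIncr c₁ s * √(corralUnmixed c₁ s 1)
      ≤ √c₁ * √(1 / corralWeights c₁ s 1) * (√2 * √(corralWeights c₁ s 1)) := by gcongr
    _ = √2 * √c₁ * (√(1 / corralWeights c₁ s 1) * √(corralWeights c₁ s 1)) := by ring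
    _ ≤ _ := by rw [h2, mul_one]; gcongr

/-- The scale starts at `0`, so the whole initial value `2 (1 + 8 √c₁) ≤ 18 √c₁` counts as the first
increment. -/
theorem corralScale_diff_le (hc : 1 ≤ c₁) (n : ℕ) :
    corralScale c₁ (n + 1) - corralScale c₁ n ≤ 18 * √c₁ / √((n + 1 : ℕ) : ℝ) := by
  have hs : 1 ≤ √c₁ := Real.one_le_sqrt.2 hc
  unfold corralScale
  rw [if_neg (Nat.succ_ne_zero n)]
  split_ifs with h
  · subst h
    simp
    linarith
  · have h1 := Real.sqrt_pos.2 (by positivity : (0 : ℝ) < ((n + 1 : ℕ) : ℝ))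
    rw [le_div_iff₀ h1]
    have h2 := Real.sq_sqrt (by positivity : (0 : ℝ) ≤ ((n + 1 : ℕ) : ℝ))
    have h3 := Real.sq_sqrt (by positivity : (0 : ℝ) ≤ (n : ℝ))
    have h4 : √(n : ℝ) ≤ √((n + 1 : ℕ) : ℝ) := Real.sqrt_le_sqrt (by push_cast; linarith)
    push_cast at *
    nlinarith [Real.sqrt_nonneg (n : ℝ)]

theorem corralScale_mono (c₁ : ℝ) (n : ℕ) : corralScale c₁ n ≤ corralScale c₁ (n + 1) := by
  unfold corralScale
  rw [if_neg (Nat.succ_ne_zero n)]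
  split_ifs with h
  · positivity
  · gcongr
    simp

/-- The loss vector of the second reduction when the played index is `k` and the shifted surrogate
loss is `m`. -/
noncomputable def corralIncr (c₁ : ℝ) (s : CorralState K) (k : Fin 2) (m : ℝ) (i : Fin 2) : ℝ :=
  m * (if i = k then 1 else 0) / corralWeights c₁ s i - 1
    - if i = 1 then corralBonusIncr c₁ s else 0

/-- The stability term when the played index is `k`. -/
noncomputable def corralStab (c₁ : ℝ) (s : CorralState K) (k : Fin 2) : ℝ :=
  2 / (√((s.rounds + 1 : ℕ) : ℝ) + 8 * √c₁) * ∑ i, corralUnmixed c₁ s i * √(corralUnmixed c₁ s i)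
    * (8 * ((if i = k then 1 else 0) / corralWeights c₁ s i - 1) ^ 2
      + 2 * (if i = 1 then corralBonusIncr c₁ s else 0) ^ 2)

/-- The shift is by `m - 1`: the unplayed index keeps `-m` and the played one `m (1/q - 1)`, apart
from the bonus. This centring gives a second moment that vanishes as either weight tends to one. -/
theorem corralPotential_incr_le (hc : 1 ≤ c₁) (s : CorralState K) (hW : 0 ≤ s.base.cumWeight)
    (k e : Fin 2) {m : ℝ} (hm₀ : 0 ≤ m) (hm₂ : m ≤ 2) :
    ftrlPotential Finset.univ (1 / 2) (corralScale c₁ (s.rounds + 1))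
        (fun i => corralLoss c₁ s i + corralIncr c₁ s k m i) e
      ≤ corralPotential c₁ e s
        - (∑ i, corralUnmixed c₁ s i * corralIncr c₁ s k m i - corralIncr c₁ s k m e)
        + (corralScale c₁ (s.rounds + 1) - corralScale c₁ s.rounds)
          * (∑ i, √(corralUnmixed c₁ s i) - 1)
        + corralStab c₁ s k := by
  obtain ⟨hp, hmin⟩ := corralUnmixed_spec c₁ s
  have hpos := corralUnmixed_pos c₁ s
  have hr := corralScale_succ_pos c₁ s.rounds
  have hs1 : 1 ≤ √c₁ := Real.one_le_sqrt.2 hc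
  set w := √((s.rounds + 1 : ℕ) : ℝ) + 8 * √c₁
  have hw : 8 * √c₁ ≤ w := le_add_of_nonneg_left (Real.sqrt_nonneg _)
  have hw₀ : 0 < w := by linarith
  have hrw : corralScale c₁ (s.rounds + 1) = 2 * w := by
    unfold corralScale
    rw [if_neg (Nat.succ_ne_zero _)]
  have hval : ∀ i, corralIncr c₁ s k m i - (m - 1)
      = m * ((if i = k then 1 else 0) / corralWeights c₁ s i - 1)
        - if i = 1 then corralBonusIncr c₁ s else 0 := fun i => by
    unfold corralIncr; ring
  have hb := corralBonusIncr_nonneg (zero_le_one.trans hc) s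
  have hbs := corralBonusIncr_mul_sqrt_le (zero_le_one.trans hc) s hW
  -- The lower bound `-2 - (3/2) √c₁` is above `-4 √c₁ ≥ -w/2`, because `√c₁ ≥ 1`.
  have hlow : ∀ i ∈ Finset.univ, -(w / 2)
      ≤ (corralIncr c₁ s k m i - (m - 1)) * √(corralUnmixed c₁ s i) := by
    intro i _
    rw [hval]
    have h1 : √(corralUnmixed c₁ s i) ≤ 1 :=
      Real.sqrt_le_one.2 (supportedSimplex_le_one hp i)
    have h0 := Real.sqrt_nonneg (corralUnmixed c₁ s i)
    have hI : 0 ≤ (if i = k then (1 : ℝ) else 0) / corralWeights c₁ s i :=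
      div_nonneg (by split_ifs <;> norm_num) (corralWeights_pos c₁ s i).le
    have h2 : -2 ≤ m * ((if i = k then 1 else 0) / corralWeights c₁ s i - 1) := by nlinarith
    have h3 : (if i = 1 then corralBonusIncr c₁ s else 0) * √(corralUnmixed c₁ s i)
        ≤ 3 / 2 * √c₁ := by
      split_ifs with h
      · rw [h]; exact hbs
      · rw [zero_mul]; positivity
    nlinarith
  have h1 := ftrlPotential_add_le (β := 1 / 2) (r := corralScale c₁ s.rounds) (by norm_num)
    (by norm_num) hr hp hmin (v := corralIncr c₁ s k m) (σ := corralStab c₁ s k) e fun x hx => by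
      rw [hrw]
      refine (sqrt_tsallis_stability hw₀ hp (fun i _ => hpos i) hx (m - 1) hlow).trans ?_
      refine mul_le_mul_of_nonneg_left (Finset.sum_le_sum fun i _ => ?_) (by positivity)
      refine mul_le_mul_of_nonneg_left ?_ (mul_nonneg (hpos i).le (Real.sqrt_nonneg _))
      rw [hval]
      set A := (if i = k then (1 : ℝ) else 0) / corralWeights c₁ s i - 1
      set B := if i = 1 then corralBonusIncr c₁ s else 0
      have h2 : (m * A) ^ 2 ≤ 4 * A ^ 2 := by
        rw [mul_pow]
        exact mul_le_mul_of_nonneg_right (by nlinarith) (sq_nonneg A)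
      nlinarith [sq_nonneg (m * A + B)]
  simp only [← Real.sqrt_eq_rpow] at h1
  exact h1

/-- The centred second moments are `q₁/q₀` and `q₀/q₁`. Weighted by `u ^ (3/2)`, both are `O(√q₁)`:
this is the factor that makes the rate small when the candidate is rarely left. -/
theorem corralStab_mean_le (hc : 1 ≤ c₁) (s : CorralState K) (hW : 0 ≤ s.base.cumWeight) :
    corralWeights c₁ s 0 * corralStab c₁ s 0 + corralWeights c₁ s 1 * corralStab c₁ s 1
      ≤ 80 * √(corralWeights c₁ s 1 / ((s.rounds + 1 : ℕ) : ℝ))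
        + corralBonusIncr c₁ s * corralUnmixed c₁ s 1 := by
  have hs1 : 1 ≤ √c₁ := Real.one_le_sqrt.2 hc
  have hb := corralBonusIncr_nonneg (zero_le_one.trans hc) s
  have hbs := corralBonusIncr_mul_sqrt_le (zero_le_one.trans hc) s hW
  have hsum := corralWeights_sum c₁ s
  have hsum' := corralUnmixed_sum c₁ s
  have hq0 := corralWeights_pos c₁ s 0
  have hq1 := corralWeights_pos c₁ s 1
  have hu0 := corralUnmixed_pos c₁ s 0
  have hu1 := corralUnmixed_pos c₁ s 1
  have hle0 := corralUnmixed_le c₁ s 0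
  have hle1 := corralUnmixed_le c₁ s 1
  have ht : (0 : ℝ) < ((s.rounds + 1 : ℕ) : ℝ) := by positivity
  have hst := Real.sqrt_pos.2 ht
  rw [Real.sqrt_div hq1.le]
  unfold corralStab
  simp only [Fin.sum_univ_two, if_true, if_neg (zero_ne_one : (0 : Fin 2) ≠ 1),
    if_neg (one_ne_zero : (1 : Fin 2) ≠ 0)]
  set t := √((s.rounds + 1 : ℕ) : ℝ)
  set b := corralBonusIncr c₁ s
  set q0 := corralWeights c₁ s 0
  set q1 := corralWeights c₁ s 1
  set u0 := corralUnmixed c₁ s 0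
  set u1 := corralUnmixed c₁ s 1
  have hw₀ : 0 < t + 8 * √c₁ := by positivity
  have e : q0 * (2 / (t + 8 * √c₁) * (u0 * √u0 * (8 * (1 / q0 - 1) ^ 2 + 2 * 0 ^ 2)
        + u1 * √u1 * (8 * (0 / q1 - 1) ^ 2 + 2 * b ^ 2)))
      + q1 * (2 / (t + 8 * √c₁) * (u0 * √u0 * (8 * (0 / q0 - 1) ^ 2 + 2 * 0 ^ 2)
        + u1 * √u1 * (8 * (1 / q1 - 1) ^ 2 + 2 * b ^ 2)))
      = 2 / (t + 8 * √c₁) * (8 * (u0 / q0 * √u0 * q1) + 8 * (u1 / q1 * √u1 * q0))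
        + 4 / (t + 8 * √c₁) * (b * √u1) * (b * u1) := by
    have e0 : q0 = 1 - q1 := by linarith
    have hne : (1 - q1) ≠ 0 := by rw [← e0]; exact hq0.ne'
    rw [e0]
    field_simp
    ring
  rw [e]
  have hsq1 : q1 ≤ √q1 := by
    have := Real.sq_sqrt hq1.le
    have h1 : √q1 ≤ 1 := Real.sqrt_le_one.2 (by linarith)
    nlinarith [Real.sqrt_nonneg q1]
  have hsu0 : √u0 ≤ 1 := Real.sqrt_le_one.2 (by linarith)
  have hsu1 : √u1 ≤ 3 / 2 * √q1 := by
    have h3 : √2 ≤ 3 / 2 := by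
      rw [Real.sqrt_le_left (by norm_num)]; norm_num
    calc √u1 ≤ √(2 * q1) := Real.sqrt_le_sqrt hle1
      _ = √2 * √q1 := Real.sqrt_mul zero_le_two _
      _ ≤ _ := by gcongr
  have r0 : u0 / q0 ≤ 2 := by rw [div_le_iff₀ hq0]; exact hle0
  have r1 : u1 / q1 ≤ 2 := by rw [div_le_iff₀ hq1]; exact hle1
  have h1 : u0 / q0 * √u0 * q1 ≤ 2 * 1 * √q1 := by gcongr
  have h2 : u1 / q1 * √u1 * q0 ≤ 2 * (3 / 2 * √q1) * 1 := by
    have : q0 ≤ 1 := by linarith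
    gcongr
  have h3 : 2 / (t + 8 * √c₁) * (8 * (u0 / q0 * √u0 * q1) + 8 * (u1 / q1 * √u1 * q0))
      ≤ 2 / t * (40 * √q1) := by
    have h5 := Real.sqrt_nonneg q1
    refine mul_le_mul ?_ (by linarith) (by positivity) (by positivity)
    exact div_le_div_of_nonneg_left zero_le_two hst (le_add_of_nonneg_right (by positivity))
  -- One factor of the squared bonus is absorbed by the learning rate, as `4 * 3/2 ≤ 8`; the other
  -- remains as `b * u1`.
  have h4 : 4 / (t + 8 * √c₁) * (b * √u1) ≤ 1 := by
    rw [div_mul_eq_mul_div, div_le_one hw₀]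
    linarith
  have h5 := mul_le_mul_of_nonneg_right h4 (mul_nonneg hb hu1.le)
  have h6 : 2 / t * (40 * √q1) = 80 * (√q1 / t) := by ring
  linarith

theorem sum_corralPlay (G : Digraph (Fin K)) (c₁ : ℝ) (x : Fin K) (s : CorralState K)
    (F : Fin K → ℝ) : ∑ a, corralPlay G c₁ x s a * F a = corralWeights c₁ s 0 * F x
      + corralWeights c₁ s 1 * ∑ a ∈ Finset.univ.erase x, corralBasePlay G c₁ x s a * F a := by
  rw [← Finset.add_sum_erase _ _ (Finset.mem_univ x), Finset.mul_sum]
  congr 1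
  · simp [corralPlay]
  · refine Finset.sum_congr rfl fun a ha => ?_
    rw [corralPlay, if_neg (Finset.ne_of_mem_erase ha)]
    ring

/-- Observability of the surrogate: every arm without a self-loop is seen from all other arms, and
the surrogate uses the loss of such an arm only when a different arm is played. -/
theorem surrogate_congr (hG : StronglyObservable G) (x : Fin K) (p : Fin K → ℝ) {y Y : Fin K → ℝ}
    {a : Fin K} (hY : ∀ j, G.Adj a j → Y j = y j) :
    surrogate G x p Y a = surrogate G x p y a := by
  classical
  unfold surrogate
  split_ifs with h1 h2 h2 h3 h3
  all_goals first | subst h1 | skip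
  all_goals congr 1
  all_goals first
    | exact hY _ h2
    | exact hY _ ((hG _).resolve_left ‹_› _ ‹_›)
    | skip
  all_goals
    refine Finset.sum_congr rfl fun j hj => ?_
    split_ifs with h
    · rfl
    · rw [hY j ((hG j).resolve_left h _ (Finset.ne_of_mem_erase hj).symm)]

variable {x : Fin K} {p y : Fin K → ℝ}

theorem sum_mul_loss_mem (hp : p ∈ supportedSimplex (Finset.univ.erase x))
    (hy : ∀ i, y i ∈ Set.Icc (0 : ℝ) 1) (P : Fin K → Prop) [DecidablePred P] :
    (∑ j ∈ Finset.univ.erase x, if P j then 0 else p j * y j) ∈ Set.Icc (0 : ℝ) 1 := by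
  constructor
  · refine Finset.sum_nonneg fun j _ => ?_
    split_ifs
    · exact le_rfl
    · exact mul_nonneg (supportedSimplex_nonneg hp j) (hy j).1
  · rw [← supportedSimplex_sum hp]
    refine Finset.sum_le_sum fun j _ => ?_
    split_ifs
    · exact supportedSimplex_nonneg hp j
    · exact mul_le_of_le_one_right (supportedSimplex_nonneg hp j) (hy j).2

theorem surrogate_mem (hp : p ∈ supportedSimplex (Finset.univ.erase x))
    (hy : ∀ i, y i ∈ Set.Icc (0 : ℝ) 1) (a : Fin K) :
    surrogate G x p y a ∈ Set.Icc (-1 : ℝ) 1 := by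
  classical
  have h1 := sum_mul_loss_mem hp hy fun j => G.Adj j j
  have hx := hy x
  have ha := hy a
  simp only [Set.mem_Icc] at *
  unfold surrogate
  split_ifs <;> constructor <;> linarith

/-- The surrogate subtracts the same quantity in expectation from both options. Their difference is
thus unchanged, and only this difference enters the regret of the two-point problem. -/
theorem surrogate_sub_sum (hp : p ∈ supportedSimplex (Finset.univ.erase x)) :
    surrogate G x p y x - ∑ a ∈ Finset.univ.erase x, p a * surrogate G x p y a
      = y x - ∑ a ∈ Finset.univ.erase x, p a * y a := by
  classical
  have h1 : ∑ a ∈ Finset.univ.erase x, p a * surrogate G x p y a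
      = ∑ a ∈ Finset.univ.erase x, (if G.Adj a a then p a * y a else 0)
        - if G.Adj x x then 0 else y x := by
    have : ∀ a ∈ Finset.univ.erase x, p a * surrogate G x p y a
        = (if G.Adj a a then p a * y a else 0) - p a * (if G.Adj x x then 0 else y x) := by
      intro a ha
      unfold surrogate
      rw [if_neg (Finset.ne_of_mem_erase ha), mul_sub, mul_ite, mul_zero]
    rw [Finset.sum_congr rfl this, Finset.sum_sub_distrib, ← Finset.sum_mul,
      supportedSimplex_sum hp, one_mul]
  have h2 : ∑ a ∈ Finset.univ.erase x, p a * y a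
      = ∑ a ∈ Finset.univ.erase x, (if G.Adj a a then p a * y a else 0)
        + ∑ a ∈ Finset.univ.erase x, (if G.Adj a a then 0 else p a * y a) := by
    rw [← Finset.sum_add_distrib]
    refine Finset.sum_congr rfl fun a _ => ?_
    split_ifs <;> ring
  rw [h1, h2]
  unfold surrogate
  rw [if_pos rfl]
  split_ifs <;> ring

end Corral

end GraphBandit

namespace GraphBandit

/-! ### Drift of the Corral potential and of the candidate potential. -/

section Corral

variable {K : ℕ} {G : Digraph (Fin K)} {c₁ : ℝ}

theorem erase_nonempty (hK : 2 ≤ K) (x : Fin K) : (Finset.univ.erase x).Nonempty := by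
  rw [← Finset.card_pos, Finset.card_erase_of_mem (Finset.mem_univ x), Finset.card_univ,
    Fintype.card_fin]
  omega

/-- For `K = 2` the exponent is negative and the FTRL theory does not apply, but the simplex is a
single point. -/
theorem basePlay_mem (hK : 2 ≤ K) (G : Digraph (Fin K)) (x : Fin K) (b : BaseState K) (q : ℝ) :
    basePlay G (Finset.univ.erase x) b q ∈ supportedSimplex (Finset.univ.erase x) := by
  obtain ⟨j, hj⟩ := erase_nonempty hK x
  rcases hK.eq_or_lt with rfl | hK
  · have huniq : ∀ p ∈ supportedSimplex (Finset.univ.erase x), p = Pi.single j 1 := by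
      intro p hp
      have hS : Finset.univ.erase x = {j} := by
        symm
        refine Finset.eq_of_subset_of_card_le (Finset.singleton_subset_iff.2 hj) ?_
        simp
      rw [hS] at hp
      ext i
      by_cases hi : i = j
      · subst hi
        simpa using supportedSimplex_sum hp
      · rw [Pi.single_eq_of_ne hi]
        exact hp.2 i (by simpa using hi)
    unfold basePlay
    exact (argminOn_spec (s := supportedSimplex (Finset.univ.erase x))
      ⟨_, single_mem_supportedSimplex hj,
        isMinOn_iff.2 fun p hp => le_of_eq (by rw [huniq p hp])⟩).1
  · exact (basePlay_spec hK G ⟨j, hj⟩ b q).1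

theorem corralLoss_step (G : Digraph (Fin K)) (c₁ : ℝ) (x : Fin K) (s : CorralState K) (a : Fin K)
    (y : Fin K → ℝ) : corralLoss c₁ (corralStep G c₁ x s a y)
      = fun i => corralLoss c₁ s i + corralIncr c₁ s (if a = x then 0 else 1)
          (surrogate G x (corralBasePlay G c₁ x s) y a + 1) i := by
  ext i
  have h : (if (i = 0 ↔ a = x) then (1 : ℝ) else 0) = if i = if a = x then 0 else 1 then 1 else 0 := by
    by_cases ha : a = x
    · simp [ha]
    · simp only [ha, iff_false, if_false]
      congr 1
      simp only [eq_iff_iff]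
      omega
  simp only [corralLoss, corralIncr, corralStep, corralBonus, baseStep, corralBonusIncr, h]
  split_ifs <;> ring

/-- The importance weights cancel on averaging and leave the difference of the two options. Against
`e = 1` the bonus contributes `-corralBonusIncr`, the credit that pays for the base algorithm. The
remaining terms fit in `108 √c₁`: `27` from the penalty, `80` from stability, `1/2` from mixing, and
`4` for two copies of `b * u1`. -/
theorem corral_drift (hK : 2 ≤ K) (hG : StronglyObservable G) (hc : 1 ≤ c₁) (x : Fin K)
    {s : CorralState K} (hW : 0 ≤ s.base.cumWeight) {y : Fin K → ℝ}
    (hy : ∀ i, y i ∈ Set.Icc (0 : ℝ) 1) {Y : Fin K → Fin K → ℝ}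
    (hY : ∀ a j, G.Adj a j → Y a j = y j) (e : Fin 2) :
    ∑ a, corralPlay G c₁ x s a * corralPotential c₁ e (corralStep G c₁ x s a (Y a))
      ≤ corralPotential c₁ e s - (∑ a, corralPlay G c₁ x s a * y a
          - if e = 0 then y x else ∑ a ∈ Finset.univ.erase x, corralBasePlay G c₁ x s a * y a)
        - (if e = 0 then 0 else corralBonusIncr c₁ s) + corralRate c₁ s := by
  have hp : corralBasePlay G c₁ x s ∈ supportedSimplex (Finset.univ.erase x) :=
    basePlay_mem hK G x _ _
  set p := corralBasePlay G c₁ x s with hpdef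
  have hs1 : 1 ≤ √c₁ := Real.one_le_sqrt.2 hc
  have hc₀ : 0 ≤ c₁ := zero_le_one.trans hc
  set m : Fin K → ℝ := fun a => surrogate G x p y a + 1
  have hm : ∀ a, 0 ≤ m a ∧ m a ≤ 2 := fun a => by
    have := surrogate_mem (G := G) hp hy a
    exact ⟨by linarith [this.1], by linarith [this.2]⟩
  set R := (corralScale c₁ (s.rounds + 1) - corralScale c₁ s.rounds)
          * (∑ i, √(corralUnmixed c₁ s i) - 1)
  have hstep : ∀ a, corralPotential c₁ e (corralStep G c₁ x s a (Y a))
      ≤ corralPotential c₁ e s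
        - (∑ i, corralUnmixed c₁ s i * corralIncr c₁ s (if a = x then 0 else 1) (m a) i
          - corralIncr c₁ s (if a = x then 0 else 1) (m a) e)
        + R + corralStab c₁ s (if a = x then 0 else 1) := by
    intro a
    have h := corralPotential_incr_le hc s hW (if a = x then 0 else 1) e (hm a).1 (hm a).2
    refine le_trans (le_of_eq ?_) h
    unfold corralPotential
    rw [corralLoss_step, surrogate_congr hG x _ (hY a)]
    rfl
  have hstab := corralStab_mean_le hc s hW
  rw [sum_corralPlay, sum_corralPlay, ← hpdef]
  have hq0 := corralWeights_pos c₁ s 0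
  have hq1 := corralWeights_pos c₁ s 1
  have hsum := corralWeights_sum c₁ s
  have hsum' := corralUnmixed_sum c₁ s
  have hle1 := corralUnmixed_le c₁ s 1
  have hu0 := corralUnmixed_pos c₁ s 0
  have hu1 := corralUnmixed_pos c₁ s 1
  have hb := corralBonusIncr_nonneg hc₀ s
  have hbq := corralBonusIncr_mul_weight_le hc₀ s hW
  have hclose := abs_le.1 (abs_corralWeights_sub_le c₁ s 1)
  have hqge := corralWeights_ge c₁ s 1
  have hscale := corralScale_diff_le hc s.rounds
  have hscale' := corralScale_mono c₁ s.rounds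
  have ht : (1 : ℝ) ≤ ((s.rounds + 1 : ℕ) : ℝ) := by simp
  have hdiff := surrogate_sub_sum (G := G) (y := y) hp
  have hYp := sum_mul_loss_mem hp hy fun _ => False
  simp only [if_false] at hYp
  have hyx := hy x
  set Yp := ∑ a ∈ Finset.univ.erase x, p a * y a
  set t := ((s.rounds + 1 : ℕ) : ℝ)
  set b := corralBonusIncr c₁ s
  set u0 := corralUnmixed c₁ s 0
  set u1 := corralUnmixed c₁ s 1
  -- the mixing error
  have hroot : 1 / (4 * t ^ 2) ≤ 1 / 2 * √(corralWeights c₁ s 1 / t) := by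
    -- The forced exploration `q₁ ≥ 1/(4 t²)` makes the mixing error `1/(4 t²)` small relative to
    -- `√(q₁/t)`.
    have h1 : 1 / (2 * t ^ 2) ≤ √(corralWeights c₁ s 1 / t) := by
      refine Real.le_sqrt_of_sq_le ?_
      rw [le_div_iff₀ (by linarith)]
      refine le_trans ?_ hqge
      have : (1 / (2 * t ^ 2)) ^ 2 * t = 1 / (4 * t ^ 2) * (1 / t) := by
        field_simp; norm_num
      rw [this]
      refine mul_le_of_le_one_right (by positivity) ?_
      rw [div_le_one (by linarith)]
      exact ht
    have h2 : 1 / (4 * t ^ 2) = 1 / 2 * (1 / (2 * t ^ 2)) := by field_simp; norm_num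
    rw [h2]
    linarith
  have herr : |corralWeights c₁ s 1 - u1| * |Yp - y x| ≤ 1 / 2 * √(corralWeights c₁ s 1 / t) := by
    have h1 : |Yp - y x| ≤ 1 := by
      rw [abs_le]; constructor <;> linarith [hYp.1, hYp.2, hyx.1, hyx.2]
    refine le_trans (mul_le_of_le_one_right (abs_nonneg _) h1) ?_
    exact (abs_corralWeights_sub_le c₁ s 1).trans hroot
  rw [← abs_mul] at herr
  have herr' := abs_le.1 herr
  -- the regularization term
  have hR : R ≤ 27 * √c₁ * √(corralWeights c₁ s 1 / t) := by
    -- The `-1` from the comparator vertex cancels `√u0 ≤ 1`, so the penalty too is proportional to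
    -- `√q₁`.
    have h1 : ∑ i, √(corralUnmixed c₁ s i) - 1 ≤ 3 / 2 * √(corralWeights c₁ s 1) := by
      rw [Fin.sum_univ_two]
      have h2 : √u0 ≤ 1 := Real.sqrt_le_one.2 (by linarith)
      have h3 : √2 ≤ 3 / 2 := by
        rw [Real.sqrt_le_left (by norm_num)]; norm_num
      have h4 : √u1 ≤ 3 / 2 * √(corralWeights c₁ s 1) := by
        calc √u1 ≤ √(2 * corralWeights c₁ s 1) := Real.sqrt_le_sqrt hle1
          _ = √2 * √(corralWeights c₁ s 1) := Real.sqrt_mul zero_le_two _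
          _ ≤ _ := by gcongr
      linarith
    rw [Real.sqrt_div hq1.le]
    calc R ≤ (corralScale c₁ (s.rounds + 1) - corralScale c₁ s.rounds)
          * (3 / 2 * √(corralWeights c₁ s 1)) :=
          mul_le_mul_of_nonneg_left h1 (by linarith)
      _ ≤ 18 * √c₁ / √t * (3 / 2 * √(corralWeights c₁ s 1)) := by gcongr
      _ = _ := by ring
  have hbu : b * u1 ≤ 2 * (√c₁ * (1 / √(s.base.cumWeight + 1 / corralWeights c₁ s 1))) := by
    have := mul_le_mul_of_nonneg_left hle1 hb
    linarith
  have hrate : corralRate c₁ s = 108 * (√c₁ * √(corralWeights c₁ s 1 / t))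
      + 108 * (√c₁ * (1 / √(s.base.cumWeight + 1 / corralWeights c₁ s 1))) := by
    unfold corralRate; ring
  have hroot₀ := Real.sqrt_nonneg (corralWeights c₁ s 1 / t)
  have hroot₁ : √(corralWeights c₁ s 1 / t) ≤ √c₁ * √(corralWeights c₁ s 1 / t) :=
    le_mul_of_one_le_left hroot₀ hs1
  have hbase₀ : 0 ≤ √c₁ * (1 / √(s.base.cumWeight + 1 / corralWeights c₁ s 1)) := by positivity
  set q0 := corralWeights c₁ s 0
  set q1 := corralWeights c₁ s 1
  have hx := mul_le_mul_of_nonneg_left (hstep x) hq0.le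
  have ha : ∀ a ∈ Finset.univ.erase x, p a * corralPotential c₁ e (corralStep G c₁ x s a (Y a))
      ≤ p a * (corralPotential c₁ e s - (∑ i, corralUnmixed c₁ s i * corralIncr c₁ s 1 (m a) i
          - corralIncr c₁ s 1 (m a) e) + R + corralStab c₁ s 1) := fun a ha => by
    have h := hstep a
    rw [if_neg (Finset.ne_of_mem_erase ha)] at h
    exact mul_le_mul_of_nonneg_left h (supportedSimplex_nonneg hp a)
  have hasum := mul_le_mul_of_nonneg_left (Finset.sum_le_sum ha) hq1.le
  refine (add_le_add hx hasum).trans ?_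
  rw [if_pos rfl]
  have hlin : ∀ A B : ℝ, ∑ a ∈ Finset.univ.erase x, p a * (A + B * m a)
      = A + B * (∑ a ∈ Finset.univ.erase x, p a * surrogate G x p y a + 1) := by
    intro A B
    have : ∀ a, p a * (A + B * m a) = p a * (A + B) + B * (p a * surrogate G x p y a) := fun a => by
      simp only [m]; ring
    rw [Finset.sum_congr rfl fun a _ => this a, Finset.sum_add_distrib, ← Finset.sum_mul,
      ← Finset.mul_sum, supportedSimplex_sum hp]
    ring
  set Q := ∑ a ∈ Finset.univ.erase x, p a * surrogate G x p y a
  -- The true losses reappear here: the surrogate of the candidate is its base average plus the true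
  -- loss difference.
  have hmx : m x = Q + 1 + y x - Yp := by simp only [m]; linarith
  have e00 : ∀ m, corralIncr c₁ s 0 m 0 = m / q0 - 1 := fun m => by simp [corralIncr, q0]
  have e01 : ∀ m, corralIncr c₁ s 0 m 1 = -1 - b := fun m => by simp [corralIncr, b]
  have e10 : ∀ m, corralIncr c₁ s 1 m 0 = -1 := fun m => by simp [corralIncr]
  have e11 : ∀ m, corralIncr c₁ s 1 m 1 = m / q1 - 1 - b := fun m => by simp [corralIncr, b, q1]
  have hu0' : u0 = 1 - u1 := by linarith
  have hq0y : q0 * y x = y x - q1 * y x := by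
    rw [eq_sub_of_add_eq hsum]; ring
  obtain rfl | rfl : e = 0 ∨ e = 1 := by omega
  · simp only [Fin.sum_univ_two, e00, e01, e10, e11, if_true]
    have e1 : ∀ a, p a * (corralPotential c₁ 0 s - (u0 * -1 + u1 * (m a / q1 - 1 - b) - -1) + R
          + corralStab c₁ s 1)
        = p a * ((corralPotential c₁ 0 s - (-u0 - u1 - u1 * b + 1) + R + corralStab c₁ s 1)
          + -(u1 / q1) * m a) := fun a => by ring
    rw [Finset.sum_congr rfl fun a _ => e1 a, hlin, hmx]
    have e2 : q0 * (corralPotential c₁ 0 s - (u0 * ((Q + 1 + y x - Yp) / q0 - 1) + u1 * (-1 - b)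
          - ((Q + 1 + y x - Yp) / q0 - 1)) + R + corralStab c₁ s 0)
        + q1 * (corralPotential c₁ 0 s - (-u0 - u1 - u1 * b + 1) + R + corralStab c₁ s 1
          + -(u1 / q1) * (Q + 1))
        = (q0 + q1) * (corralPotential c₁ 0 s + R + u1 * b) + u1 * (y x - Yp)
          + (q0 * corralStab c₁ s 0 + q1 * corralStab c₁ s 1) := by
      rw [hu0']
      field_simp
      ring
    rw [e2, hsum, hrate, hq0y]
    linarith [herr'.1, herr'.2]
  · simp only [Fin.sum_univ_two, e00, e01, e10, e11, if_neg (one_ne_zero : (1 : Fin 2) ≠ 0)]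
    have e1 : ∀ a, p a * (corralPotential c₁ 1 s - (u0 * -1 + u1 * (m a / q1 - 1 - b)
          - (m a / q1 - 1 - b)) + R + corralStab c₁ s 1)
        = p a * ((corralPotential c₁ 1 s - (-u0 - u1 - u1 * b + 1 + b) + R + corralStab c₁ s 1)
          + (1 - u1) / q1 * m a) := fun a => by ring
    rw [Finset.sum_congr rfl fun a _ => e1 a, hlin, hmx]
    have e2 : q0 * (corralPotential c₁ 1 s - (u0 * ((Q + 1 + y x - Yp) / q0 - 1) + u1 * (-1 - b)
          - (-1 - b)) + R + corralStab c₁ s 0)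
        + q1 * (corralPotential c₁ 1 s - (-u0 - u1 - u1 * b + 1 + b) + R + corralStab c₁ s 1
          + (1 - u1) / q1 * (Q + 1))
        = (q0 + q1) * (corralPotential c₁ 1 s + R - b + u1 * b) - (1 - u1) * (y x - Yp)
          + (q0 * corralStab c₁ s 0 + q1 * corralStab c₁ s 1) := by
      rw [hu0']
      field_simp
      ring
    rw [e2, hsum, hrate, hq0y]
    linarith [herr'.1, herr'.2]

/-- The potential of the second reduction with candidate `x` with respect to the comparator `u`. -/
noncomputable def candidatePotential (G : Digraph (Fin K)) (c₁ : ℝ) (u x : Fin K)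
    (s : CorralState K) : ℝ :=
  if u = x then corralPotential c₁ 0 s
  else corralPotential c₁ 1 s
    + if K = 2 then 0 else basePotential G (Finset.univ.erase x) u s.base

theorem basePotential_init {S : Finset (Fin K)} {u : Fin K} (hu : u ∈ S) :
    basePotential G S u (BaseState.init K) = 0 := by
  have h : tsallisScale G (BaseState.init K).cumWeight = 0 := by
    simp [tsallisScale, BaseState.init]
  unfold basePotential
  rw [h]
  exact ftrlPotential_zero hu

theorem corralPotential_init (c₁ : ℝ) (e : Fin 2) :
    corralPotential c₁ e (CorralState.init K) = 0 := by
  have h : corralLoss c₁ (CorralState.init K) = fun _ => 0 := by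
    ext i; simp [corralLoss, CorralState.init, corralBonus, BaseState.init]
  have h' : corralScale c₁ (CorralState.init K).rounds = 0 := if_pos rfl
  unfold corralPotential
  rw [h, h']
  exact ftrlPotential_zero (Finset.mem_univ e)

theorem candidatePotential_init (G : Digraph (Fin K)) (c₁ : ℝ) (u x : Fin K) :
    candidatePotential G c₁ u x (CorralState.init K) = 0 := by
  unfold candidatePotential
  rw [corralPotential_init, corralPotential_init]
  split_ifs with h1 h2
  · rfl
  · rw [add_zero]
  · rw [zero_add]
    exact basePotential_init (Finset.mem_erase.2 ⟨h1, Finset.mem_univ u⟩)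

theorem candidatePotential_nonneg (hK : 2 ≤ K) (G : Digraph (Fin K)) (c₁ : ℝ) (u x : Fin K)
    (s : CorralState K) : 0 ≤ candidatePotential G c₁ u x s := by
  have h : ∀ e, 0 ≤ corralPotential c₁ e s := fun e =>
    ftrlPotential_nonneg (by norm_num) (Finset.mem_univ e)
  unfold candidatePotential
  split_ifs with h1 h2
  · exact h 0
  · rw [add_zero]; exact h 1
  · exact add_nonneg (h 1) (ftrlPotential_nonneg (tsallisExponent_pos (by omega))
      (Finset.mem_erase.2 ⟨h1, Finset.mem_univ u⟩))

theorem card_erase_ge (hK : 3 ≤ K) (x : Fin K) : 2 ≤ (Finset.univ.erase x).card := by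
  rw [Finset.card_erase_of_mem (Finset.mem_univ x), Finset.card_univ, Fintype.card_fin]
  omega

theorem sum_mul_eq_of_two {x u : Fin K} (hK : K = 2) (hu : u ∈ Finset.univ.erase x)
    {p : Fin K → ℝ} (hp : p ∈ supportedSimplex (Finset.univ.erase x)) (y : Fin K → ℝ) :
    ∑ a ∈ Finset.univ.erase x, p a * y a = y u := by
  have hS : Finset.univ.erase x = {u} := by
    symm
    refine Finset.eq_of_subset_of_card_le (Finset.singleton_subset_iff.2 hu) ?_
    simp [hK]
  rw [hS] at hp
  have := supportedSimplex_sum hp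
  rw [Finset.sum_singleton] at this
  rw [hS, Finset.sum_singleton, this, one_mul]

/-- Against an arm other than the candidate, the Corral drift compares with the base algorithm and
the base drift compares the base algorithm with `u`. The base cost is half a bonus increment, so the
full increment credited by Corral covers it. -/
theorem candidate_drift (hK : 2 ≤ K) (hG : StronglyObservable G) {κ : ℝ} (hκ : 90000 ≤ κ)
    (hc : 1 ≤ stabConst κ G) (x : Fin K) {s : CorralState K} (hW : 0 ≤ s.base.cumWeight)
    {y : Fin K → ℝ} (hy : ∀ i, y i ∈ Set.Icc (0 : ℝ) 1) {Y : Fin K → Fin K → ℝ}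
    (hY : ∀ a j, G.Adj a j → Y a j = y j) (u : Fin K) :
    ∑ a, corralPlay G (stabConst κ G) x s a
        * candidatePotential G (stabConst κ G) u x (corralStep G (stabConst κ G) x s a (Y a))
      ≤ candidatePotential G (stabConst κ G) u x s
        - (∑ a, corralPlay G (stabConst κ G) x s a * y a - y u) + corralRate (stabConst κ G) s := by
  set c₁ := stabConst κ G
  unfold candidatePotential
  by_cases hux : u = x
  · simp only [if_pos hux]
    have h := corral_drift hK hG hc x hW hy hY 0
    rw [if_pos rfl, if_pos rfl, sub_zero] at h
    rw [hux]
    exact h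
  simp only [if_neg hux]
  have hu : u ∈ Finset.univ.erase x := Finset.mem_erase.2 ⟨hux, Finset.mem_univ u⟩
  have h := corral_drift hK hG hc x hW hy hY 1
  rw [if_neg one_ne_zero, if_neg one_ne_zero] at h
  have hb := corralBonusIncr_nonneg (zero_le_one.trans hc) s
  have hp : corralBasePlay G c₁ x s ∈ supportedSimplex (Finset.univ.erase x) :=
    basePlay_mem hK G x _ _
  by_cases hK2 : K = 2
  · simp only [if_pos hK2, add_zero]
    rw [sum_mul_eq_of_two hK2 hu hp] at h
    linarith
  simp only [if_neg hK2]
  have hK3 : 3 ≤ K := by omega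
  have hd := base_drift hK3 hG (card_erase_ge hK3 x) hκ hW (corralWeights_pos c₁ s 1)
    (corralWeights_le_one c₁ s 1) hy hu hY x (Y x)
  have hbase : ∑ a, corralPlay G c₁ x s a * basePotential G (Finset.univ.erase x) u
      (corralStep G c₁ x s a (Y a)).base
      = corralWeights c₁ s 1 * ∑ a, corralBasePlay G c₁ x s a
          * basePotential G (Finset.univ.erase x) u
            (baseStep G (Finset.univ.erase x) s.base (corralWeights c₁ s 1) a True (Y a))
        + (1 - corralWeights c₁ s 1) * basePotential G (Finset.univ.erase x) u
            (baseStep G (Finset.univ.erase x) s.base (corralWeights c₁ s 1) x False (Y x)) := by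
    rw [sum_corralPlay, ← eq_sub_of_add_eq (corralWeights_sum c₁ s), add_comm]
    have hx0 : corralBasePlay G c₁ x s x = 0 := hp.2 x (Finset.notMem_erase x _)
    rw [← Finset.add_sum_erase Finset.univ (fun a => corralBasePlay G c₁ x s a
          * basePotential G (Finset.univ.erase x) u
            (baseStep G (Finset.univ.erase x) s.base (corralWeights c₁ s 1) a True (Y a)))
      (Finset.mem_univ x), hx0, zero_mul, zero_add]
    congr 1
    · congr 1
      refine Finset.sum_congr rfl fun a ha => ?_
      have : (a ≠ x) = True := eq_true (Finset.ne_of_mem_erase ha)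
      simp only [corralStep, this]
    · have : (x ≠ x) = False := eq_false fun h => h rfl
      simp only [corralStep, this]
  simp only [mul_add, Finset.sum_add_distrib]
  rw [hbase]
  unfold corralBonusIncr at h hb
  unfold corralBasePlay at h ⊢
  linarith

end Corral

/-! ### Drift of the full algorithm's potential. -/

section Alg

variable {K : ℕ} {G : Digraph (Fin K)}

/-- The potential of the full algorithm with respect to the comparator `u`. -/
noncomputable def algPotential (G : Digraph (Fin K)) (c₁ : ℝ) (u : Fin K) (s : AlgState K) : ℝ :=
  candidatePotential G c₁ u s.candidate s.corral

theorem algPotential_fresh (G : Digraph (Fin K)) (c₁ : ℝ) (u x : Fin K) (n : ℕ) :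
    algPotential G c₁ u (AlgState.fresh x n) = 0 := candidatePotential_init G c₁ u x

theorem algPotential_nonneg (hK : 2 ≤ K) (G : Digraph (Fin K)) (c₁ : ℝ) (u : Fin K)
    (s : AlgState K) : 0 ≤ algPotential G c₁ u s := candidatePotential_nonneg hK G c₁ u _ _

theorem algPlay_nonneg (hK : 2 ≤ K) (G : Digraph (Fin K)) (c₁ : ℝ) (s : AlgState K) (a : Fin K) :
    0 ≤ algPlay G c₁ s a := by
  unfold algPlay corralPlay
  split_ifs
  · exact (corralWeights_pos _ _ _).le
  · exact mul_nonneg (corralWeights_pos _ _ _).le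
      (supportedSimplex_nonneg (basePlay_mem hK G _ _ _) a)

theorem algPlay_sum (hK : 2 ≤ K) (G : Digraph (Fin K)) (c₁ : ℝ) (s : AlgState K) :
    ∑ a, algPlay G c₁ s a = 1 := by
  have h := sum_corralPlay G c₁ s.candidate s.corral fun _ => 1
  simp only [mul_one] at h
  unfold algPlay
  rw [h, ← corralWeights_sum c₁ s.corral]
  congr 1
  exact mul_right_eq_self₀.2 (Or.inl (supportedSimplex_sum (basePlay_mem hK G _ _ _)))

/-- A restart resets the potential to zero. The old potential is nonnegative, so regret inequalities
survive epoch changes. -/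
theorem algPotential_step_le (hK : 2 ≤ K) (G : Digraph (Fin K)) (c₁ : ℝ)
    (sel : Finset (Fin K) → Fin K) (u : Fin K) (s : AlgState K) (a : Fin K) (y : Fin K → ℝ) :
    algPotential G c₁ u (algStep G c₁ sel s a y)
      ≤ candidatePotential G c₁ u s.candidate (corralStep G c₁ s.candidate s.corral a y) := by
  unfold algStep
  dsimp only
  split_ifs
  · rw [algPotential_fresh]
    exact candidatePotential_nonneg hK G c₁ u _ _
  · exact le_rfl

theorem alg_drift (hK : 2 ≤ K) (hG : StronglyObservable G) {κ : ℝ} (hκ : 90000 ≤ κ)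
    (hc : 1 ≤ stabConst κ G) (sel : Finset (Fin K) → Fin K) {s : AlgState K}
    (hW : 0 ≤ s.corral.base.cumWeight)
    {y : Fin K → ℝ} (hy : ∀ i, y i ∈ Set.Icc (0 : ℝ) 1) {Y : Fin K → Fin K → ℝ}
    (hY : ∀ a j, G.Adj a j → Y a j = y j) (u : Fin K) :
    ∑ a, algPlay G (stabConst κ G) s a
        * algPotential G (stabConst κ G) u (algStep G (stabConst κ G) sel s a (Y a))
      ≤ algPotential G (stabConst κ G) u s
        - (∑ a, algPlay G (stabConst κ G) s a * y a - y u)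
        + corralRate (stabConst κ G) s.corral :=
  (Finset.sum_le_sum fun a _ => mul_le_mul_of_nonneg_left
    (algPotential_step_le hK G _ sel u s a (Y a)) (algPlay_nonneg hK G _ s a)).trans
    (candidate_drift hK hG hκ hc s.candidate hW hy hY u)

end Alg

end GraphBandit

namespace GraphBandit

/-! ## Trajectories of the full algorithm -/

section Trajectory

variable {K : ℕ} {G : Digraph (Fin K)} {c₁ : ℝ} {sel : Finset (Fin K) → Fin K}

theorem algStep_cases (hsel : ∀ s : Finset (Fin K), s.Nonempty → sel s ∈ s) (s : AlgState K)
    (a : Fin K) (y : Fin K → ℝ) :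
    (∃ x', algStep G c₁ sel s a y = AlgState.fresh x' (s.corral.rounds + 1) ∧ x' ≠ s.candidate ∧
      s.corral.rounds + 1 ≤ 2 * Function.update s.count a (s.count a + 1) x' ∧
      2 * s.prevLength ≤ s.corral.rounds + 1) ∨
    (algStep G c₁ sel s a y = ⟨s.candidate, s.prevLength,
        Function.update s.count a (s.count a + 1), corralStep G c₁ s.candidate s.corral a y⟩ ∧
      ∀ v, v ≠ s.candidate → s.corral.rounds + 1 < 2 * s.prevLength ∨
        2 * Function.update s.count a (s.count a + 1) v < s.corral.rounds + 1) := by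
  by_cases h : 2 * s.prevLength ≤ (corralStep G c₁ s.candidate s.corral a y).rounds ∧
      ((Finset.univ.erase s.candidate).filter fun x =>
        (corralStep G c₁ s.candidate s.corral a y).rounds
          ≤ 2 * Function.update s.count a (s.count a + 1) x).Nonempty
  · left
    have hmem := hsel _ h.2
    rw [Finset.mem_filter, Finset.mem_erase] at hmem
    exact ⟨_, if_pos h, hmem.1.1, hmem.2, h.1⟩
  · right
    refine ⟨if_neg h, fun v hv => ?_⟩
    by_contra! hlt
    exact h ⟨hlt.1, v, Finset.mem_filter.2 ⟨Finset.mem_erase.2 ⟨hv, Finset.mem_univ v⟩, hlt.2⟩⟩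

theorem sum_update_succ (f : Fin K → ℕ) (a : Fin K) :
    ∑ v, Function.update f a (f a + 1) v = ∑ v, f v + 1 := by
  have h : ∀ v, Function.update f a (f a + 1) v = f v + if v = a then 1 else 0 := by
    intro v
    by_cases h : v = a
    · subst h; simp
    · simp [h]
  simp [h, Finset.sum_add_distrib]

/-- Elementary bounds on the counters of the algorithm after `t` rounds. -/
structure AlgState.Valid (s : AlgState K) (t : ℕ) : Prop where
  sum_count : ∑ v, s.count v = s.corral.rounds
  length_le : s.corral.rounds + s.prevLength ≤ t
  rounds_le : (s.corral.rounds : ℝ) ≤ s.corral.base.cumWeight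
  weight_le : s.corral.base.cumWeight ≤ 4 * (s.corral.rounds : ℝ) ^ 3

theorem AlgState.Valid.cumWeight_nonneg {s : AlgState K} {t : ℕ} (h : s.Valid t) :
    0 ≤ s.corral.base.cumWeight := (Nat.cast_nonneg _).trans h.rounds_le

theorem AlgState.valid_fresh (x : Fin K) {n t : ℕ} (h : n ≤ t) : (AlgState.fresh x n).Valid t where
  sum_count := by simp [AlgState.fresh, CorralState.init]
  length_le := by simpa [AlgState.fresh, CorralState.init] using h
  rounds_le := by simp [AlgState.fresh, CorralState.init, BaseState.init]
  weight_le := by simp [AlgState.fresh, CorralState.init, BaseState.init]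

/-- Mixing gives `1/q ≤ 4 (n + 1)²`, and `4 n³ + 4 (n + 1)² ≤ 4 (n + 1)³`. The polynomial bound on
`∑ 1/q` keeps its logarithm of order `log T`. -/
theorem AlgState.Valid.step (hsel : ∀ s : Finset (Fin K), s.Nonempty → sel s ∈ s) {s : AlgState K}
    {t : ℕ} (h : s.Valid t) (a : Fin K) (y : Fin K → ℝ) :
    (algStep G c₁ sel s a y).Valid (t + 1) := by
  have h1 := h.length_le
  rcases algStep_cases (G := G) (c₁ := c₁) hsel s a y with ⟨x', he, -⟩ | ⟨he, -⟩
  · rw [he]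
    exact AlgState.valid_fresh x' (by omega)
  · rw [he]
    have hq := corralWeights_pos c₁ s.corral 1
    have hq1 := corralWeights_le_one c₁ s.corral 1
    have hge := corralWeights_ge c₁ s.corral 1
    refine ⟨?_, ?_, ?_, ?_⟩
    · simpa [corralStep] using (sum_update_succ s.count a).trans (by rw [h.sum_count])
    · simp only [corralStep]; omega
    · simp only [corralStep, baseStep]
      have : 1 ≤ 1 / corralWeights c₁ s.corral 1 := by rw [le_div_iff₀ hq]; linarith
      push_cast
      linarith [h.rounds_le]
    · simp only [corralStep, baseStep]
      have h2 : 1 / corralWeights c₁ s.corral 1 ≤ 4 * ((s.corral.rounds + 1 : ℕ) : ℝ) ^ 2 := by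
        rw [div_le_iff₀ hq]
        rw [div_le_iff₀ (by positivity)] at hge
        linarith
      have h3 := h.weight_le
      have h4 : (0 : ℝ) ≤ s.corral.rounds := Nat.cast_nonneg _
      push_cast at *
      nlinarith [mul_nonneg h4 h4]

theorem valid_algTrajectory (hsel : ∀ s : Finset (Fin K), s.Nonempty → sel s ∈ s) (lo : ℝ)
    (x : Fin K) (l : ℕ → Fin K → ℝ) (a : ℕ → Fin K) (t : ℕ) :
    (algTrajectory G c₁ lo sel x l a t).Valid t := by
  induction t with
  | zero => exact AlgState.valid_fresh x le_rfl
  | succ t ih => exact ih.step hsel _ _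

theorem corralRate_nonneg (c₁ : ℝ) (s : CorralState K) : 0 ≤ corralRate c₁ s := by
  unfold corralRate; positivity

theorem corralRate_le (c₁ : ℝ) {s : CorralState K} (h : (s.rounds : ℝ) ≤ s.base.cumWeight) :
    corralRate c₁ s ≤ 216 * √c₁ * (1 / √((s.rounds + 1 : ℕ) : ℝ)) := by
  have hq := corralWeights_pos c₁ s 1
  have hq1 := corralWeights_le_one c₁ s 1
  have ht : (0 : ℝ) < ((s.rounds + 1 : ℕ) : ℝ) := by positivity
  have hst := Real.sqrt_pos.2 ht
  have h1 : √(corralWeights c₁ s 1 / ((s.rounds + 1 : ℕ) : ℝ)) ≤ 1 / √((s.rounds + 1 : ℕ) : ℝ) := by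
    rw [Real.sqrt_div hq.le]
    exact div_le_div_of_nonneg_right (Real.sqrt_le_one.2 hq1) hst.le
  have h2 : 1 / √(s.base.cumWeight + 1 / corralWeights c₁ s 1) ≤ 1 / √((s.rounds + 1 : ℕ) : ℝ) := by
    refine one_div_le_one_div_of_le hst (Real.sqrt_le_sqrt ?_)
    have : 1 ≤ 1 / corralWeights c₁ s 1 := by rw [le_div_iff₀ hq]; linarith
    push_cast
    linarith
  unfold corralRate
  have h3 := Real.sqrt_nonneg c₁
  nlinarith

theorem one_div_sqrt_succ_le (n : ℕ) :
    1 / √((n + 1 : ℕ) : ℝ) ≤ 2 * (√((n + 1 : ℕ) : ℝ) - √(n : ℝ)) := by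
  have := sqrt_add_sub_sqrt_ge (W := n) (d := 1) (Nat.cast_nonneg n) one_pos
  push_cast
  exact this

theorem sqrt_le_mul_add_div {lam : ℝ} (hlam : 0 < lam) {v : ℝ} (hv : 0 ≤ v) :
    √v ≤ lam * v / 2 + 1 / (2 * lam) := by
  have h1 := Real.sq_sqrt hv
  have h2 : lam * v / 2 + 1 / (2 * lam) - √v = (lam * √v - 1) ^ 2 / (2 * lam) := by
    rw [sub_sq, mul_pow, h1]
    field_simp
    ring
  have h3 : 0 ≤ (lam * √v - 1) ^ 2 / (2 * lam) := by positivity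
  linarith

/-- The sum of `1 / t` and of the relative increments of `∑ 1 / q_t` is bounded by this. -/
noncomputable def logPotential (s : CorralState K) : ℝ :=
  if s.rounds = 0 then 0 else 2 + Real.log s.rounds + Real.log s.base.cumWeight

/-- Each square root is `q` times the root of a quotient, and the arithmetic–geometric mean
inequality with parameter `lam` splits off `lam * q`. The remainders `1/t` and `(1/q) / ∑ 1/q` are
bounded by increments of logarithms. -/
theorem corralRate_le_log (c₁ : ℝ) {s : CorralState K}
    (h : (s.rounds : ℝ) ≤ s.base.cumWeight) {lam : ℝ} (hlam : 0 < lam) (x a : Fin K)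
    (y : Fin K → ℝ) :
    corralRate c₁ s ≤ 108 * √c₁ * (lam * corralWeights c₁ s 1
      + (logPotential (corralStep G c₁ x s a y) - logPotential s) / (2 * lam)) := by
  have hq := corralWeights_pos c₁ s 1
  have hq1 := corralWeights_le_one c₁ s 1
  have ht : (0 : ℝ) < ((s.rounds + 1 : ℕ) : ℝ) := by positivity
  have hr : (0 : ℝ) ≤ (s.rounds : ℝ) := Nat.cast_nonneg _
  have hinv : 1 ≤ 1 / corralWeights c₁ s 1 := by rw [le_div_iff₀ hq]; linarith
  have hW' : 0 < s.base.cumWeight + 1 / corralWeights c₁ s 1 := by linarith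
  have hlog : 1 / ((s.rounds + 1 : ℕ) : ℝ)
      + 1 / corralWeights c₁ s 1 / (s.base.cumWeight + 1 / corralWeights c₁ s 1)
      ≤ logPotential (corralStep G c₁ x s a y) - logPotential s := by
    unfold logPotential
    rw [if_neg (by simp [corralStep])]
    simp only [corralStep, baseStep]
    have hinc : ∀ v d : ℝ, 0 < v → 0 < d → d / (v + d) ≤ Real.log (v + d) - Real.log v := by
      intro v d hv hd
      have := Real.one_sub_inv_le_log_of_pos (x := (v + d) / v) (by positivity)
      rw [Real.log_div (by positivity) hv.ne', inv_div] at this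
      refine le_trans (le_of_eq ?_) this
      field_simp
      ring
    -- In the first round of an epoch there is no earlier logarithm; both quotients are at most `1`,
    -- which the constant `2` in `logPotential` covers.
    split_ifs with h0
    · rw [h0]
      have h1 : 1 / corralWeights c₁ s 1 / (s.base.cumWeight + 1 / corralWeights c₁ s 1) ≤ 1 := by
        rw [div_le_one hW']; linarith
      have h2 : 0 ≤ Real.log (s.base.cumWeight + 1 / corralWeights c₁ s 1) :=
        Real.log_nonneg (by linarith)
      simp
      simp at h1 h2
      linarith
    · have h1 : (0 : ℝ) < s.rounds := by exact_mod_cast Nat.pos_of_ne_zero h0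
      have h2 := hinc s.rounds 1 h1 one_pos
      have h3 := hinc s.base.cumWeight (1 / corralWeights c₁ s 1) (by linarith) (by linarith)
      push_cast
      linarith
  have h1 := sqrt_le_mul_add_div (one_div_pos.2 hlam)
    (v := 1 / (corralWeights c₁ s 1 * ((s.rounds + 1 : ℕ) : ℝ))) (by positivity)
  have h2 := sqrt_le_mul_add_div (one_div_pos.2 hlam)
    (v := 1 / (corralWeights c₁ s 1 * (corralWeights c₁ s 1
      * (s.base.cumWeight + 1 / corralWeights c₁ s 1)))) (by positivity)
  have e1 : √(corralWeights c₁ s 1 / ((s.rounds + 1 : ℕ) : ℝ)) = corralWeights c₁ s 1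
      * √(1 / (corralWeights c₁ s 1 * ((s.rounds + 1 : ℕ) : ℝ))) := by
    nth_rewrite 2 [← Real.sqrt_sq hq.le]
    rw [← Real.sqrt_mul (by positivity)]
    congr 1
    field_simp
  have e2 : 1 / √(s.base.cumWeight + 1 / corralWeights c₁ s 1) = corralWeights c₁ s 1
      * √(1 / (corralWeights c₁ s 1 * (corralWeights c₁ s 1
      * (s.base.cumWeight + 1 / corralWeights c₁ s 1)))) := by
    nth_rewrite 2 [← Real.sqrt_sq hq.le]
    rw [← Real.sqrt_mul (by positivity), one_div, ← Real.sqrt_inv]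
    congr 1
    field_simp
  have h3 := mul_le_mul_of_nonneg_left h1 hq.le
  have h4 := mul_le_mul_of_nonneg_left h2 hq.le
  rw [← e1] at h3
  rw [← e2] at h4
  unfold corralRate
  refine mul_le_mul_of_nonneg_left ?_ (by positivity)
  refine (add_le_add h3 h4).trans ?_
  have h5 := div_le_div_of_nonneg_right hlog (by positivity : 0 ≤ 2 * lam)
  refine le_trans (le_of_eq ?_) (add_le_add_right h5 (lam * corralWeights c₁ s 1))
  set W' := s.base.cumWeight + 1 / corralWeights c₁ s 1
  field_simp
  ring

theorem logPotential_le {s : CorralState K} {T : ℕ} (hT : 2 ≤ T) (hr : s.rounds ≤ T)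
    (hW : s.base.cumWeight ≤ 4 * (s.rounds : ℝ) ^ 3) (hW' : (s.rounds : ℝ) ≤ s.base.cumWeight) :
    logPotential s ≤ 9 * Real.log T := by
  have hlog2 := Real.log_two_gt_d9
  have hlogT : Real.log 2 ≤ Real.log T := Real.log_le_log two_pos (by exact_mod_cast hT)
  unfold logPotential
  split_ifs with h
  · linarith
  · have h1 : (0 : ℝ) < s.rounds := by exact_mod_cast Nat.pos_of_ne_zero h
    have h2 : Real.log s.rounds ≤ Real.log T := Real.log_le_log h1 (by exact_mod_cast hr)
    have h3 := Real.log_le_log (by linarith) hW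
    rw [Real.log_mul (by norm_num) (by positivity), Real.log_pow,
      show (4 : ℝ) = 2 ^ 2 by norm_num, Real.log_pow] at h3
    push_cast at h3
    linarith

/-- The regret bound in the rounds so far: a part `E` from the current epoch, and a part from the
previous epochs. -/
theorem exists_epoch_bound (hsel : ∀ s : Finset (Fin K), s.Nonempty → sel s ∈ s) (lo : ℝ)
    (x : Fin K) (l : ℕ → Fin K → ℝ) (a : ℕ → Fin K) (x' : Fin K) {lam : ℝ} (hlam : 0 < lam)
    (hplay : ∀ s : AlgState K, s.candidate = x' →
      corralWeights c₁ s.corral 1 = 1 - algPlay G c₁ s x')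
    (hplay' : ∀ s : AlgState K, algPlay G c₁ s x' ≤ 1) (t : ℕ) :
    ∃ E : ℝ,
      ∑ i ∈ Finset.range t, corralRate c₁ (algTrajectory G c₁ lo sel x l a i).corral
        ≤ E + 1728 * √c₁ * √((algTrajectory G c₁ lo sel x l a t).prevLength : ℝ) ∧
      E ≤ 432 * √c₁ * √((algTrajectory G c₁ lo sel x l a t).corral.rounds : ℝ) ∧
      ((algTrajectory G c₁ lo sel x l a t).candidate = x' →
        E ≤ 108 * √c₁ * (lam * ∑ i ∈ Finset.range t,
              (1 - algPlay G c₁ (algTrajectory G c₁ lo sel x l a i) x')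
            + logPotential (algTrajectory G c₁ lo sel x l a t).corral / (2 * lam))) := by
  induction t with
  | zero =>
    exact ⟨0, by simp [algTrajectory, AlgState.fresh], by simp [algTrajectory, AlgState.fresh,
      CorralState.init], fun _ => by simp [algTrajectory, AlgState.fresh, CorralState.init,
      logPotential]⟩
  | succ t ih =>
    obtain ⟨E, hE, hE₁, hE₂⟩ := ih
    have hval := valid_algTrajectory (G := G) (c₁ := c₁) hsel lo x l a t
    have hQ : 0 ≤ ∑ i ∈ Finset.range (t + 1),
        (1 - algPlay G c₁ (algTrajectory G c₁ lo sel x l a i) x') :=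
      Finset.sum_nonneg fun i _ => sub_nonneg.2 (hplay' _)
    have hs1 := Real.sqrt_nonneg c₁
    simp only [algTrajectory]
    set s := algTrajectory G c₁ lo sel x l a t
    have hrate := corralRate_le c₁ hval.rounds_le
    have hstep := one_div_sqrt_succ_le s.corral.rounds
    have hrate' : corralRate c₁ s.corral ≤ 432 * √c₁
        * (√((s.corral.rounds + 1 : ℕ) : ℝ) - √(s.corral.rounds : ℝ)) := by
      refine hrate.trans ?_
      have := mul_le_mul_of_nonneg_left hstep (by positivity : 0 ≤ 216 * √c₁)
      linarith
    rw [Finset.sum_range_succ]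
    rcases algStep_cases (G := G) (c₁ := c₁) hsel s (a t) (feedback G lo (a t) (l t)) with
      ⟨x'', he, -, -, hprev⟩ | ⟨he, -⟩
    · rw [he]
      -- At a restart the finished epoch moves into the `prevLength` term. The old `prevLength` is
      -- at most half the new one and `√(1/2) ≤ 3/4`, so the constants close up: `432 + 1728 * 3/4 =
      -- 1728`.
      refine ⟨0, ?_, by simp [AlgState.fresh, CorralState.init], fun _ => ?_⟩
      · have h1 : √(s.prevLength : ℝ) ≤ 3 / 4 * √((s.corral.rounds + 1 : ℕ) : ℝ) := by
          rw [Real.sqrt_le_left (by positivity), mul_pow, Real.sq_sqrt (by positivity)]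
          have : (2 * s.prevLength : ℝ) ≤ ((s.corral.rounds + 1 : ℕ) : ℝ) := by
            exact_mod_cast hprev
          linarith
        simp only [AlgState.fresh]
        have h2 := mul_le_mul_of_nonneg_left h1 (by positivity : 0 ≤ 1728 * √c₁)
        linarith
      · have h3 : logPotential (AlgState.fresh x'' (s.corral.rounds + 1) : AlgState K).corral = 0 :=
          if_pos rfl
        rw [h3, zero_div, add_zero]
        positivity
    · rw [he]
      refine ⟨E + corralRate c₁ s.corral, by linarith, ?_, fun hcand => ?_⟩
      · simp only [corralStep]
        linarith
      · simp only at hcand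
        have h1 := corralRate_le_log (G := G) c₁ hval.rounds_le hlam s.candidate (a t)
          (feedback G lo (a t) (l t))
        rw [hplay s hcand] at h1
        have h2 := hE₂ hcand
        rw [Finset.sum_range_succ]
        refine (add_le_add h2 h1).trans (le_of_eq ?_)
        ring

/-- The lengths of the epochs with a candidate other than `x'` are controlled by the number of
rounds in which `x'` is not played. -/
theorem exists_count_bound (hsel : ∀ s : Finset (Fin K), s.Nonempty → sel s ∈ s) (lo : ℝ)
    (x : Fin K) (l : ℕ → Fin K → ℝ) (a : ℕ → Fin K) (x' : Fin K) (t : ℕ) :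
    ∃ n : ℕ, (∑ i ∈ Finset.range t, if a i = x' then 0 else 1)
        + (algTrajectory G c₁ lo sel x l a t).count x'
          = n + (algTrajectory G c₁ lo sel x l a t).corral.rounds ∧
      (algTrajectory G c₁ lo sel x l a t).count x'
        ≤ (algTrajectory G c₁ lo sel x l a t).corral.rounds ∧
      (algTrajectory G c₁ lo sel x l a t).prevLength ≤ 4 * n + 1 ∧
      ((algTrajectory G c₁ lo sel x l a t).candidate ≠ x' →
        (algTrajectory G c₁ lo sel x l a t).prevLength ≤ 2 * n ∧
        (2 * (algTrajectory G c₁ lo sel x l a t).count x'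
            < (algTrajectory G c₁ lo sel x l a t).corral.rounds ∨
          (algTrajectory G c₁ lo sel x l a t).corral.rounds
            < 2 * (algTrajectory G c₁ lo sel x l a t).prevLength ∨
          (algTrajectory G c₁ lo sel x l a t).corral.rounds = 0)) := by
  induction t with
  | zero => exact ⟨0, by simp [algTrajectory, AlgState.fresh, CorralState.init]⟩
  | succ t ih =>
    obtain ⟨n, h1, h2, h3, h4⟩ := ih
    have hval := valid_algTrajectory (G := G) (c₁ := c₁) hsel lo x l a t
    simp only [algTrajectory]
    set s := algTrajectory G c₁ lo sel x l a t
    rw [Finset.sum_range_succ]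
    set N := ∑ i ∈ Finset.range t, if a i = x' then 0 else 1
    have hsum := (sum_update_succ s.count (a t)).trans (by rw [hval.sum_count])
    have hcount : Function.update s.count (a t) (s.count (a t) + 1) x'
        = s.count x' + if a t = x' then 1 else 0 := by
      by_cases h : a t = x'
      · rw [← h]; simp
      · rw [Function.update_of_ne (Ne.symm h), if_neg h, add_zero]
    have hsplit : (if a t = x' then 0 else 1) + (if a t = x' then 1 else 0) = 1 := by
      split_ifs <;> rfl
    have hle : (if a t = x' then 1 else 0) ≤ 1 := by split_ifs <;> norm_num
    rcases algStep_cases (G := G) (c₁ := c₁) hsel s (a t) (feedback G lo (a t) (l t)) with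
      ⟨v, he, hv, hfreq, hprev⟩ | ⟨he, hcont⟩
    · rw [he]
      have hpair : v ≠ x' → Function.update s.count (a t) (s.count (a t) + 1) v
          + Function.update s.count (a t) (s.count (a t) + 1) x' ≤ s.corral.rounds + 1 := by
        intro hne
        rw [← hsum, ← Finset.sum_pair hne]
        exact Finset.sum_le_sum_of_subset (Finset.subset_univ _)
      -- The witness `n` counts the plays of arms other than `x'` before the current epoch; it is
      -- updated only at restarts.
      refine ⟨N + if a t = x' then 0 else 1, by simp [AlgState.fresh, CorralState.init],
        by simp [AlgState.fresh, CorralState.init], ?_, fun hne => ⟨?_, ?_⟩⟩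
      · simp only [AlgState.fresh]
        -- If the new candidate is `x'`, the finished epoch had another candidate. Unless it was
        -- short, the failed restart test one round earlier shows `x'` was played less than half the
        -- time. The `+ 1` covers an epoch of length one. If the new candidate is not `x'`, it took
        -- at least half of the plays itself.
        by_cases hvx : v = x'
        · have h5 := h4 (fun h => hv (hvx.trans h.symm))
          omega
        · have := hpair hvx
          omega
      · simp only [AlgState.fresh] at hne ⊢
        have := hpair hne
        omega
      · exact Or.inr (Or.inr rfl)
    · rw [he]
      refine ⟨n, ?_, ?_, h3, fun hne => ⟨(h4 hne).1, ?_⟩⟩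
      · simp only [corralStep]; omega
      · simp only [corralStep]; omega
      · simp only [corralStep]
        rcases hcont x' (Ne.symm hne) with h5 | h5
        · exact Or.inr (Or.inl h5)
        · exact Or.inl h5

end Trajectory

end GraphBandit

namespace GraphBandit

/-! ### Pathwise bounds on the summed rate. -/

section PathBound

variable {K : ℕ} {G : Digraph (Fin K)} {c₁ : ℝ} {sel : Finset (Fin K) → Fin K}

theorem one_sub_algPlay_candidate (G : Digraph (Fin K)) (c₁ : ℝ) (s : AlgState K) :
    corralWeights c₁ s.corral 1 = 1 - algPlay G c₁ s s.candidate := by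
  have := corralWeights_sum c₁ s.corral
  unfold algPlay corralPlay
  rw [if_pos rfl]
  linarith

theorem algPlay_le_one (hK : 2 ≤ K) (G : Digraph (Fin K)) (c₁ : ℝ) (s : AlgState K) (a : Fin K) :
    algPlay G c₁ s a ≤ 1 := by
  rw [← algPlay_sum hK G c₁ s]
  exact Finset.single_le_sum (fun b _ => algPlay_nonneg hK G c₁ s b) (Finset.mem_univ a)

theorem sum_corralRate_le (hK : 2 ≤ K) (hsel : ∀ s : Finset (Fin K), s.Nonempty → sel s ∈ s)
    (lo : ℝ) (x : Fin K) (l : ℕ → Fin K → ℝ) (a : ℕ → Fin K) (t : ℕ) :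
    ∑ i ∈ Finset.range t, corralRate c₁ (algTrajectory G c₁ lo sel x l a i).corral
      ≤ 2160 * √c₁ * √(t : ℝ) := by
  obtain ⟨E, h1, h2, -⟩ := exists_epoch_bound (G := G) (c₁ := c₁) hsel lo x l a x one_pos
    (fun s hs => hs ▸ one_sub_algPlay_candidate G c₁ s) (fun s => algPlay_le_one hK G c₁ s x) t
  have hval := (valid_algTrajectory (G := G) (c₁ := c₁) hsel lo x l a t).length_le
  set s := algTrajectory G c₁ lo sel x l a t
  have h3 : √(s.corral.rounds : ℝ) ≤ √(t : ℝ) :=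
    Real.sqrt_le_sqrt (Nat.cast_le.2 (by omega))
  have h4 : √(s.prevLength : ℝ) ≤ √(t : ℝ) := Real.sqrt_le_sqrt (Nat.cast_le.2 (by omega))
  have h5 := mul_le_mul_of_nonneg_left h3 (by positivity : 0 ≤ 432 * √c₁)
  have h6 := mul_le_mul_of_nonneg_left h4 (by positivity : 0 ≤ 1728 * √c₁)
  linarith

/-- If the current candidate is `x'`, its epoch is bounded logarithmically and only the previous
length is charged to the plays of other arms. Otherwise the current length, too, is at most four
times the number of such plays. Square roots of these counts become `lam * N + 1 / lam`. -/
theorem sum_corralRate_le_log (hK : 2 ≤ K)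
    (hsel : ∀ s : Finset (Fin K), s.Nonempty → sel s ∈ s)
    (lo : ℝ) (x : Fin K) (l : ℕ → Fin K → ℝ) (a : ℕ → Fin K) (x' : Fin K) {lam : ℝ}
    (hlam : 0 < lam) {T : ℕ} (hT : 2 ≤ T) :
    ∑ i ∈ Finset.range T, corralRate c₁ (algTrajectory G c₁ lo sel x l a i).corral
      ≤ 3300 * √c₁ * (1 + lam * (∑ i ∈ Finset.range T, (if a i = x' then 0 else 1)
          + ∑ i ∈ Finset.range T, (1 - algPlay G c₁ (algTrajectory G c₁ lo sel x l a i) x'))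
        + Real.log T / lam) := by
  obtain ⟨E, h1, h2, h3⟩ := exists_epoch_bound (G := G) (c₁ := c₁) hsel lo x l a x' hlam
    (fun s hs => hs ▸ one_sub_algPlay_candidate G c₁ s) (fun s => algPlay_le_one hK G c₁ s x') T
  obtain ⟨n, g1, g2, g3, g4⟩ := exists_count_bound (G := G) (c₁ := c₁) hsel lo x l a x' T
  have hval := valid_algTrajectory (G := G) (c₁ := c₁) hsel lo x l a T
  have hQ : 0 ≤ ∑ i ∈ Finset.range T,
      (1 - algPlay G c₁ (algTrajectory G c₁ lo sel x l a i) x') :=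
    Finset.sum_nonneg fun i _ => sub_nonneg.2 (algPlay_le_one hK G c₁ _ x')
  have hN : (∑ i ∈ Finset.range T, (if a i = x' then (0 : ℝ) else 1))
      = ((∑ i ∈ Finset.range T, if a i = x' then 0 else 1 : ℕ) : ℝ) := by
    push_cast; rfl
  rw [hN]
  set N := ∑ i ∈ Finset.range T, if a i = x' then 0 else 1
  set Q := ∑ i ∈ Finset.range T, (1 - algPlay G c₁ (algTrajectory G c₁ lo sel x l a i) x')
  set s := algTrajectory G c₁ lo sel x l a T
  have hlog2 := Real.log_two_gt_d9
  have hlogT : Real.log 2 ≤ Real.log T := Real.log_le_log two_pos (by exact_mod_cast hT)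
  have hinv : 1 / lam ≤ 3 / 2 * (Real.log T / lam) := by
    rw [← mul_div_assoc]
    exact div_le_div_of_nonneg_right (by linarith) hlam.le
  have hL : 0 ≤ Real.log T / lam := div_nonneg (by linarith) hlam.le
  have hinv₀ : 0 < 1 / lam := by positivity
  have hs1 := Real.sqrt_nonneg c₁
  have hsqrtN : √(4 * (N : ℝ)) ≤ lam * N + 1 / lam := by
    have := sqrt_le_mul_add_div hlam (v := (N : ℝ)) (Nat.cast_nonneg _)
    rw [Real.sqrt_mul (by norm_num), show (4 : ℝ) = 2 ^ 2 by norm_num,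
      Real.sqrt_sq (by norm_num)]
    have e : 1 / lam = 2 * (1 / (2 * lam)) := by field_simp
    linarith
  by_cases hcand : s.candidate = x'
  · have hE := h3 hcand
    have hlp := logPotential_le hT (by have := hval.length_le; omega) hval.weight_le hval.rounds_le
    have hprev : √(s.prevLength : ℝ) ≤ 1 + (lam * N + 1 / lam) := by
      refine (Real.sqrt_le_sqrt (y := 1 + 4 * (N : ℝ)) ?_).trans ?_
      · exact_mod_cast (by omega : s.prevLength ≤ 1 + 4 * N)
      · rw [Real.sqrt_le_left (by positivity)]
        have h5 := Real.sq_sqrt (by positivity : 0 ≤ 4 * (N : ℝ))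
        nlinarith [Real.sqrt_nonneg (4 * (N : ℝ))]
    have h5 := div_le_div_of_nonneg_right hlp (by positivity : 0 ≤ 2 * lam)
    have e5 : 9 * Real.log T / (2 * lam) = 9 / 2 * (Real.log T / lam) := by field_simp
    rw [e5] at h5
    have h6 := mul_le_mul_of_nonneg_left h5 (by positivity : 0 ≤ 108 * √c₁)
    have h7 := mul_le_mul_of_nonneg_left hprev (by positivity : 0 ≤ 1728 * √c₁)
    have h8 := mul_le_mul_of_nonneg_left hinv (by positivity : 0 ≤ 1728 * √c₁)
    have p1 : 0 ≤ √c₁ * (lam * Q) := by positivity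
    have p2 : 0 ≤ √c₁ * (lam * N) := by positivity
    have p3 : 0 ≤ √c₁ * (Real.log T / lam) := by positivity
    linarith
  · obtain ⟨g5, g6⟩ := g4 hcand
    have hr : √(s.corral.rounds : ℝ) ≤ lam * N + 1 / lam := by
      refine (Real.sqrt_le_sqrt (y := 4 * (N : ℝ)) ?_).trans hsqrtN
      exact_mod_cast (by omega : s.corral.rounds ≤ 4 * N)
    have hprev : √(s.prevLength : ℝ) ≤ lam * N + 1 / lam := by
      refine (Real.sqrt_le_sqrt (y := 4 * (N : ℝ)) ?_).trans hsqrtN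
      exact_mod_cast (by omega : s.prevLength ≤ 4 * N)
    have h6 := mul_le_mul_of_nonneg_left hr (by positivity : 0 ≤ 432 * √c₁)
    have h7 := mul_le_mul_of_nonneg_left hprev (by positivity : 0 ≤ 1728 * √c₁)
    have h8 := mul_le_mul_of_nonneg_left hinv (by positivity : 0 ≤ 2160 * √c₁)
    have p1 : 0 ≤ √c₁ * (lam * Q) := by positivity
    have p2 : 0 ≤ √c₁ * (lam * N) := by positivity
    have p3 : 0 ≤ √c₁ * (Real.log T / lam) := by positivity
    linarith

end PathBound

/-! ## Measurability -/

instance (K : ℕ) : MeasurableSpace (BaseState K) :=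
  MeasurableSpace.comap (fun b => (b.cumLoss, b.cumWeight)) inferInstance

instance (K : ℕ) : MeasurableSpace (CorralState K) :=
  MeasurableSpace.comap (fun s => (s.rounds, s.cumZ, s.base)) inferInstance

instance (K : ℕ) : MeasurableSpace (AlgState K) :=
  MeasurableSpace.comap (fun s => (s.candidate, s.prevLength, s.count, s.corral)) inferInstance

section Measurability

variable {α : Type*} {mα : MeasurableSpace α} {K : ℕ}

/-- Actions, candidates and counters are discrete, so measurability can be checked with their values
frozen. -/
theorem measurable_discrete_comp {ι γ : Type*} [MeasurableSpace ι] [Countable ι]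
    [MeasurableSingletonClass ι] {mγ : MeasurableSpace γ} {c : α → ι} (hc : Measurable c)
    {F : ι → α → γ} (hF : ∀ i, Measurable (F i)) : Measurable fun ω => F (c ω) ω :=
  (measurable_from_prod_countable_right (f := fun p : ι × α => F p.1 p.2) hF).comp
    (hc.prodMk measurable_id)

theorem measurable_of_forall_eq {γ : Type*} {mγ : MeasurableSpace γ} {f g : α → γ}
    (hf : Measurable f) (h : ∀ ω, f ω = g ω) : Measurable g := (funext h : f = g) ▸ hf

theorem measurable_pair_iff {β γ : Type*} {mβ : MeasurableSpace β} {mγ : MeasurableSpace γ}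
    {f : α → β} {g : α → γ} :
    Measurable (fun ω => (f ω, g ω)) ↔ Measurable f ∧ Measurable g :=
  ⟨fun h => ⟨h.fst, h.snd⟩, fun h => h.1.prodMk h.2⟩

theorem measurable_baseState_iff {f : α → BaseState K} : Measurable f ↔
    Measurable (fun ω => (f ω).cumLoss) ∧ Measurable fun ω => (f ω).cumWeight :=
  measurable_comap_iff.trans measurable_pair_iff

theorem measurable_corralState_iff {f : α → CorralState K} : Measurable f ↔
    Measurable (fun ω => (f ω).rounds) ∧ Measurable (fun ω => (f ω).cumZ) ∧
      Measurable fun ω => (f ω).base :=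
  measurable_comap_iff.trans (measurable_pair_iff.trans (and_congr_right fun _ => measurable_pair_iff))

theorem measurable_algState_iff {f : α → AlgState K} : Measurable f ↔
    Measurable (fun ω => (f ω).candidate) ∧ Measurable (fun ω => (f ω).prevLength) ∧
      Measurable (fun ω => (f ω).count) ∧ Measurable fun ω => (f ω).corral :=
  measurable_comap_iff.trans (measurable_pair_iff.trans (and_congr_right fun _ =>
    measurable_pair_iff.trans (and_congr_right fun _ => measurable_pair_iff)))

/-- The choice made by `argminOn` is unique for positive scale, hence continuous in the data there.
-/
theorem measurable_argmin_ftrlObj {ι : Type*} [Fintype ι] {S : Finset ι} (hS : S.Nonempty) {β : ℝ}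
    (hβ₀ : 0 < β) (hβ₁ : β < 1) {L : α → ι → ℝ} {r : α → ℝ} (hL : Measurable L) (hr : Measurable r)
    (hpos : ∀ ω, 0 < r ω) :
    Measurable fun ω => argminOn (supportedSimplex S) (ftrlObj S β (r ω) (L ω)) := by
  classical
  have hcont := continuousOn_ftrl (S := S) hβ₀ hβ₁
    (φ := fun z => argminOn (supportedSimplex S) (ftrlObj S β z.2 z.1))
    fun z _ => argminOn_spec (exists_isMinOn_ftrlObj hS hβ₀.le z.2 z.1)
  have hmeas := hcont.measurable_piecewise (g := fun _ => (0 : ι → ℝ)) continuousOn_const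
    (measurableSet_lt measurable_const measurable_snd)
  have h := hmeas.comp (hL.prodMk hr)
  refine measurable_of_forall_eq h fun ω => ?_
  exact Set.piecewise_eq_of_mem _ _ _ (hpos ω)

theorem measurable_ftrlPotential {ι : Type*} [Fintype ι] (S : Finset ι) {β : ℝ} (hβ₀ : 0 ≤ β)
    {L : α → ι → ℝ} {r : α → ℝ} (hL : Measurable L) (hr : Measurable r) (u : ι) :
    Measurable fun ω => ftrlPotential S β (r ω) (L ω) u := by
  have hc : Measurable fun z : (ι → ℝ) × ℝ => ftrlValue S β z.2 z.1 :=
    (continuous_ftrlValue S hβ₀).measurable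
  have h2 : Measurable ((fun z : (ι → ℝ) × ℝ => ftrlValue S β z.2 z.1) ∘ fun ω => (L ω, r ω)) :=
    hc.comp (hL.prodMk hr)
  have h1 : Measurable fun ω => L ω u := (measurable_pi_apply u).comp hL
  unfold ftrlPotential
  exact (h1.sub hr).sub h2

theorem measurable_tsallisScale (G : Digraph (Fin K)) {W : α → ℝ} (hW : Measurable W) :
    Measurable fun ω => tsallisScale G (W ω) := by
  unfold tsallisScale
  fun_prop

theorem measurable_basePlay (hK : 2 ≤ K) (G : Digraph (Fin K)) (x : Fin K) {b : α → BaseState K}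
    {q : α → ℝ} (hb : Measurable b) (hq : Measurable q) (hW : ∀ ω, 0 ≤ (b ω).cumWeight)
    (hq₀ : ∀ ω, 0 < q ω) :
    Measurable fun ω => basePlay G (Finset.univ.erase x) (b ω) (q ω) := by
  obtain ⟨hL, hWm⟩ := measurable_baseState_iff.1 hb
  rcases hK.eq_or_lt with rfl | hK3
  · have h : ∀ ω, basePlay G (Finset.univ.erase x) (b ω) (q ω)
        = fun i => if i ∈ Finset.univ.erase x then 1 else 0 := by
      intro ω
      have hp := basePlay_mem hK G x (b ω) (q ω)
      ext i
      split_ifs with hi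
      · have := sum_mul_eq_of_two rfl hi hp fun _ => 1
        have h2 := sum_mul_eq_of_two rfl hi hp (Pi.single i 1)
        rw [Finset.sum_eq_single_of_mem i hi fun j _ hj => by simp [hj]] at h2
        simpa using h2
      · exact hp.2 i hi
    simp only [h]
    exact measurable_const
  · refine measurable_of_forall_eq (measurable_argmin_ftrlObj (erase_nonempty hK x)
      (tsallisExponent_pos hK3) (tsallisExponent_lt_one hK3) hL
      (r := fun ω => tsallisScale G ((b ω).cumWeight + 1 / q ω))
      (measurable_tsallisScale G (hWm.add (measurable_const.div hq))) fun ω => ?_) fun ω => ?_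
    · have : 0 < 1 / q ω := one_div_pos.2 (hq₀ ω)
      exact tsallisScale_pos hK3 G (add_pos_of_nonneg_of_pos (hW ω) this)
    · unfold basePlay
      simp only [basePlay_objective]
      rfl

theorem measurable_heavyIndicator (G : Digraph (Fin K)) {p : α → Fin K → ℝ} (hp : Measurable p)
    (i : Fin K) : Measurable fun ω => heavyIndicator G (p ω) i := by
  classical
  have hpi : Measurable fun ω => p ω i := (measurable_pi_apply i).comp hp
  unfold heavyIndicator
  exact Measurable.ite ((MeasurableSet.const _).inter (measurableSet_lt measurable_const hpi))
    measurable_const measurable_const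

theorem measurable_baseStep (hK : 2 ≤ K) (G : Digraph (Fin K)) (x : Fin K) {b : α → BaseState K}
    {q : α → ℝ} (hb : Measurable b) (hq : Measurable q) (hW : ∀ ω, 0 ≤ (b ω).cumWeight)
    (hq₀ : ∀ ω, 0 < q ω) (a : Fin K) (upd : Prop) {y : α → Fin K → ℝ} (hy : Measurable y) :
    Measurable fun ω => baseStep G (Finset.univ.erase x) (b ω) (q ω) a upd (y ω) := by
  classical
  have hp := measurable_basePlay hK G x hb hq hW hq₀
  have hp' : ∀ i, Measurable fun ω => basePlay G (Finset.univ.erase x) (b ω) (q ω) i :=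
    fun i => (measurable_pi_apply i).comp hp
  obtain ⟨hL, hWm⟩ := measurable_baseState_iff.1 hb
  refine measurable_baseState_iff.2 ⟨measurable_pi_iff.2 fun i => ?_, ?_⟩
  · have hh := measurable_heavyIndicator G hp i
    refine ((measurable_pi_apply i).comp hL).add (Measurable.add ?_ hh)
    refine Measurable.ite (MeasurableSet.const _) ?_ measurable_const
    exact (((measurable_pi_apply i).comp hy).sub hh).div
      (Finset.measurable_sum _ fun j _ => (hp' j).mul hq)
  · exact hWm.add (measurable_const.div hq)

theorem measurable_corralWeights (c₁ : ℝ) {s : α → CorralState K} (hs : Measurable s) (i : Fin 2) :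
    Measurable fun ω => corralWeights c₁ (s ω) i := by
  obtain ⟨hr, hz, hb⟩ := measurable_corralState_iff.1 hs
  obtain ⟨-, hW⟩ := measurable_baseState_iff.1 hb
  have hloss : Measurable fun ω => corralLoss c₁ (s ω) := by
    refine measurable_pi_iff.2 fun j => ((measurable_pi_apply j).comp hz).sub ?_
    refine Measurable.ite (MeasurableSet.const _) ?_ measurable_const
    unfold corralBonus
    fun_prop
  have hscale : Measurable fun ω => corralScale c₁ ((s ω).rounds + 1) :=
    (measurable_from_top (f := fun n => corralScale c₁ (n + 1))).comp hr
  have hun : Measurable fun ω => corralUnmixed c₁ (s ω) := by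
    refine measurable_of_forall_eq (measurable_argmin_ftrlObj (S := (Finset.univ : Finset (Fin 2)))
      Finset.univ_nonempty (β := 1 / 2) (by norm_num) (by norm_num) hloss hscale
      fun ω => corralScale_succ_pos c₁ _) fun ω => ?_
    have hspec := argminOn_spec (exists_isMinOn_ftrlObj (S := (Finset.univ : Finset (Fin 2)))
      Finset.univ_nonempty (β := 1 / 2) (by norm_num) (corralScale c₁ ((s ω).rounds + 1))
      (corralLoss c₁ (s ω)))
    -- Uniqueness identifies the minimizer chosen in the algorithm with the one chosen through
    -- `ftrlObj`.
    exact ftrl_unique (by norm_num) (by norm_num) (corralScale_succ_pos c₁ _)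
      (corralUnmixed_spec c₁ (s ω)).1 (corralUnmixed_spec c₁ (s ω)).2 hspec.1 hspec.2
  have hn : ∀ f : ℕ → ℝ, Measurable fun ω => f (s ω).rounds := fun f =>
    (measurable_from_top (f := f)).comp hr
  exact ((hn fun n => 1 - 1 / (2 * ((n + 1 : ℕ) : ℝ) ^ 2)).mul
    ((measurable_pi_apply i).comp hun)).add (hn fun n => 1 / (4 * ((n + 1 : ℕ) : ℝ) ^ 2))

theorem measurable_corralBasePlay (hK : 2 ≤ K) (G : Digraph (Fin K)) (c₁ : ℝ) (x : Fin K)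
    {s : α → CorralState K} (hs : Measurable s) (hW : ∀ ω, 0 ≤ (s ω).base.cumWeight) :
    Measurable fun ω => corralBasePlay G c₁ x (s ω) :=
  measurable_basePlay hK G x (measurable_corralState_iff.1 hs).2.2
    (measurable_corralWeights c₁ hs 1) hW fun ω => corralWeights_pos c₁ (s ω) 1

theorem measurable_corralPlay (hK : 2 ≤ K) (G : Digraph (Fin K)) (c₁ : ℝ) (x : Fin K)
    {s : α → CorralState K} (hs : Measurable s) (hW : ∀ ω, 0 ≤ (s ω).base.cumWeight) (a : Fin K) :
    Measurable fun ω => corralPlay G c₁ x (s ω) a :=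
  Measurable.ite (MeasurableSet.const _) (measurable_corralWeights c₁ hs 0)
    ((measurable_corralWeights c₁ hs 1).mul
      ((measurable_pi_apply a).comp (measurable_corralBasePlay hK G c₁ x hs hW)))

theorem measurable_surrogate (G : Digraph (Fin K)) (x : Fin K) {p y : α → Fin K → ℝ}
    (hp : Measurable p) (hy : Measurable y) (a : Fin K) :
    Measurable fun ω => surrogate G x (p ω) (y ω) a := by
  classical
  have hp' : ∀ i, Measurable fun ω => p ω i := fun i => (measurable_pi_apply i).comp hp
  have hy' : ∀ i, Measurable fun ω => y ω i := fun i => (measurable_pi_apply i).comp hy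
  unfold surrogate
  refine Measurable.ite (MeasurableSet.const _) (Measurable.sub ?_ ?_) (Measurable.sub ?_ ?_)
  · exact Measurable.ite (MeasurableSet.const _) (hy' x) measurable_const
  · exact Finset.measurable_sum _ fun j _ =>
      Measurable.ite (MeasurableSet.const _) measurable_const ((hp' j).mul (hy' j))
  · exact Measurable.ite (MeasurableSet.const _) (hy' a) measurable_const
  · exact Measurable.ite (MeasurableSet.const _) measurable_const (hy' x)

theorem measurable_corralStep (hK : 2 ≤ K) (G : Digraph (Fin K)) (c₁ : ℝ) (x : Fin K)
    {s : α → CorralState K} (hs : Measurable s) (hW : ∀ ω, 0 ≤ (s ω).base.cumWeight) (a : Fin K)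
    {y : α → Fin K → ℝ} (hy : Measurable y) :
    Measurable fun ω => corralStep G c₁ x (s ω) a (y ω) := by
  obtain ⟨hr, hz, hb⟩ := measurable_corralState_iff.1 hs
  refine measurable_corralState_iff.2 ⟨hr.add_const 1, measurable_pi_iff.2 fun i => ?_, ?_⟩
  · refine ((measurable_pi_apply i).comp hz).add (Measurable.sub_const ?_ 1)
    refine Measurable.div (Measurable.mul_const (Measurable.add_const ?_ 1) _)
      (measurable_corralWeights c₁ hs i)
    exact measurable_surrogate G x (measurable_corralBasePlay hK G c₁ x hs hW) hy a
  · exact measurable_baseStep hK G x hb (measurable_corralWeights c₁ hs 1) hW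
      (fun ω => corralWeights_pos c₁ (s ω) 1) a _ hy

theorem measurable_algStep (hK : 2 ≤ K) (G : Digraph (Fin K)) (c₁ : ℝ)
    (sel : Finset (Fin K) → Fin K) {s : α → AlgState K} (hs : Measurable s)
    (hW : ∀ ω, 0 ≤ (s ω).corral.base.cumWeight) (a : Fin K) {y : α → Fin K → ℝ}
    (hy : Measurable y) : Measurable fun ω => algStep G c₁ sel (s ω) a (y ω) := by
  classical
  obtain ⟨hcand, hprev, hcount, hcor⟩ := measurable_algState_iff.1 hs
  have hr := (measurable_corralState_iff.1 hcor).1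
  -- With candidate, previous length, counts and round number frozen in `d`, the restart test is
  -- constant in `ω`.
  set F : Fin K × ℕ × (Fin K → ℕ) × ℕ → α → AlgState K := fun d ω =>
    if 2 * d.2.1 ≤ d.2.2.2 + 1 ∧ ((Finset.univ.erase d.1).filter fun x =>
        d.2.2.2 + 1 ≤ 2 * Function.update d.2.2.1 a (d.2.2.1 a + 1) x).Nonempty then
      AlgState.fresh (sel ((Finset.univ.erase d.1).filter fun x =>
        d.2.2.2 + 1 ≤ 2 * Function.update d.2.2.1 a (d.2.2.1 a + 1) x)) (d.2.2.2 + 1)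
    else ⟨d.1, d.2.1, Function.update d.2.2.1 a (d.2.2.1 a + 1),
      corralStep G c₁ d.1 (s ω).corral a (y ω)⟩ with hF
  have hFm : ∀ d, Measurable (F d) := by
    intro d
    refine Measurable.ite (MeasurableSet.const _) measurable_const ?_
    exact measurable_algState_iff.2 ⟨measurable_const, measurable_const, measurable_const,
      measurable_corralStep hK G c₁ d.1 hcor hW a hy⟩
  exact measurable_discrete_comp (hcand.prodMk (hprev.prodMk (hcount.prodMk hr))) hFm

theorem measurable_algPlay (hK : 2 ≤ K) (G : Digraph (Fin K)) (c₁ : ℝ) {s : α → AlgState K}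
    (hs : Measurable s) (hW : ∀ ω, 0 ≤ (s ω).corral.base.cumWeight) (a : Fin K) :
    Measurable fun ω => algPlay G c₁ (s ω) a := by
  obtain ⟨hcand, -, -, hcor⟩ := measurable_algState_iff.1 hs
  exact measurable_discrete_comp hcand fun x => measurable_corralPlay hK G c₁ x hcor hW a

theorem measurable_basePotential (hK : 3 ≤ K) (G : Digraph (Fin K)) (S : Finset (Fin K))
    (u : Fin K) {b : α → BaseState K} (hb : Measurable b) :
    Measurable fun ω => basePotential G S u (b ω) := by
  obtain ⟨hL, hW⟩ := measurable_baseState_iff.1 hb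
  exact measurable_ftrlPotential S (tsallisExponent_pos hK).le hL (measurable_tsallisScale G hW) u

theorem measurable_corralPotential (c₁ : ℝ) (e : Fin 2) {s : α → CorralState K}
    (hs : Measurable s) : Measurable fun ω => corralPotential c₁ e (s ω) := by
  obtain ⟨hr, hz, hb⟩ := measurable_corralState_iff.1 hs
  obtain ⟨-, hW⟩ := measurable_baseState_iff.1 hb
  refine measurable_ftrlPotential _ (by norm_num) (measurable_pi_iff.2 fun j => ?_)
    ((measurable_from_top (f := fun n => corralScale c₁ n)).comp hr) e
  refine ((measurable_pi_apply j).comp hz).sub ?_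
  refine Measurable.ite (MeasurableSet.const _) ?_ measurable_const
  unfold corralBonus
  fun_prop

theorem measurable_algPotential (hK : 2 ≤ K) (G : Digraph (Fin K)) (c₁ : ℝ) (u : Fin K)
    {s : α → AlgState K} (hs : Measurable s) : Measurable fun ω => algPotential G c₁ u (s ω) := by
  obtain ⟨hcand, -, -, hcor⟩ := measurable_algState_iff.1 hs
  refine measurable_discrete_comp (F := fun x ω => candidatePotential G c₁ u x (s ω).corral) hcand
    fun x => ?_
  unfold candidatePotential
  split_ifs with h1 h2
  · exact measurable_corralPotential c₁ 0 hcor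
  · exact (measurable_corralPotential c₁ 1 hcor).add_const 0
  · exact (measurable_corralPotential c₁ 1 hcor).add (measurable_basePotential (by omega) G _ u
      (measurable_corralState_iff.1 hcor).2.2)

theorem measurable_corralRate (c₁ : ℝ) {s : α → CorralState K} (hs : Measurable s) :
    Measurable fun ω => corralRate c₁ (s ω) := by
  obtain ⟨hr, -, hb⟩ := measurable_corralState_iff.1 hs
  obtain ⟨-, hW⟩ := measurable_baseState_iff.1 hb
  have hq := measurable_corralWeights c₁ hs 1
  have hn : Measurable fun ω => (((s ω).rounds + 1 : ℕ) : ℝ) :=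
    (measurable_from_top (f := fun n : ℕ => ((n + 1 : ℕ) : ℝ))).comp hr
  unfold corralRate
  fun_prop

theorem measurable_feedback (G : Digraph (Fin K)) (lo : ℝ) (a : Fin K) {l : α → Fin K → ℝ}
    (hl : Measurable l) : Measurable fun ω => feedback G lo a (l ω) := by
  classical
  refine measurable_pi_iff.2 fun j => ?_
  have hj : Measurable fun ω => l ω j := (measurable_pi_apply j).comp hl
  exact Measurable.ite (MeasurableSet.const _) ((hj.sub_const lo).div_const _) measurable_const

end Measurability

end GraphBandit

namespace GraphBandit

/-! ## Integrating over a randomized action -/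

/-- On the sub-σ-algebra, `μ` restricted to `E` has density `ρ`. Working with lower integrals avoids
any integrability assumption on `f`. -/
theorem setLIntegral_of_condExp_indicator {Ω : Type*} {m m₀ : MeasurableSpace Ω} (hm : m ≤ m₀)
    {μ : Measure Ω} [IsProbabilityMeasure μ] {E : Set Ω} (hE : MeasurableSet[m₀] E) {ρ : Ω → ℝ}
    (hρ : Measurable[m] ρ) (hρ₀ : ∀ ω, 0 ≤ ρ ω)
    (hlaw : μ[E.indicator (fun _ => (1 : ℝ)) | m] =ᵐ[μ] ρ) {f : Ω → ENNReal}
    (hf : Measurable[m] f) :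
    ∫⁻ ω in E, f ω ∂μ = ∫⁻ ω, ENNReal.ofReal (ρ ω) * f ω ∂μ := by
  have hint : Integrable (E.indicator fun _ => (1 : ℝ)) μ :=
    (integrable_const 1).indicator hE
  have hρi : Integrable ρ μ := integrable_condExp.congr hlaw
  have hρm : Measurable[m] fun ω => ENNReal.ofReal (ρ ω) := ENNReal.measurable_ofReal.comp hρ
  have hmeas : (μ.restrict E).trim hm
      = (μ.trim hm).withDensity fun ω => ENNReal.ofReal (ρ ω) := by
    refine @Measure.ext _ m _ _ fun s hs => ?_
    rw [trim_measurableSet_eq hm hs, withDensity_apply _ hs, ← lintegral_indicator hs,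
      lintegral_trim hm (hρm.indicator hs), lintegral_indicator (hm s hs),
      ← ofReal_integral_eq_lintegral_ofReal hρi.integrableOn
        (Filter.Eventually.of_forall hρ₀),
      ← setIntegral_congr_ae (hm s hs) (hlaw.mono fun ω h _ => h),
      setIntegral_condExp hm hint hs, setIntegral_indicator hE, setIntegral_const,
      Measure.restrict_apply (hm s hs)]
    simp [Measure.real]
  rw [← lintegral_trim hm hf, hmeas, lintegral_withDensity_eq_lintegral_mul _ hρm hf,
    lintegral_trim hm (hρm.mul hf)]
  rfl

theorem apply_eq_sum_indicator {Ω β γ : Type*} [Fintype β] [AddCommMonoid γ] (X : Ω → β)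
    (g : β → Ω → γ) (ω : Ω) : g (X ω) ω = ∑ b, Set.indicator {ω | X ω = b} (g b) ω := by
  rw [Finset.sum_eq_single (X ω)]
  · simp
  · intro b _ hb
    exact Set.indicator_of_notMem (fun h => hb h.symm) _
  · simp

/-- Averages over a finite random choice. Nonnegativity of `F` makes integrability a conclusion,
which is what an induction on potentials needs. -/
theorem integral_randomized_le {Ω β : Type*} [Fintype β] {m m₀ : MeasurableSpace Ω} (hm : m ≤ m₀)
    {μ : Measure Ω} [IsProbabilityMeasure μ] {X : Ω → β}
    (hX : ∀ b, MeasurableSet[m₀] {ω | X ω = b}) {π : β → Ω → ℝ} (hπ : ∀ b, Measurable[m] (π b))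
    (hπ₀ : ∀ b ω, 0 ≤ π b ω)
    (hlaw : ∀ b, μ[Set.indicator {ω | X ω = b} (fun _ => (1 : ℝ)) | m] =ᵐ[μ] π b)
    {F : β → Ω → ℝ} (hF : ∀ b, Measurable[m] (F b)) (hF₀ : ∀ b ω, 0 ≤ F b ω)
    {H : Ω → ℝ} (hH : Integrable H μ) (hle : ∀ ω, ∑ b, π b ω * F b ω ≤ H ω) :
    Integrable (fun ω => F (X ω) ω) μ ∧ ∫ ω, F (X ω) ω ∂μ ≤ ∫ ω, H ω ∂μ := by
  classical
  have hF' : ∀ b, Measurable (F b) := fun b => (hF b).mono hm le_rfl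
  have hFX : Measurable fun ω => F (X ω) ω := by
    exact measurable_of_forall_eq
      (Finset.measurable_sum Finset.univ fun b _ => (hF' b).indicator (hX b))
      fun ω => (apply_eq_sum_indicator X F ω).symm
  have hFm : ∀ b, Measurable[m] fun ω => ENNReal.ofReal (F b ω) := fun b =>
    ENNReal.measurable_ofReal.comp (hF b)
  have hH₀ : ∀ ω, 0 ≤ H ω := fun ω =>
    (Finset.sum_nonneg fun b _ => mul_nonneg (hπ₀ b ω) (hF₀ b ω)).trans (hle ω)
  have hlin : ∫⁻ ω, ENNReal.ofReal (F (X ω) ω) ∂μ ≤ ∫⁻ ω, ENNReal.ofReal (H ω) ∂μ := by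
    calc ∫⁻ ω, ENNReal.ofReal (F (X ω) ω) ∂μ
        = ∫⁻ ω, ∑ b, Set.indicator {ω | X ω = b} (fun ω => ENNReal.ofReal (F b ω)) ω ∂μ :=
          lintegral_congr fun ω => apply_eq_sum_indicator X (fun b ω => ENNReal.ofReal (F b ω)) ω
      _ = ∑ b, ∫⁻ ω, ENNReal.ofReal (π b ω) * ENNReal.ofReal (F b ω) ∂μ := by
          rw [lintegral_finsetSum _ fun b _ => ((hFm b).mono hm le_rfl).indicator (hX b)]
          refine Finset.sum_congr rfl fun b _ => ?_
          rw [lintegral_indicator (hX b), setLIntegral_of_condExp_indicator hm (hX b) (hπ b) (hπ₀ b)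
            (hlaw b) (hFm b)]
      _ = ∫⁻ ω, ∑ b, ENNReal.ofReal (π b ω) * ENNReal.ofReal (F b ω) ∂μ :=
          (lintegral_finsetSum _ fun b _ => (ENNReal.measurable_ofReal.comp
            ((hπ b).mono hm le_rfl)).mul ((hFm b).mono hm le_rfl)).symm
      _ ≤ ∫⁻ ω, ENNReal.ofReal (H ω) ∂μ := by
          refine lintegral_mono fun ω => ?_
          calc ∑ b, ENNReal.ofReal (π b ω) * ENNReal.ofReal (F b ω)
              = ENNReal.ofReal (∑ b, π b ω * F b ω) := by
                rw [ENNReal.ofReal_sum_of_nonneg fun b _ => mul_nonneg (hπ₀ b ω) (hF₀ b ω)]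
                exact Finset.sum_congr rfl fun b _ => (ENNReal.ofReal_mul (hπ₀ b ω)).symm
            _ ≤ _ := ENNReal.ofReal_le_ofReal (hle ω)
  have hfin : ∫⁻ ω, ENNReal.ofReal (F (X ω) ω) ∂μ < ⊤ :=
    hlin.trans_lt ((lintegral_mono fun ω => Real.ofReal_le_enorm _).trans_lt hH.2)
  have hInt : Integrable (fun ω => F (X ω) ω) μ :=
    ⟨hFX.aestronglyMeasurable, (hasFiniteIntegral_iff_ofReal
      (Filter.Eventually.of_forall fun ω => hF₀ _ ω)).2 hfin⟩
  refine ⟨hInt, ?_⟩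
  rw [← ENNReal.ofReal_le_ofReal_iff (integral_nonneg hH₀),
    ofReal_integral_eq_lintegral_ofReal hInt (Filter.Eventually.of_forall fun ω => hF₀ _ ω),
    ofReal_integral_eq_lintegral_ofReal hH (Filter.Eventually.of_forall hH₀)]
  exact hlin

/-! ## Regret bounds for the full algorithm -/

/-- The state of the algorithm before round `t`. -/
noncomputable abbrev runState {K : ℕ} (G : Digraph (Fin K)) (c₁ lo : ℝ)
    (sel : Finset (Fin K) → Fin K) {Ω : Type*} (ℓ : ℕ → Ω → Fin K → ℝ) (x₁ : Ω → Fin K)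
    (A : ℕ → Ω → Fin K) (t : ℕ) (ω : Ω) : AlgState K :=
  algTrajectory G c₁ lo sel (x₁ ω) (fun s => ℓ s ω) (fun s => A s ω) t

theorem rescale_mem {lo l : ℝ} (hlo : lo ≤ 0) (hl : l ∈ Set.Icc lo 1) :
    (l - lo) / (1 - lo) ∈ Set.Icc (0 : ℝ) 1 := by
  have : 0 < 1 - lo := by linarith
  exact ⟨div_nonneg (by linarith [hl.1]) this.le, (div_le_one this).2 (by linarith [hl.2])⟩

theorem feedback_eq {K : ℕ} {G : Digraph (Fin K)} (lo : ℝ) {a j : Fin K} (h : G.Adj a j)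
    (l : Fin K → ℝ) : feedback G lo a l j = (l j - lo) / (1 - lo) := if_pos h

section Run

variable {K : ℕ} {G : Digraph (Fin K)} {c₁ lo : ℝ} {sel : Finset (Fin K) → Fin K} {T : ℕ}
  {Ω : Type*} {m : MeasurableSpace Ω} {μ : Measure Ω} {ℱ : Filtration ℕ m}
  {ℓ : ℕ → Ω → Fin K → ℝ} {x₁ : Ω → Fin K} {A : ℕ → Ω → Fin K}

theorem runState_cumWeight_nonneg (hsel : ∀ s : Finset (Fin K), s.Nonempty → sel s ∈ s) (t : ℕ)
    (ω : Ω) : 0 ≤ (runState G c₁ lo sel ℓ x₁ A t ω).corral.base.cumWeight :=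
  (valid_algTrajectory hsel lo _ _ _ t).cumWeight_nonneg

theorem IsRun.measurable_runState (h : IsRun G c₁ lo sel T μ ℱ ℓ x₁ A) (hK : 2 ≤ K)
    (hsel : ∀ s : Finset (Fin K), s.Nonempty → sel s ∈ s) {t : ℕ} (ht : t ≤ T) :
    Measurable[ℱ t] (runState G c₁ lo sel ℓ x₁ A t) := by
  induction t with
  | zero =>
    exact measurable_discrete_comp (mα := ℱ 0) h.init_measurable
      (F := fun v _ => AlgState.fresh v 0) fun _ => measurable_const
  | succ t ih =>
    have hs : Measurable[ℱ (t + 1)] (runState G c₁ lo sel ℓ x₁ A t) :=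
      (ih (by omega)).mono (ℱ.mono (Nat.le_succ t)) le_rfl
    exact measurable_discrete_comp (mα := ℱ (t + 1)) (h.action_measurable t ht)
      (F := fun a ω => algStep G c₁ sel (runState G c₁ lo sel ℓ x₁ A t ω) a
        (feedback G lo a (ℓ t ω)))
      fun a => measurable_algStep hK G c₁ sel hs (runState_cumWeight_nonneg hsel t) a
        (measurable_feedback G lo a (h.loss_measurable t ht))

theorem IsRun.sup_comap_le (h : IsRun G c₁ lo sel T μ ℱ ℓ x₁ A) {t : ℕ} (ht : t < T) :
    ℱ t ⊔ MeasurableSpace.comap (ℓ t) inferInstance ≤ m :=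
  sup_le (ℱ.le t) (((h.loss_measurable t ht).mono (ℱ.le _) le_rfl).comap_le)

theorem IsRun.measurable_loss (h : IsRun G c₁ lo sel T μ ℱ ℓ x₁ A) {t : ℕ} (ht : t < T)
    (a : Fin K) : Measurable fun ω => ℓ t ω a :=
  (measurable_pi_apply a).comp ((h.loss_measurable t ht).mono (ℱ.le _) le_rfl)

theorem IsRun.integrable_loss [IsProbabilityMeasure μ] (h : IsRun G c₁ lo sel T μ ℱ ℓ x₁ A) {t : ℕ}
    (ht : t < T) (a : Fin K) : Integrable (fun ω => ℓ t ω a) μ :=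
  Integrable.of_mem_Icc lo 1 (h.measurable_loss ht a).aemeasurable
    (Filter.Eventually.of_forall fun ω => h.loss_mem t ht ω a)

theorem IsRun.integrable_loss_action [IsProbabilityMeasure μ]
    (h : IsRun G c₁ lo sel T μ ℱ ℓ x₁ A) {t : ℕ} (ht : t < T) :
    Integrable (fun ω => ℓ t ω (A t ω)) μ :=
  Integrable.of_mem_Icc lo 1 (measurable_discrete_comp
      ((h.action_measurable t ht).mono (ℱ.le _) le_rfl) (F := fun a ω => ℓ t ω a)
      (h.measurable_loss ht)).aemeasurable
    (Filter.Eventually.of_forall fun ω => h.loss_mem t ht ω _)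

theorem IsRun.integrable_loss_sub [IsProbabilityMeasure μ]
    (h : IsRun G c₁ lo sel T μ ℱ ℓ x₁ A) (u : Fin K) :
    ∀ t ∈ Finset.range T, Integrable (fun ω => ℓ t ω (A t ω) - ℓ t ω u) μ := fun _ ht =>
  (h.integrable_loss_action (Finset.mem_range.1 ht)).sub (h.integrable_loss (Finset.mem_range.1 ht) u)

theorem IsRun.randomized_le [IsProbabilityMeasure μ] (h : IsRun G c₁ lo sel T μ ℱ ℓ x₁ A)
    (hK : 2 ≤ K) (hsel : ∀ s : Finset (Fin K), s.Nonempty → sel s ∈ s) {t : ℕ} (ht : t < T)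
    {F : Fin K → Ω → ℝ}
    (hF : ∀ a, Measurable[ℱ t ⊔ MeasurableSpace.comap (ℓ t) inferInstance] (F a))
    (hF₀ : ∀ a ω, 0 ≤ F a ω) {H : Ω → ℝ} (hH : Integrable H μ)
    (hle : ∀ ω, ∑ a, algPlay G c₁ (runState G c₁ lo sel ℓ x₁ A t ω) a * F a ω ≤ H ω) :
    Integrable (fun ω => F (A t ω) ω) μ ∧ ∫ ω, F (A t ω) ω ∂μ ≤ ∫ ω, H ω ∂μ :=
  integral_randomized_le (h.sup_comap_le ht)
    (fun a => (h.action_measurable t ht).mono (ℱ.le _) le_rfl (measurableSet_singleton a))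
    (fun a => (measurable_algPlay hK G c₁ (h.measurable_runState hK hsel ht.le)
      (runState_cumWeight_nonneg hsel t) a).mono le_sup_left le_rfl)
    (fun a _ => algPlay_nonneg hK G c₁ _ a) (h.action_law t ht) hF hF₀ hH hle

theorem IsRun.integrable_corralRate [IsProbabilityMeasure μ]
    (h : IsRun G c₁ lo sel T μ ℱ ℓ x₁ A) (hK : 2 ≤ K)
    (hsel : ∀ s : Finset (Fin K), s.Nonempty → sel s ∈ s) {t : ℕ} (ht : t ≤ T) :
    Integrable (fun ω => corralRate c₁ (runState G c₁ lo sel ℓ x₁ A t ω).corral) μ := by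
  have hs := (h.measurable_runState hK hsel ht).mono (ℱ.le _) le_rfl
  refine Integrable.of_mem_Icc 0 (216 * √c₁)
    (measurable_corralRate c₁ (measurable_algState_iff.1 hs).2.2.2).aemeasurable
    (Filter.Eventually.of_forall fun ω => ⟨corralRate_nonneg _ _, ?_⟩)
  refine (corralRate_le c₁ (valid_algTrajectory hsel lo _ _ _ t).rounds_le).trans ?_
  refine mul_le_of_le_one_right (by positivity) ?_
  rw [div_le_one (by positivity)]
  exact Real.one_le_sqrt.2 (by exact_mod_cast Nat.le_add_left 1 _)

/-- `alg_drift` is applied conditionally on the past and the current losses. The rescaled loss of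
the played arm is added to the potential, so that both are averaged at once and the integrand stays
nonnegative. -/
theorem IsRun.potential_step [IsProbabilityMeasure μ] {κ : ℝ}
    (h : IsRun G (stabConst κ G) lo sel T μ ℱ ℓ x₁ A) (hK : 2 ≤ K) (hG : StronglyObservable G)
    (hκ : 90000 ≤ κ) (hc : 1 ≤ stabConst κ G) (hlo : lo ≤ 0)
    (hsel : ∀ s : Finset (Fin K), s.Nonempty → sel s ∈ s) (u : Fin K) {t : ℕ} (ht : t < T)
    (hU : Integrable (fun ω => algPotential G (stabConst κ G) u
      (runState G (stabConst κ G) lo sel ℓ x₁ A t ω)) μ) :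
    Integrable (fun ω => algPotential G (stabConst κ G) u
      (runState G (stabConst κ G) lo sel ℓ x₁ A (t + 1) ω)) μ ∧
    ∫ ω, algPotential G (stabConst κ G) u
        (runState G (stabConst κ G) lo sel ℓ x₁ A (t + 1) ω) ∂μ
      + ∫ ω, (ℓ t ω (A t ω) - ℓ t ω u) / (1 - lo) ∂μ
      ≤ ∫ ω, algPotential G (stabConst κ G) u
          (runState G (stabConst κ G) lo sel ℓ x₁ A t ω) ∂μ
        + ∫ ω, corralRate (stabConst κ G)
          (runState G (stabConst κ G) lo sel ℓ x₁ A t ω).corral ∂μ := by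
  set c₁ := stabConst κ G
  set s := runState G c₁ lo sel ℓ x₁ A
  have hmem : ∀ ω i, (ℓ t ω i - lo) / (1 - lo) ∈ Set.Icc (0 : ℝ) 1 := fun ω i =>
    rescale_mem hlo (h.loss_mem t ht ω i)
  have hrate := h.integrable_corralRate hK hsel ht.le
  have hyu : Integrable (fun ω => (ℓ t ω u - lo) / (1 - lo)) μ :=
    ((h.integrable_loss ht u).sub (integrable_const lo)).div_const _
  have hyA : Integrable (fun ω => (ℓ t ω (A t ω) - lo) / (1 - lo)) μ :=
    ((h.integrable_loss_action ht).sub (integrable_const lo)).div_const _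
  have hW : ∀ ω, 0 ≤ (s t ω).corral.base.cumWeight := runState_cumWeight_nonneg hsel t
  have hs : Measurable[ℱ t ⊔ MeasurableSpace.comap (ℓ t) inferInstance] (s t) :=
    (h.measurable_runState hK hsel ht.le).mono le_sup_left le_rfl
  have hl : Measurable[ℱ t ⊔ MeasurableSpace.comap (ℓ t) inferInstance] (ℓ t) :=
    (comap_measurable (ℓ t)).mono le_sup_right le_rfl
  have hFm : ∀ a, Measurable[ℱ t ⊔ MeasurableSpace.comap (ℓ t) inferInstance] fun ω =>
      algPotential G c₁ u (algStep G c₁ sel (s t ω) a (feedback G lo a (ℓ t ω)))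
        + (ℓ t ω a - lo) / (1 - lo) := fun a =>
    Measurable.add (measurable_algPotential (mα := ℱ t ⊔ MeasurableSpace.comap (ℓ t) inferInstance)
      hK G c₁ u (measurable_algStep hK G c₁ sel hs hW a (measurable_feedback G lo a hl)))
      ((((measurable_pi_apply a).comp hl).sub_const lo).div_const _)
  obtain ⟨h1, h2⟩ := h.randomized_le hK hsel ht
    (F := fun a ω => algPotential G c₁ u (algStep G c₁ sel (s t ω) a (feedback G lo a (ℓ t ω)))
      + (ℓ t ω a - lo) / (1 - lo))
    (fun a => hFm a)
    (fun a ω => add_nonneg (algPotential_nonneg hK G c₁ u _) (hmem ω a).1)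
    ((hU.add hyu).add hrate) fun ω => by
      have := alg_drift hK hG hκ hc sel (hW ω) (hmem ω)
        (Y := fun a => feedback G lo a (ℓ t ω)) (fun a j haj => feedback_eq lo haj _) u
      simp only [mul_add, Finset.sum_add_distrib, Pi.add_apply]
      linarith
  have h3 : Integrable (fun ω => algPotential G c₁ u (s (t + 1) ω)) μ :=
    (h1.sub hyA).congr (Filter.Eventually.of_forall fun ω => by
      simp only [Pi.sub_apply, add_sub_cancel_right]; rfl)
  refine ⟨h3, ?_⟩
  have h4 : ∫ ω, (ℓ t ω (A t ω) - ℓ t ω u) / (1 - lo) ∂μ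
      = ∫ ω, (ℓ t ω (A t ω) - lo) / (1 - lo) ∂μ - ∫ ω, (ℓ t ω u - lo) / (1 - lo) ∂μ := by
    rw [← integral_sub hyA hyu]
    exact integral_congr_ae (Filter.Eventually.of_forall fun ω => by ring)
  have h5 := integral_add h3 hyA
  have h6 := integral_add (hU.add hyu) hrate
  have h7 := integral_add hU hyu
  simp only [Pi.add_apply] at h2 h6 h7
  have h8 : ∫ ω, algPotential G c₁ u (s (t + 1) ω) + (ℓ t ω (A t ω) - lo) / (1 - lo) ∂μ
    ≤ _ := h2
  linarith

/-- The drift telescopes from potential zero, and the final potential is nonnegative. The factor `2`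
bounds `1 - lo`, as potentials see rescaled losses. -/
theorem IsRun.regret_le [IsProbabilityMeasure μ] {κ : ℝ}
    (h : IsRun G (stabConst κ G) lo sel T μ ℱ ℓ x₁ A) (hK : 2 ≤ K) (hG : StronglyObservable G)
    (hκ : 90000 ≤ κ) (hc : 1 ≤ stabConst κ G) (hlo' : -1 ≤ lo) (hlo : lo ≤ 0)
    (hsel : ∀ s : Finset (Fin K), s.Nonempty → sel s ∈ s) (u : Fin K) :
    regret T μ ℓ A u ≤ 2 * ∫ ω, ∑ t ∈ Finset.range T, corralRate (stabConst κ G)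
      (runState G (stabConst κ G) lo sel ℓ x₁ A t ω).corral ∂μ := by
  have hrate := fun t (ht : t ≤ T) => h.integrable_corralRate hK hsel ht
  have key : ∀ n ≤ T, Integrable (fun ω => algPotential G (stabConst κ G) u
        (runState G (stabConst κ G) lo sel ℓ x₁ A n ω)) μ ∧
      ∫ ω, algPotential G (stabConst κ G) u
          (runState G (stabConst κ G) lo sel ℓ x₁ A n ω) ∂μ
        + ∑ t ∈ Finset.range n, ∫ ω, (ℓ t ω (A t ω) - ℓ t ω u) / (1 - lo) ∂μ
        ≤ ∑ t ∈ Finset.range n, ∫ ω, corralRate (stabConst κ G)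
          (runState G (stabConst κ G) lo sel ℓ x₁ A t ω).corral ∂μ := by
    intro n hn
    induction n with
    | zero =>
      have h0 : ∀ ω, algPotential G (stabConst κ G) u
          (runState G (stabConst κ G) lo sel ℓ x₁ A 0 ω) = 0 := fun ω =>
        algPotential_fresh G _ u _ _
      simp [h0]
    | succ n ih =>
      obtain ⟨i1, i2⟩ := ih (by omega)
      obtain ⟨j1, j2⟩ := h.potential_step hK hG hκ hc hlo hsel u hn i1
      refine ⟨j1, ?_⟩
      rw [Finset.sum_range_succ, Finset.sum_range_succ]
      linarith
  have hpos : 0 < 1 - lo := by linarith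
  have h1 := (key T le_rfl).2
  have h2 : 0 ≤ ∫ ω, algPotential G (stabConst κ G) u
      (runState G (stabConst κ G) lo sel ℓ x₁ A T ω) ∂μ :=
    integral_nonneg fun ω => algPotential_nonneg hK G _ u _
  rw [integral_finsetSum _ fun t ht => hrate t (Finset.mem_range.1 ht).le]
  have h3 : regret T μ ℓ A u = (1 - lo) * ∑ t ∈ Finset.range T,
      ∫ ω, (ℓ t ω (A t ω) - ℓ t ω u) / (1 - lo) ∂μ := by
    unfold regret
    rw [integral_finsetSum _ (h.integrable_loss_sub u), Finset.mul_sum]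
    refine Finset.sum_congr rfl fun t _ => ?_
    rw [integral_div]
    field_simp
  have h4 : 0 ≤ ∑ t ∈ Finset.range T, ∫ ω, corralRate (stabConst κ G)
      (runState G (stabConst κ G) lo sel ℓ x₁ A t ω).corral ∂μ :=
    Finset.sum_nonneg fun t _ => integral_nonneg fun ω => corralRate_nonneg _ _
  rw [h3]
  exact (mul_le_mul_of_nonneg_left (by linarith) hpos.le).trans
    (mul_le_mul_of_nonneg_right (by linarith) h4)

theorem IsRun.regret_le_sqrt [IsProbabilityMeasure μ] {κ : ℝ}
    (h : IsRun G (stabConst κ G) lo sel T μ ℱ ℓ x₁ A) (hK : 2 ≤ K) (hG : StronglyObservable G)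
    (hκ : 90000 ≤ κ) (hc : 1 ≤ stabConst κ G) (hlo' : -1 ≤ lo) (hlo : lo ≤ 0)
    (hsel : ∀ s : Finset (Fin K), s.Nonempty → sel s ∈ s) (u : Fin K) :
    regret T μ ℓ A u ≤ 4320 * √(stabConst κ G) * √(T : ℝ) := by
  have h1 := h.regret_le hK hG hκ hc hlo' hlo hsel u
  have h2 := integral_mono (integrable_finsetSum (Finset.range T) fun t ht =>
      h.integrable_corralRate hK hsel (Finset.mem_range.1 ht).le)
    (integrable_const (μ := μ) (2160 * √(stabConst κ G) * √(T : ℝ)))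
    fun ω => sum_corralRate_le hK hsel lo (x₁ ω) _ _ T
  simp only [integral_const, probReal_univ, one_smul] at h2
  linarith

end Run

end GraphBandit

namespace GraphBandit

/-! ## The corrupted stochastic regime -/

section Stochastic

variable {K : ℕ} {G : Digraph (Fin K)} {c₁ lo : ℝ} {sel : Finset (Fin K) → Fin K} {T : ℕ}
  {Ω : Type*} {m : MeasurableSpace Ω} {μ : Measure Ω} {ℱ : Filtration ℕ m}
  {ℓ : ℕ → Ω → Fin K → ℝ} {x₁ : Ω → Fin K} {A : ℕ → Ω → Fin K}

theorem IsRun.stronglyMeasurable_algPlay (h : IsRun G c₁ lo sel T μ ℱ ℓ x₁ A) (hK : 2 ≤ K)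
    (hsel : ∀ s : Finset (Fin K), s.Nonempty → sel s ∈ s) {t : ℕ} (ht : t < T) (a : Fin K) :
    StronglyMeasurable[ℱ t] fun ω => algPlay G c₁ (runState G c₁ lo sel ℓ x₁ A t ω) a :=
  (measurable_algPlay (mα := ℱ t) hK G c₁ (h.measurable_runState hK hsel ht.le)
    (runState_cumWeight_nonneg hsel t) a).stronglyMeasurable

theorem IsRun.integrable_algPlay [IsProbabilityMeasure μ] (h : IsRun G c₁ lo sel T μ ℱ ℓ x₁ A)
    (hK : 2 ≤ K) (hsel : ∀ s : Finset (Fin K), s.Nonempty → sel s ∈ s) {t : ℕ} (ht : t < T)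
    (a : Fin K) :
    Integrable (fun ω => algPlay G c₁ (runState G c₁ lo sel ℓ x₁ A t ω) a) μ :=
  Integrable.of_mem_Icc 0 1
    ((h.stronglyMeasurable_algPlay hK hsel ht a).mono (ℱ.le t)).measurable.aemeasurable
    (Filter.Eventually.of_forall fun _ => ⟨algPlay_nonneg hK G c₁ _ a, algPlay_le_one hK G c₁ _ a⟩)

theorem IsRun.integrable_ne [IsProbabilityMeasure μ] (h : IsRun G c₁ lo sel T μ ℱ ℓ x₁ A)
    {t : ℕ} (ht : t < T) (x : Fin K) :
    Integrable (fun ω => if A t ω = x then (0 : ℝ) else 1) μ :=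
  Integrable.of_mem_Icc 0 1 (Measurable.ite ((h.action_measurable t ht).mono (ℱ.le _) le_rfl
      (measurableSet_singleton x)) measurable_const measurable_const).aemeasurable
    (Filter.Eventually.of_forall fun ω => by split_ifs <;> simp)

/-- Identifies in expectation the two counts in `sum_corralRate_le_log`: realized plays of other
arms and their conditional probabilities. -/
theorem IsRun.integral_ne [IsProbabilityMeasure μ] (h : IsRun G c₁ lo sel T μ ℱ ℓ x₁ A)
    (hK : 2 ≤ K) (hsel : ∀ s : Finset (Fin K), s.Nonempty → sel s ∈ s) {t : ℕ} (ht : t < T)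
    (x : Fin K) :
    ∫ ω, (if A t ω = x then (0 : ℝ) else 1) ∂μ
      = ∫ ω, (1 - algPlay G c₁ (runState G c₁ lo sel ℓ x₁ A t ω) x) ∂μ := by
  have hE : MeasurableSet {ω | A t ω = x} :=
    (h.action_measurable t ht).mono (ℱ.le _) le_rfl (measurableSet_singleton x)
  have hi : Integrable (Set.indicator {ω | A t ω = x} fun _ => (1 : ℝ)) μ :=
    (integrable_const 1).indicator hE
  rw [integral_sub (integrable_const 1) (h.integrable_algPlay hK hsel ht x),
    ← integral_congr_ae (h.action_law t ht x), integral_condExp (h.sup_comap_le ht),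
    ← integral_sub (integrable_const 1) hi]
  refine integral_congr_ae (Filter.Eventually.of_forall fun ω => ?_)
  by_cases hω : A t ω = x <;> simp [hω]

theorem IsRun.gap_le [IsProbabilityMeasure μ] (h : IsRun G c₁ lo sel T μ ℱ ℓ x₁ A)
    (hlo' : -1 ≤ lo) {x v : Fin K} {Δ : ℝ} {C : ℕ → ℝ}
    (hst : CorruptedStochastic T μ ℱ ℓ x Δ C) (hv : v ≠ x) {t : ℕ} (ht : t < T) :
    Δ - C t ≤ ∫ ω, (ℓ t ω v - ℓ t ω x) ∂μ ∧ ∫ ω, (ℓ t ω v - ℓ t ω x) ∂μ ≤ 2 := by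
  have hi := (h.integrable_loss ht v).sub (h.integrable_loss ht x)
  constructor
  · have h1 := integral_mono_ae (integrable_const (Δ - C t)) integrable_condExp (hst.gap t ht v hv)
    rw [integral_condExp (ℱ.le t)] at h1
    simpa using h1
  · have h1 := integral_mono hi (integrable_const (μ := μ) (2 : ℝ)) fun ω => by
      have h2 := (h.loss_mem t ht ω v).2
      have h3 := (h.loss_mem t ht ω x).1
      simp only [Pi.sub_apply]
      linarith
    simpa using h1

/-- The action is independent of the losses given the past, and the play probabilities are `ℱ
t`-measurable, so the conditional gap can be inserted arm by arm. -/
theorem IsRun.gap_step [IsProbabilityMeasure μ] (h : IsRun G c₁ lo sel T μ ℱ ℓ x₁ A)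
    (hK : 2 ≤ K) (hlo' : -1 ≤ lo)
    (hsel : ∀ s : Finset (Fin K), s.Nonempty → sel s ∈ s) {x : Fin K} {Δ : ℝ} {C : ℕ → ℝ}
    (hst : CorruptedStochastic T μ ℱ ℓ x Δ C) {t : ℕ} (ht : t < T) :
    Δ * ∫ ω, (1 - algPlay G c₁ (runState G c₁ lo sel ℓ x₁ A t ω) x) ∂μ - C t
      ≤ ∫ ω, (ℓ t ω (A t ω) - ℓ t ω x) ∂μ := by
  set π : Fin K → Ω → ℝ := fun a ω => algPlay G c₁ (runState G c₁ lo sel ℓ x₁ A t ω) a with hπ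
  have hπ₀ : ∀ a ω, 0 ≤ π a ω := fun a ω => algPlay_nonneg hK G c₁ _ a
  have hπ₁ : ∀ a ω, π a ω ≤ 1 := fun a ω => algPlay_le_one hK G c₁ _ a
  have hπs : ∀ ω, ∑ a, π a ω = 1 := fun ω => algPlay_sum hK G c₁ _
  have hπi : ∀ a, Integrable (π a) μ := fun a => h.integrable_algPlay hK hsel ht a
  have hd : ∀ a, Integrable (fun ω => ℓ t ω a - ℓ t ω x) μ := fun a =>
    (h.integrable_loss ht a).sub (h.integrable_loss ht x)
  have hb : ∀ a ω, |ℓ t ω a - ℓ t ω x| ≤ 2 := fun a ω => by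
    have h1 := h.loss_mem t ht ω a
    have h2 := h.loss_mem t ht ω x
    rw [abs_le]
    constructor <;> linarith [h1.1, h1.2, h2.1, h2.2]
  have hπd : ∀ a, Integrable (fun ω => π a ω * (ℓ t ω a - ℓ t ω x)) μ := fun a =>
    (hd a).bdd_mul (c := 1) (hπi a).aestronglyMeasurable (Filter.Eventually.of_forall fun ω => by
      rw [Real.norm_eq_abs, abs_of_nonneg (hπ₀ a ω)]; exact hπ₁ a ω)
  have hl : Measurable[ℱ t ⊔ MeasurableSpace.comap (ℓ t) inferInstance] (ℓ t) :=
    (comap_measurable (ℓ t)).mono le_sup_right le_rfl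
  have hF : ∀ a, Measurable[ℱ t ⊔ MeasurableSpace.comap (ℓ t) inferInstance] fun ω =>
      2 - (ℓ t ω a - ℓ t ω x) := fun a =>
    (((measurable_pi_apply a).comp hl).sub ((measurable_pi_apply x).comp hl)).const_sub 2
  have hsum : Integrable (fun ω => ∑ a, π a ω * (ℓ t ω a - ℓ t ω x)) μ :=
    integrable_finsetSum _ fun a _ => hπd a
  -- `randomized_le` gives upper bounds for nonnegative integrands. Applied to `2` minus the loss
  -- difference, it yields the required lower bound.
  obtain ⟨-, h1⟩ := h.randomized_le hK hsel ht (F := fun a ω => 2 - (ℓ t ω a - ℓ t ω x)) hF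
    (fun a ω => by linarith [(abs_le.1 (hb a ω)).2])
    ((integrable_const (2 : ℝ)).sub hsum) fun ω => by
      refine le_of_eq ?_
      change ∑ a, π a ω * (2 - (ℓ t ω a - ℓ t ω x)) = 2 - ∑ a, π a ω * (ℓ t ω a - ℓ t ω x)
      simp only [mul_sub _ (2 : ℝ), Finset.sum_sub_distrib, ← Finset.sum_mul, hπs, one_mul]
  have hA : Integrable (fun ω => ℓ t ω (A t ω) - ℓ t ω x) μ :=
    h.integrable_loss_sub x t (Finset.mem_range.2 ht)
  have h2 : ∑ a, ∫ ω, π a ω * (ℓ t ω a - ℓ t ω x) ∂μ ≤ ∫ ω, (ℓ t ω (A t ω) - ℓ t ω x) ∂μ := by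
    have e1 := integral_sub (integrable_const (μ := μ) (2 : ℝ)) hA
    have e2 := integral_sub (integrable_const (μ := μ) (2 : ℝ)) hsum
    have e3 := integral_finsetSum (μ := μ) Finset.univ fun a _ => hπd a
    simp only [Pi.sub_apply] at h1
    linarith
  refine le_trans ?_ h2
  have h3 : ∀ a ≠ x, (Δ - C t) * ∫ ω, π a ω ∂μ ≤ ∫ ω, π a ω * (ℓ t ω a - ℓ t ω x) ∂μ := by
    intro a ha
    have hce := condExp_mul_of_stronglyMeasurable_left (μ := μ) (m := ℱ t)
      (h.stronglyMeasurable_algPlay hK hsel ht a) (hπd a) (hd a)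
    have e1 : ∫ ω, π a ω * (ℓ t ω a - ℓ t ω x) ∂μ
        = ∫ ω, π a ω * (μ[fun ω => ℓ t ω a - ℓ t ω x | ℱ t]) ω ∂μ := by
      rw [← integral_condExp (ℱ.le t)]
      exact integral_congr_ae hce
    have e2 : Integrable (fun ω => π a ω * (μ[fun ω => ℓ t ω a - ℓ t ω x | ℱ t]) ω) μ :=
      integrable_condExp.bdd_mul (c := 1) (hπi a).aestronglyMeasurable
        (Filter.Eventually.of_forall fun ω => by
          rw [Real.norm_eq_abs, abs_of_nonneg (hπ₀ a ω)]; exact hπ₁ a ω)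
    rw [e1, ← integral_const_mul]
    refine integral_mono_ae ((hπi a).const_mul _) e2 ?_
    filter_upwards [hst.gap t ht a ha] with ω hω
    rw [mul_comm]
    exact mul_le_mul_of_nonneg_left hω (hπ₀ a ω)
  have h4 : ∑ a ∈ Finset.univ.erase x, ∫ ω, π a ω ∂μ = ∫ ω, (1 - π x ω) ∂μ := by
    rw [← integral_finsetSum _ fun a _ => hπi a]
    refine integral_congr_ae (Filter.Eventually.of_forall fun ω => ?_)
    have := Finset.add_sum_erase Finset.univ (fun a => π a ω) (Finset.mem_univ x)
    simp only at this ⊢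
    linarith [hπs ω]
  have h5 : ∫ ω, (1 - π x ω) ∂μ ≤ 1 := by
    have := integral_mono ((integrable_const 1).sub (hπi x)) (integrable_const (μ := μ) (1 : ℝ))
      fun ω => by simp only [Pi.sub_apply]; linarith [hπ₀ x ω]
    simpa using this
  rw [← Finset.add_sum_erase Finset.univ _ (Finset.mem_univ x)]
  simp only [sub_self, mul_zero, integral_zero, zero_add]
  -- The corruption is multiplied by a probability, hence costs at most `C t`.
  calc _ ≤ (Δ - C t) * ∫ ω, (1 - π x ω) ∂μ := by
        nlinarith [mul_le_mul_of_nonneg_left h5 (hst.corruption_nonneg t ht)]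
    _ = ∑ a ∈ Finset.univ.erase x, (Δ - C t) * ∫ ω, π a ω ∂μ := by rw [← h4, Finset.mul_sum]
    _ ≤ _ := Finset.sum_le_sum fun a ha => h3 a (Finset.ne_of_mem_erase ha)

theorem integrable_affine [IsProbabilityMeasure μ] {f g : Ω → ℝ} (hf : Integrable f μ)
    (hg : Integrable g μ) (a b : ℝ) : Integrable (fun ω => 1 + a * (f ω + g ω) + b) μ :=
  ((integrable_const 1).add ((hf.add hg).const_mul a)).add (integrable_const b)

theorem integral_affine [IsProbabilityMeasure μ] {f g : Ω → ℝ} (hf : Integrable f μ)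
    (hg : Integrable g μ) (a b : ℝ) :
    ∫ ω, (1 + a * (f ω + g ω) + b) ∂μ = 1 + a * (∫ ω, f ω ∂μ + ∫ ω, g ω ∂μ) + b := by
  have h1 : Integrable (fun ω => f ω + g ω) μ := hf.add hg
  have h2 : Integrable (fun ω => 1 + a * (f ω + g ω)) μ := (integrable_const 1).add (h1.const_mul a)
  rw [integral_add h2 (integrable_const b), integral_add (integrable_const 1) (h1.const_mul a),
    integral_const_mul, integral_add hf hg]
  simp

/-- The two sides of the self-bounding argument, expressed through one number `n`, the expected
number of rounds off the optimal arm. -/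
theorem IsRun.regret_optimal [IsProbabilityMeasure μ] {κ : ℝ}
    (h : IsRun G (stabConst κ G) lo sel T μ ℱ ℓ x₁ A) (hK : 2 ≤ K) (hG : StronglyObservable G)
    (hκ : 90000 ≤ κ) (hc : 1 ≤ stabConst κ G) (hlo' : -1 ≤ lo) (hlo : lo ≤ 0)
    (hsel : ∀ s : Finset (Fin K), s.Nonempty → sel s ∈ s) (hT : 2 ≤ T) {x : Fin K} {Δ : ℝ}
    {C : ℕ → ℝ} (hst : CorruptedStochastic T μ ℱ ℓ x Δ C) :
    ∃ n : ℝ, 0 ≤ n ∧ Δ * n - ∑ t ∈ Finset.range T, C t ≤ regret T μ ℓ A x ∧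
      ∀ lam : ℝ, 0 < lam → regret T μ ℓ A x
        ≤ 6600 * √(stabConst κ G) * (1 + 2 * lam * n + Real.log T / lam) := by
  set c₁ := stabConst κ G
  set n := ∑ t ∈ Finset.range T,
    ∫ ω, (1 - algPlay G c₁ (runState G c₁ lo sel ℓ x₁ A t ω) x) ∂μ with hn
  have i1 : ∀ t ∈ Finset.range T, Integrable (fun ω => if A t ω = x then (0 : ℝ) else 1) μ :=
    fun t ht => h.integrable_ne (Finset.mem_range.1 ht) x
  have i2 : ∀ t ∈ Finset.range T, Integrable (fun ω => 1 - algPlay G c₁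
      (runState G c₁ lo sel ℓ x₁ A t ω) x) μ := fun t ht =>
    (integrable_const 1).sub (h.integrable_algPlay hK hsel (Finset.mem_range.1 ht) x)
  refine ⟨n, Finset.sum_nonneg fun t _ => integral_nonneg fun ω =>
    sub_nonneg.2 (algPlay_le_one hK G c₁ _ x), ?_, fun lam hlam => ?_⟩
  · unfold regret
    rw [integral_finsetSum _ (h.integrable_loss_sub x), hn, Finset.mul_sum,
      ← Finset.sum_sub_distrib]
    exact Finset.sum_le_sum fun t ht => h.gap_step hK hlo' hsel hst (Finset.mem_range.1 ht)
  · refine (h.regret_le hK hG hκ hc hlo' hlo hsel x).trans ?_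
    have hN : ∫ ω, ∑ t ∈ Finset.range T, (if A t ω = x then (0 : ℝ) else 1) ∂μ = n := by
      rw [integral_finsetSum _ i1]
      exact Finset.sum_congr rfl fun t ht => h.integral_ne hK hsel (Finset.mem_range.1 ht) x
    have hQ : ∫ ω, ∑ t ∈ Finset.range T,
        (1 - algPlay G c₁ (runState G c₁ lo sel ℓ x₁ A t ω) x) ∂μ = n :=
      integral_finsetSum _ i2
    have j1 := integrable_finsetSum _ i1
    have j2 := integrable_finsetSum _ i2
    have h1 := integral_mono (integrable_finsetSum (Finset.range T) fun t ht =>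
      h.integrable_corralRate hK hsel (Finset.mem_range.1 ht).le)
      ((integrable_affine j1 j2 lam (Real.log T / lam)).const_mul (3300 * √c₁))
      fun ω => sum_corralRate_le_log hK hsel lo (x₁ ω) (fun s => ℓ s ω) (fun s => A s ω) x hlam hT
    rw [integral_const_mul, integral_affine j1 j2, hN, hQ] at h1
    linarith

/-- Trading off the two regret bounds of the corrupted stochastic regime. -/
theorem self_bounding_le {c L Δ C n R : ℝ} (hc : 1 ≤ c) (hL : 1 ≤ 3 / 2 * L) (hΔ : 0 < Δ)
    (hΔ' : Δ ≤ 4) (hC : 0 ≤ C) (h1 : Δ * n - C ≤ R)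
    (h2 : ∀ lam : ℝ, 0 < lam → R ≤ 6600 * √c * (1 + 2 * lam * n + L / lam)) :
    R ≤ 400000000 * (c * L / Δ + √(c * L / Δ * C)) := by
  have hs1 : 1 ≤ √c := Real.one_le_sqrt.2 hc
  have hsq : √c * √c = c := Real.mul_self_sqrt (by linarith)
  have hsc : √c ≤ c := by nlinarith
  have hLpos : 0 < L := by linarith
  set a := c * L / Δ with ha
  have hapos : 0 < a := by positivity
  -- Bounding `Δ` lets the additive constant `√c` be absorbed into the logarithmic term.
  have hca : c ≤ 6 * a := by
    have : c * Δ ≤ 6 * (c * L) := by nlinarith [mul_le_mul_of_nonneg_left hΔ' (by linarith : 0 ≤ c)]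
    rw [ha, ← mul_div_assoc, le_div_iff₀ hΔ]
    exact this
  rcases le_or_gt R 0 with hR | hR
  · have : 0 ≤ 400000000 * (a + √(a * C)) := by positivity
    linarith
  have key : ∀ θ : ℝ, 0 < θ → θ ≤ 1 → R ≤ 79200 * a + θ * C + 348480000 * (a / θ) := by
    intro θ hθ hθ1
    -- This `lam` turns the `n`-term into `θ Δ n / 2 ≤ θ (R + C) / 2`. As `θ ≤ 1`, half of `R` is
    -- absorbed on the left. The choice of `θ` is `1` when `C ≤ a` and `√(a / C)` otherwise.
    have h3 := h2 (θ * Δ / (26400 * √c)) (by positivity)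
    have e1 : 6600 * √c * (1 + 2 * (θ * Δ / (26400 * √c)) * n + L / (θ * Δ / (26400 * √c)))
        = 6600 * √c + θ * (Δ * n) / 2 + 174240000 * ((√c * √c) * L / (Δ * θ)) := by
      field_simp
      ring
    have e2 : a / θ = c * L / (Δ * θ) := by rw [ha, div_div]
    rw [e1, hsq, ← e2] at h3
    have h4 : θ * (Δ * n) ≤ θ * (R + C) := mul_le_mul_of_nonneg_left (by linarith) hθ.le
    have h5 : θ * R ≤ R := mul_le_of_le_one_left hR.le hθ1
    nlinarith
  rcases le_or_gt C a with hCa | hCa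
  · have h3 := key 1 one_pos le_rfl
    rw [one_mul, div_one] at h3
    have : 0 ≤ √(a * C) := Real.sqrt_nonneg _
    linarith
  · have hCpos : 0 < C := hapos.trans hCa
    have hsC := Real.sqrt_pos.2 hCpos
    have hsa := Real.sqrt_pos.2 hapos
    have hCC : √C * √C = C := Real.mul_self_sqrt hC
    have haa : √a * √a = a := Real.mul_self_sqrt hapos.le
    have h3 := key (√a / √C) (by positivity)
      ((div_le_one hsC).2 (Real.sqrt_le_sqrt hCa.le))
    have e1 : √a / √C * C = √a * √C := by
      rw [div_mul_eq_mul_div, div_eq_iff hsC.ne', mul_assoc, hCC]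
    have e2 : a / (√a / √C) = √a * √C := by
      rw [div_div_eq_mul_div, div_eq_iff hsa.ne', mul_right_comm, haa]
    rw [e1, e2] at h3
    rw [Real.sqrt_mul hapos.le]
    have : 0 ≤ √a * √C := by positivity
    linarith

/-- If `Δ T ≤ 2 C`, then `T` is at most `2 C / Δ` and the adversarial bound already has the required
form. Otherwise the corruption is too small to hide the gap: `x` has the least expected cumulative
loss, so it is the worst comparator, and `Δ ≤ 4` because losses lie in an interval of length at most
two. -/
theorem IsRun.regret_le_stochastic [IsProbabilityMeasure μ] {κ : ℝ}
    (h : IsRun G (stabConst κ G) lo sel T μ ℱ ℓ x₁ A) (hK : 2 ≤ K) (hG : StronglyObservable G)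
    (hκ : 90000 ≤ κ) (hc : 1 ≤ stabConst κ G) (hlo' : -1 ≤ lo) (hlo : lo ≤ 0)
    (hsel : ∀ s : Finset (Fin K), s.Nonempty → sel s ∈ s) (hT : 2 ≤ T) {x : Fin K} {Δ : ℝ}
    {C : ℕ → ℝ} (hst : CorruptedStochastic T μ ℱ ℓ x Δ C) (u : Fin K) :
    regret T μ ℓ A u ≤ 400000000 * (stabConst κ G * Real.log T / Δ
      + √(stabConst κ G * Real.log T / Δ * ∑ t ∈ Finset.range T, C t)) := by
  have hΔ := hst.gap_pos
  set c₁ := stabConst κ G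
  set S := ∑ t ∈ Finset.range T, C t with hS
  have hS₀ : 0 ≤ S := Finset.sum_nonneg fun t ht => hst.corruption_nonneg t (Finset.mem_range.1 ht)
  have hT' : (2 : ℝ) ≤ T := by exact_mod_cast hT
  have hL : 1 ≤ 3 / 2 * Real.log T := by
    have := Real.log_le_log two_pos hT'
    linarith [Real.log_two_gt_d9]
  have hLpos : 0 < Real.log T := by linarith
  have ha : 0 < c₁ * Real.log T / Δ := by positivity
  rcases le_or_gt (Δ * T) (2 * S) with hbig | hsmall
  · refine (h.regret_le_sqrt hK hG hκ hc hlo' hlo hsel u).trans ?_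
    have h1 : √c₁ * √(T : ℝ) ≤ 2 * √(c₁ * Real.log T / Δ * S) := by
      rw [← Real.sqrt_mul (by linarith), show (2 : ℝ) = √4 by
        rw [show (4 : ℝ) = 2 ^ 2 by norm_num]; exact (Real.sqrt_sq two_pos.le).symm,
        ← Real.sqrt_mul (by norm_num)]
      refine Real.sqrt_le_sqrt ?_
      have h2 : (T : ℝ) ≤ 2 * S / Δ := by rw [le_div_iff₀ hΔ]; linarith
      have h3 : 0 ≤ S / Δ := by positivity
      have h4 : (T : ℝ) ≤ 4 * (Real.log T * (S / Δ)) := by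
        have : 1 * (S / Δ) ≤ 3 / 2 * Real.log T * (S / Δ) := mul_le_mul_of_nonneg_right hL h3
        have e : 2 * S / Δ = 2 * (S / Δ) := by ring
        nlinarith
      calc c₁ * (T : ℝ) ≤ c₁ * (4 * (Real.log T * (S / Δ))) :=
            mul_le_mul_of_nonneg_left h4 (by linarith)
        _ = _ := by ring
    have h5 : 0 ≤ √(c₁ * Real.log T / Δ * S) := Real.sqrt_nonneg _
    linarith
  · have hgap : ∀ v ≠ x, Δ * T - S ≤ ∑ t ∈ Finset.range T, ∫ ω, (ℓ t ω v - ℓ t ω x) ∂μ := by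
      intro v hv
      have : Δ * T - S = ∑ t ∈ Finset.range T, (Δ - C t) := by
        rw [Finset.sum_sub_distrib, Finset.sum_const, Finset.card_range, nsmul_eq_mul, mul_comm]
      rw [this]
      exact Finset.sum_le_sum fun t ht => (h.gap_le hlo' hst hv (Finset.mem_range.1 ht)).1
    have hΔ4 : Δ ≤ 4 := by
      obtain ⟨v, hv⟩ := erase_nonempty hK x
      have hv := Finset.ne_of_mem_erase hv
      have h1 : ∑ t ∈ Finset.range T, ∫ ω, (ℓ t ω v - ℓ t ω x) ∂μ ≤ T * 2 := by
        have := Finset.sum_le_card_nsmul (Finset.range T)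
          (fun t => ∫ ω, (ℓ t ω v - ℓ t ω x) ∂μ) 2
          fun t ht => (h.gap_le hlo' hst hv (Finset.mem_range.1 ht)).2
        simpa using this
      have h2 := hgap v hv
      by_contra hcon
      nlinarith
    obtain ⟨n, -, h1, h2⟩ := h.regret_optimal hK hG hκ hc hlo' hlo hsel hT hst
    have h3 := self_bounding_le hc hL hΔ hΔ4 hS₀ h1 h2
    rcases eq_or_ne u x with rfl | hu
    · exact h3
    · refine le_trans ?_ h3
      have h4 := hgap u hu
      unfold regret
      rw [integral_finsetSum _ (h.integrable_loss_sub u), integral_finsetSum _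
        (h.integrable_loss_sub x)]
      have h5 : ∑ t ∈ Finset.range T, ∫ ω, (ℓ t ω (A t ω) - ℓ t ω u) ∂μ
          = ∑ t ∈ Finset.range T, ∫ ω, (ℓ t ω (A t ω) - ℓ t ω x) ∂μ
            - ∑ t ∈ Finset.range T, ∫ ω, (ℓ t ω u - ℓ t ω x) ∂μ := by
        rw [← Finset.sum_sub_distrib]
        refine Finset.sum_congr rfl fun t ht => ?_
        have ht' := Finset.mem_range.1 ht
        rw [integral_sub (h.integrable_loss_action ht') (h.integrable_loss ht' u),
          integral_sub (h.integrable_loss_action ht') (h.integrable_loss ht' x),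
          integral_sub (h.integrable_loss ht' u) (h.integrable_loss ht' x)]
        ring
      nlinarith

end Stochastic

end GraphBandit

namespace GraphBandit

/-! ## Stability of the base algorithm -/

section Stability

variable {K : ℕ} {G : Digraph (Fin K)} {S : Finset (Fin K)} {lo : ℝ} {T : ℕ}
  {Ω : Type*} {m : MeasurableSpace Ω} {μ : Measure Ω} {ℱ : Filtration ℕ m}
  {q : ℕ → Ω → ℝ} {ℓ : ℕ → Ω → Fin K → ℝ} {A : ℕ → Ω → Fin K} {upd : ℕ → Ω → Prop}

theorem baseStep_false (G : Digraph (Fin K)) (S : Finset (Fin K)) (b : BaseState K) (q : ℝ)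
    (a a' : Fin K) (y y' : Fin K → ℝ) :
    baseStep G S b q a False y = baseStep G S b q a' False y' := by
  simp only [baseStep, baseEstimate_false]

/-- The potential of the base algorithm, which vanishes when there is only one arm. -/
noncomputable def stabPotential (G : Digraph (Fin K)) (S : Finset (Fin K)) (u : Fin K)
    (b : BaseState K) : ℝ :=
  if K = 2 then 0 else basePotential G S u b

theorem stabPotential_nonneg (hK : 2 ≤ K) {u : Fin K} (hu : u ∈ S) (b : BaseState K) :
    0 ≤ stabPotential G S u b := by
  unfold stabPotential
  split_ifs with h
  · exact le_rfl
  · exact ftrlPotential_nonneg (tsallisExponent_pos (by omega)) hu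

theorem stabPotential_init {u : Fin K} (hu : u ∈ S) :
    stabPotential G S u (BaseState.init K) = 0 := by
  unfold stabPotential
  rw [basePotential_init hu, ite_self]

theorem measurable_stabPotential {α : Type*} {mα : MeasurableSpace α} (hK : 2 ≤ K)
    (G : Digraph (Fin K)) (S : Finset (Fin K)) (u : Fin K) {b : α → BaseState K}
    (hb : Measurable b) : Measurable fun ω => stabPotential G S u (b ω) := by
  unfold stabPotential
  split_ifs with h
  · exact measurable_const
  · exact measurable_basePotential (by omega) G S u hb

/-- The drift as one average over pairs of action and update indicator, the form required by
`integral_randomized_le`. -/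
theorem stabPotential_drift (hK : 2 ≤ K) (hG : StronglyObservable G) {κ : ℝ} (hκ : 90000 ≤ κ)
    (hc : 1 ≤ stabConst κ G) {x u : Fin K} (hu : u ∈ Finset.univ.erase x) {b : BaseState K} {q : ℝ}
    (hW : 0 ≤ b.cumWeight) (hq₀ : 0 < q) (hq₁ : q ≤ 1) {y : Fin K → ℝ}
    (hy : ∀ i, y i ∈ Set.Icc (0 : ℝ) 1) {Y : Fin K → Fin K → ℝ}
    (hY : ∀ a j, G.Adj a j → Y a j = y j) :
    ∑ z : Fin K × Bool, basePlay G (Finset.univ.erase x) b q z.1 * (if z.2 then q else 1 - q)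
        * (stabPotential G (Finset.univ.erase x) u
          (baseStep G (Finset.univ.erase x) b q z.1 (z.2 = true) (Y z.1)) + y z.1)
      ≤ stabPotential G (Finset.univ.erase x) u b + y u
        + (√(stabConst κ G * (b.cumWeight + 1 / q)) - √(stabConst κ G * b.cumWeight)) / 2 := by
  set p := basePlay G (Finset.univ.erase x) b q with hp
  have hmem : p ∈ supportedSimplex (Finset.univ.erase x) := basePlay_mem hK G x b q
  have hpx : p x = 0 := hmem.2 x (Finset.notMem_erase x _)
  have hsum : ∑ a, p a = 1 := hmem.1.2
  have hy' : ∑ a ∈ Finset.univ.erase x, p a * y a = ∑ a, p a * y a := by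
    rw [← Finset.add_sum_erase Finset.univ _ (Finset.mem_univ x), hpx, zero_mul, zero_add]
  have hexp : ∑ z : Fin K × Bool, p z.1 * (if z.2 then q else 1 - q)
        * (stabPotential G (Finset.univ.erase x) u
          (baseStep G (Finset.univ.erase x) b q z.1 (z.2 = true) (Y z.1)) + y z.1)
      = q * ∑ a, p a * stabPotential G (Finset.univ.erase x) u
          (baseStep G (Finset.univ.erase x) b q a True (Y a))
        + (1 - q) * stabPotential G (Finset.univ.erase x) u
          (baseStep G (Finset.univ.erase x) b q x False y) + ∑ a, p a * y a := by
    rw [Fintype.sum_prod_type]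
    simp only [Fintype.sum_bool, if_true, Bool.false_eq_true, if_false,
      baseStep_false G (Finset.univ.erase x) b q _ x _ y]
    have hx : ∀ X : ℝ, X = ∑ a, p a * X := fun X => by rw [← Finset.sum_mul, hsum, one_mul]
    rw [hx ((1 - q) * stabPotential G (Finset.univ.erase x) u
      (baseStep G (Finset.univ.erase x) b q x False y)), Finset.mul_sum, ← Finset.sum_add_distrib,
      ← Finset.sum_add_distrib]
    exact Finset.sum_congr rfl fun a _ => by ring
  rw [hexp]
  by_cases h2 : K = 2
  · have h3 := sum_mul_eq_of_two h2 hu hmem y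
    have h4 : √(stabConst κ G * b.cumWeight) ≤ √(stabConst κ G * (b.cumWeight + 1 / q)) := by
      have : 0 < 1 / q := one_div_pos.2 hq₀
      exact Real.sqrt_le_sqrt (mul_le_mul_of_nonneg_left (by linarith) (by linarith))
    have h5 : ∀ b', stabPotential G (Finset.univ.erase x) u b' = 0 := fun b' => if_pos h2
    simp only [h5, mul_zero, Finset.sum_const_zero, ← hy', h3]
    linarith
  · have h5 : ∀ b', stabPotential G (Finset.univ.erase x) u b'
        = basePotential G (Finset.univ.erase x) u b' := fun b' => if_neg h2
    have := base_drift (by omega) hG (card_erase_ge (by omega) x) hκ hW hq₀ hq₁ hy hu hY x y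
    simp only [h5]
    rw [← hp] at this
    linarith

/-- The state of the base algorithm before round `t`. -/
noncomputable abbrev baseState (G : Digraph (Fin K)) (S : Finset (Fin K)) (lo : ℝ)
    (q : ℕ → Ω → ℝ) (ℓ : ℕ → Ω → Fin K → ℝ) (A : ℕ → Ω → Fin K) (upd : ℕ → Ω → Prop) (t : ℕ)
    (ω : Ω) : BaseState K :=
  baseTrajectory G S lo (fun s => q s ω) (fun s => ℓ s ω) (fun s => A s ω) (fun s => upd s ω) t

theorem baseState_cumWeight (t : ℕ) (ω : Ω) :
    (baseState G S lo q ℓ A upd t ω).cumWeight = ∑ s ∈ Finset.range t, 1 / q s ω := by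
  induction t with
  | zero => rfl
  | succ t ih => rw [Finset.sum_range_succ, ← ih]; rfl

theorem IsBaseRun.cumWeight_nonneg (h : IsBaseRun G S lo T μ ℱ q ℓ A upd) {t : ℕ} (ht : t ≤ T)
    (ω : Ω) : 0 ≤ (baseState G S lo q ℓ A upd t ω).cumWeight := by
  rw [baseState_cumWeight]
  exact Finset.sum_nonneg fun s hs =>
    one_div_nonneg.2 (h.weight_mem s ((Finset.mem_range.1 hs).trans_le ht) ω).1.le

open Classical in
/-- The action and the update indicator of a round. -/
noncomputable def actionUpd (A : ℕ → Ω → Fin K) (upd : ℕ → Ω → Prop) (t : ℕ) (ω : Ω) :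
    Fin K × Bool :=
  (A t ω, if upd t ω then true else false)

theorem actionUpd_snd (t : ℕ) (ω : Ω) : ((actionUpd A upd t ω).2 = true) = upd t ω := by
  unfold actionUpd
  by_cases hu : upd t ω <;> simp [hu]

theorem IsBaseRun.measurable_actionUpd (h : IsBaseRun G S lo T μ ℱ q ℓ A upd) {t : ℕ}
    (ht : t < T) : Measurable[ℱ (t + 1)] (actionUpd A upd t) := by
  classical
  exact (h.action_measurable t ht).prodMk
    (Measurable.ite (h.upd_measurable t ht) measurable_const measurable_const)

theorem baseState_succ (t : ℕ) (ω : Ω) :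
    baseState G S lo q ℓ A upd (t + 1) ω = baseStep G S (baseState G S lo q ℓ A upd t ω) (q t ω)
      (actionUpd A upd t ω).1 ((actionUpd A upd t ω).2 = true)
      (feedback G lo (actionUpd A upd t ω).1 (ℓ t ω)) := by
  rw [actionUpd_snd]
  rfl

theorem IsBaseRun.measurable_baseState {x : Fin K}
    (h : IsBaseRun G (Finset.univ.erase x) lo T μ ℱ q ℓ A upd) (hK : 2 ≤ K) {t : ℕ} (ht : t ≤ T) :
    Measurable[ℱ t] (baseState G (Finset.univ.erase x) lo q ℓ A upd t) := by
  induction t with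
  | zero => exact measurable_const
  | succ t ih =>
    have hle : ℱ t ≤ ℱ (t + 1) := ℱ.mono (Nat.le_succ t)
    have hb : Measurable[ℱ (t + 1)] (baseState G (Finset.univ.erase x) lo q ℓ A upd t) :=
      (ih (by omega)).mono hle le_rfl
    refine @measurable_of_forall_eq _ (ℱ (t + 1)) _ _ _ _
      (measurable_discrete_comp (mα := ℱ (t + 1)) (h.measurable_actionUpd ht)
      (F := fun z ω => baseStep G (Finset.univ.erase x)
        (baseState G (Finset.univ.erase x) lo q ℓ A upd t ω) (q t ω) z.1 (z.2 = true)
        (feedback G lo z.1 (ℓ t ω)))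
      fun z => measurable_baseStep (mα := ℱ (t + 1)) hK G x hb
        ((h.weight_measurable t ht).mono hle le_rfl) (h.cumWeight_nonneg (by omega))
        (fun ω => (h.weight_mem t ht ω).1) z.1 _
        (measurable_feedback G lo z.1 (h.loss_measurable t ht)))
      fun ω => (baseState_succ t ω).symm

theorem IsBaseRun.sup_comap_le (h : IsBaseRun G S lo T μ ℱ q ℓ A upd) {t : ℕ} (ht : t < T) :
    ℱ t ⊔ MeasurableSpace.comap (ℓ t) inferInstance ≤ m :=
  sup_le (ℱ.le t) (((h.loss_measurable t ht).mono (ℱ.le _) le_rfl).comap_le)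

theorem IsBaseRun.actionUpd_law [IsProbabilityMeasure μ] (h : IsBaseRun G S lo T μ ℱ q ℓ A upd)
    {t : ℕ} (ht : t < T) (z : Fin K × Bool) :
    μ[Set.indicator {ω | actionUpd A upd t ω = z} (fun _ => (1 : ℝ)) |
        ℱ t ⊔ MeasurableSpace.comap (ℓ t) inferInstance] =ᵐ[μ]
      fun ω => basePlay G S (baseState G S lo q ℓ A upd t ω) (q t ω) z.1
        * (if z.2 then q t ω else 1 - q t ω) := by
  obtain ⟨a, v⟩ := z
  have hA : MeasurableSet {ω | A t ω = a} :=
    (h.action_measurable t ht).mono (ℱ.le _) le_rfl (measurableSet_singleton a)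
  have hU : MeasurableSet {ω | upd t ω} := ℱ.le _ _ (h.upd_measurable t ht)
  have hset : {ω | actionUpd A upd t ω = (a, true)} = {ω | A t ω = a ∧ upd t ω} := by
    ext ω
    by_cases hu : upd t ω <;> simp [actionUpd, hu]
  cases v with
  | true =>
    rw [hset]
    exact h.action_upd_law t ht a
  | false =>
    -- The law without an update follows by subtraction from the law of the action and its joint law
    -- with an update.
    have hind : Set.indicator {ω | actionUpd A upd t ω = (a, false)} (fun _ => (1 : ℝ))
        = Set.indicator {ω | A t ω = a} (fun _ => (1 : ℝ))
          - Set.indicator {ω | A t ω = a ∧ upd t ω} fun _ => (1 : ℝ) := by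
      ext ω
      by_cases hu : upd t ω <;> by_cases ha : A t ω = a <;> simp [actionUpd, hu, ha]
    rw [hind]
    filter_upwards [condExp_sub ((integrable_const (μ := μ) (1 : ℝ)).indicator hA)
      ((integrable_const (1 : ℝ)).indicator (hA.inter hU))
      (ℱ t ⊔ MeasurableSpace.comap (ℓ t) inferInstance), h.action_law t ht a,
      h.action_upd_law t ht a] with ω h1 h2 h3
    refine h1.trans ?_
    rw [Pi.sub_apply, h2]
    refine (congrArg _ h3).trans ?_
    simp only [Bool.false_eq_true, if_false]
    ring

theorem IsBaseRun.randomized_le [IsProbabilityMeasure μ] {x : Fin K}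
    (h : IsBaseRun G (Finset.univ.erase x) lo T μ ℱ q ℓ A upd) (hK : 2 ≤ K) {t : ℕ} (ht : t < T)
    {F : Fin K × Bool → Ω → ℝ}
    (hF : ∀ z, Measurable[ℱ t ⊔ MeasurableSpace.comap (ℓ t) inferInstance] (F z))
    (hF₀ : ∀ z ω, 0 ≤ F z ω) {H : Ω → ℝ} (hH : Integrable H μ)
    (hle : ∀ ω, ∑ z : Fin K × Bool, basePlay G (Finset.univ.erase x)
      (baseState G (Finset.univ.erase x) lo q ℓ A upd t ω) (q t ω) z.1
        * (if z.2 then q t ω else 1 - q t ω) * F z ω ≤ H ω) :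
    Integrable (fun ω => F (actionUpd A upd t ω) ω) μ ∧
      ∫ ω, F (actionUpd A upd t ω) ω ∂μ ≤ ∫ ω, H ω ∂μ := by
  refine integral_randomized_le (h.sup_comap_le ht)
    (fun z => (h.measurable_actionUpd ht).mono (ℱ.le _) le_rfl (measurableSet_singleton z))
    (fun z => Measurable.mono (ma := ℱ t) ?_ le_sup_left le_rfl) (fun z ω => ?_)
    (h.actionUpd_law ht) hF hF₀ hH hle
  · have hq := h.weight_measurable t ht
    refine Measurable.mul ((measurable_pi_apply z.1).comp (measurable_basePlay (mα := ℱ t) hK G x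
      (h.measurable_baseState hK ht.le) hq (h.cumWeight_nonneg ht.le)
      fun ω => (h.weight_mem t ht ω).1)) ?_
    split_ifs
    · exact hq
    · exact hq.const_sub 1
  · refine mul_nonneg (supportedSimplex_nonneg (basePlay_mem hK G x _ _) z.1) ?_
    have := h.weight_mem t ht ω
    split_ifs
    · exact this.1.le
    · linarith [this.2]

theorem IsBaseRun.measurable_loss (h : IsBaseRun G S lo T μ ℱ q ℓ A upd) {t : ℕ} (ht : t < T)
    (a : Fin K) : Measurable fun ω => ℓ t ω a :=
  (measurable_pi_apply a).comp ((h.loss_measurable t ht).mono (ℱ.le _) le_rfl)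

theorem IsBaseRun.measurable_loss_action (h : IsBaseRun G S lo T μ ℱ q ℓ A upd) {t : ℕ}
    (ht : t < T) : Measurable fun ω => ℓ t ω (A t ω) :=
  measurable_discrete_comp ((h.action_measurable t ht).mono (ℱ.le _) le_rfl)
    (F := fun a ω => ℓ t ω a) (h.measurable_loss ht)

theorem sum_range_stopped {τ T : ℕ} (hτ : τ ≤ T) (f : ℕ → ℝ) :
    ∑ t ∈ Finset.range τ, f t = ∑ t ∈ Finset.range T, (if t < τ then 1 else 0) * f t := by
  simp only [ite_mul, one_mul, zero_mul, ← Finset.sum_filter]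
  refine Finset.sum_congr ?_ fun _ _ => rfl
  ext t
  simp only [Finset.mem_range, Finset.mem_filter]
  omega

/-- Growth in round `t` of the bound, scaled by `c`. -/
noncomputable def boundIncr (c : ℝ) (q : ℕ → Ω → ℝ) (t : ℕ) (ω : Ω) : ℝ :=
  √(c * ∑ s ∈ Finset.range (t + 1), 1 / q s ω) - √(c * ∑ s ∈ Finset.range t, 1 / q s ω)

theorem sum_boundIncr (c : ℝ) (q : ℕ → Ω → ℝ) (n : ℕ) (ω : Ω) :
    ∑ t ∈ Finset.range n, boundIncr c q t ω = √(c * ∑ s ∈ Finset.range n, 1 / q s ω) := by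
  unfold boundIncr
  rw [Finset.sum_range_sub fun t => √(c * ∑ s ∈ Finset.range t, 1 / q s ω)]
  simp

theorem IsBaseRun.boundIncr_nonneg (h : IsBaseRun G S lo T μ ℱ q ℓ A upd) {c : ℝ} (hc : 0 ≤ c)
    {t : ℕ} (ht : t < T) (ω : Ω) : 0 ≤ boundIncr c q t ω := by
  refine sub_nonneg.2 (Real.sqrt_le_sqrt (mul_le_mul_of_nonneg_left ?_ hc))
  rw [Finset.sum_range_succ]
  exact le_add_of_nonneg_right (one_div_nonneg.2 (h.weight_mem t ht ω).1.le)

theorem IsBaseRun.measurable_boundIncr (h : IsBaseRun G S lo T μ ℱ q ℓ A upd) (c : ℝ) {t : ℕ}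
    (ht : t < T) : Measurable (boundIncr c q t) := by
  have hq : ∀ n ≤ T, Measurable fun ω => √(c * ∑ s ∈ Finset.range n, 1 / q s ω) := fun n hn =>
    ((Finset.measurable_sum _ fun s hs => measurable_const.div ((h.weight_measurable s
      ((Finset.mem_range.1 hs).trans_le hn)).mono (ℱ.le s) le_rfl)).const_mul c).sqrt
  exact (hq _ ht).sub (hq _ ht.le)

theorem measurable_stopped {τ : Ω → ℕ}
    (hτ : IsStoppingTime ℱ fun ω => ((τ ω : ℕ) : WithTop ℕ)) (t : ℕ) :
    Measurable[ℱ t] fun ω => if t < τ ω then (1 : ℝ) else 0 := by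
  refine Measurable.ite ?_ measurable_const measurable_const
  have := hτ.measurableSet_gt t
  convert this using 3
  exact Nat.cast_lt.symm

/-- Here `χ` and `χ'` stand for the indicators that the run is still active in this round and the
next. Since `χ` is known before the round, it multiplies the drift; replacing `χ` by `χ'` afterwards
only lowers a nonnegative potential. -/
theorem IsBaseRun.stopped_step [IsProbabilityMeasure μ] {x u : Fin K} {κ : ℝ}
    (h : IsBaseRun G (Finset.univ.erase x) lo T μ ℱ q ℓ A upd) (hK : 2 ≤ K)
    (hG : StronglyObservable G) (hκ : 90000 ≤ κ) (hc : 1 ≤ stabConst κ G) (hlo : lo ≤ 0)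
    (hu : u ∈ Finset.univ.erase x) {t : ℕ} (ht : t < T) {χ χ' : Ω → ℝ} (hχ : Measurable[ℱ t] χ)
    (hχ' : Measurable χ') (hχ₀ : ∀ ω, 0 ≤ χ' ω) (hχχ : ∀ ω, χ' ω ≤ χ ω) (hχ₁ : ∀ ω, χ ω ≤ 1)
    (hV : Integrable (fun ω => χ ω * stabPotential G (Finset.univ.erase x) u
      (baseState G (Finset.univ.erase x) lo q ℓ A upd t ω)) μ)
    (hI : Integrable (fun ω => χ ω * boundIncr (stabConst κ G) q t ω) μ) :
    Integrable (fun ω => χ' ω * stabPotential G (Finset.univ.erase x) u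
      (baseState G (Finset.univ.erase x) lo q ℓ A upd (t + 1) ω)) μ ∧
    ∫ ω, χ' ω * stabPotential G (Finset.univ.erase x) u
        (baseState G (Finset.univ.erase x) lo q ℓ A upd (t + 1) ω) ∂μ
      + ∫ ω, χ ω * ((ℓ t ω (A t ω) - ℓ t ω u) / (1 - lo)) ∂μ
      ≤ ∫ ω, χ ω * stabPotential G (Finset.univ.erase x) u
          (baseState G (Finset.univ.erase x) lo q ℓ A upd t ω) ∂μ
        + (∫ ω, χ ω * boundIncr (stabConst κ G) q t ω ∂μ) / 2 := by
  set c₁ := stabConst κ G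
  set S := Finset.univ.erase x
  set b := baseState G S lo q ℓ A upd with hb
  have hmem : ∀ ω i, (ℓ t ω i - lo) / (1 - lo) ∈ Set.Icc (0 : ℝ) 1 := fun ω i =>
    rescale_mem hlo (h.loss_mem t ht ω i)
  have hχ0 : ∀ ω, 0 ≤ χ ω := fun ω => (hχ₀ ω).trans (hχχ ω)
  have hU₀ : ∀ b', 0 ≤ stabPotential G S u b' := stabPotential_nonneg hK hu
  have hχm : Measurable χ := hχ.mono (ℱ.le t) le_rfl
  have hbdd : ∀ f : Ω → ℝ, Measurable f → (∀ ω, f ω ∈ Set.Icc (0 : ℝ) 1) →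
      Integrable (fun ω => χ ω * f ω) μ := fun f hf hf' =>
    Integrable.of_mem_Icc 0 1 (hχm.mul hf).aemeasurable (Filter.Eventually.of_forall fun ω =>
      ⟨mul_nonneg (hχ0 ω) (hf' ω).1, mul_le_one₀ (hχ₁ ω) (hf' ω).1 (hf' ω).2⟩)
  have hyu := hbdd (fun ω => (ℓ t ω u - lo) / (1 - lo))
    (((h.measurable_loss ht u).sub_const lo).div_const _) fun ω => hmem ω u
  have hyA := hbdd (fun ω => (ℓ t ω (A t ω) - lo) / (1 - lo))
    (((h.measurable_loss_action ht).sub_const lo).div_const _) fun ω => hmem ω _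
  have hle : ℱ t ≤ ℱ t ⊔ MeasurableSpace.comap (ℓ t) inferInstance := le_sup_left
  have hbm : Measurable[ℱ t ⊔ MeasurableSpace.comap (ℓ t) inferInstance] (b t) :=
    (h.measurable_baseState hK ht.le).mono hle le_rfl
  have hl : Measurable[ℱ t ⊔ MeasurableSpace.comap (ℓ t) inferInstance] (ℓ t) :=
    (comap_measurable (ℓ t)).mono le_sup_right le_rfl
  have hFm : ∀ z : Fin K × Bool, Measurable[ℱ t ⊔ MeasurableSpace.comap (ℓ t) inferInstance]
      fun ω => χ ω * (stabPotential G S u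
        (baseStep G S (b t ω) (q t ω) z.1 (z.2 = true) (feedback G lo z.1 (ℓ t ω)))
          + (ℓ t ω z.1 - lo) / (1 - lo)) := fun z =>
    (hχ.mono hle le_rfl).mul (Measurable.add
      (measurable_stabPotential (mα := ℱ t ⊔ MeasurableSpace.comap (ℓ t) inferInstance) hK G S u
        (measurable_baseStep hK G x hbm ((h.weight_measurable t ht).mono hle le_rfl)
          (h.cumWeight_nonneg ht.le) (fun ω => (h.weight_mem t ht ω).1) z.1 _
          (measurable_feedback G lo z.1 hl)))
      ((((measurable_pi_apply z.1).comp hl).sub_const lo).div_const _))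
  obtain ⟨h1, h2⟩ := h.randomized_le hK ht hFm
    (fun z ω => mul_nonneg (hχ0 ω) (add_nonneg (hU₀ _) (hmem ω z.1).1))
    ((hV.add hyu).add (hI.div_const 2)) fun ω => by
      have hd := stabPotential_drift hK hG hκ hc hu (b := b t ω) (h.cumWeight_nonneg ht.le ω)
        (h.weight_mem t ht ω).1 (h.weight_mem t ht ω).2 (hmem ω)
        (Y := fun a => feedback G lo a (ℓ t ω)) fun a j haj => feedback_eq lo haj _
      have hincr : √(c₁ * ((b t ω).cumWeight + 1 / q t ω)) - √(c₁ * (b t ω).cumWeight)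
          = boundIncr c₁ q t ω := by
        rw [boundIncr, Finset.sum_range_succ, hb, baseState_cumWeight]
      rw [hincr] at hd
      have := mul_le_mul_of_nonneg_left hd (hχ0 ω)
      rw [Finset.mul_sum] at this
      simp only [Pi.add_apply]
      refine le_trans (le_of_eq (Finset.sum_congr rfl fun z _ => ?_)) (this.trans (le_of_eq ?_))
      · exact mul_left_comm _ _ _
      · ring
  have hsucc : ∀ ω, χ ω * (stabPotential G S u (baseStep G S (b t ω) (q t ω)
      (actionUpd A upd t ω).1 ((actionUpd A upd t ω).2 = true)
        (feedback G lo (actionUpd A upd t ω).1 (ℓ t ω)))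
          + (ℓ t ω (actionUpd A upd t ω).1 - lo) / (1 - lo))
      = χ ω * stabPotential G S u (b (t + 1) ω)
        + χ ω * ((ℓ t ω (A t ω) - lo) / (1 - lo)) := fun ω => by
    rw [mul_add, hb, baseState_succ]
    rfl
  simp only [hsucc] at h1 h2
  have h3 : Integrable (fun ω => χ ω * stabPotential G S u (b (t + 1) ω)) μ :=
    (h1.sub hyA).congr (Filter.Eventually.of_forall fun ω => by
      simp only [Pi.sub_apply, add_sub_cancel_right])
  have hbm' : Measurable (b (t + 1)) := (h.measurable_baseState hK ht).mono (ℱ.le _) le_rfl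
  have hdom : ∀ ω, χ' ω * stabPotential G S u (b (t + 1) ω)
      ≤ χ ω * stabPotential G S u (b (t + 1) ω) := fun ω =>
    mul_le_mul_of_nonneg_right (hχχ ω) (hU₀ _)
  have h4 : Integrable (fun ω => χ' ω * stabPotential G S u (b (t + 1) ω)) μ :=
    h3.mono' (hχ'.mul (measurable_stabPotential hK G S u hbm')).aestronglyMeasurable
      (Filter.Eventually.of_forall fun ω => by
        rw [Real.norm_eq_abs, abs_of_nonneg (mul_nonneg (hχ₀ ω) (hU₀ _))]
        exact hdom ω)
  refine ⟨h4, ?_⟩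
  have h5 : ∫ ω, χ ω * ((ℓ t ω (A t ω) - ℓ t ω u) / (1 - lo)) ∂μ
      = ∫ ω, χ ω * ((ℓ t ω (A t ω) - lo) / (1 - lo)) ∂μ
        - ∫ ω, χ ω * ((ℓ t ω u - lo) / (1 - lo)) ∂μ := by
    rw [← integral_sub hyA hyu]
    exact integral_congr_ae (Filter.Eventually.of_forall fun ω => by ring)
  have h6 := integral_add h3 hyA
  have h7 := integral_add (hV.add hyu) (hI.div_const 2)
  have h8 := integral_add hV hyu
  have h9 := integral_mono h4 h3 hdom
  have h10 := integral_div (μ := μ) 2 fun ω => χ ω * boundIncr c₁ q t ω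
  simp only [Pi.add_apply] at h2 h7 h8
  linarith

/-- The stopped drift telescopes to half the bound for rescaled losses, and scaling back costs `1 -
lo ≤ 2`. Stopping at `τ` is encoded by weights `χ`, so all sums run up to the fixed horizon. -/
theorem iwStable_erase (hK : 2 ≤ K) (hG : StronglyObservable G) {κ : ℝ} (hκ : 90000 ≤ κ)
    (hc : 1 ≤ stabConst κ G) (x : Fin K) :
    IWStable.{u} G (Finset.univ.erase x) (stabConst κ G) 0 := by
  intro lo hlo' hlo T Ω m μ hμ ℱ q ℓ A upd h τ hτ hτT u hu hint
  simp only [zero_div, add_zero] at hint ⊢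
  set c₁ := stabConst κ G
  set S := Finset.univ.erase x
  set χ : ℕ → Ω → ℝ := fun t ω => if t < τ ω then 1 else 0 with hχ
  have hχm : ∀ t, Measurable[ℱ t] (χ t) := measurable_stopped hτ
  have hχm' : ∀ t, Measurable (χ t) := fun t => (hχm t).mono (ℱ.le t) le_rfl
  have hχ₀ : ∀ t ω, 0 ≤ χ t ω := fun t ω => by simp only [hχ]; split_ifs <;> norm_num
  have hχ₁ : ∀ t ω, χ t ω ≤ 1 := fun t ω => by simp only [hχ]; split_ifs <;> norm_num
  have hχχ : ∀ t ω, χ (t + 1) ω ≤ χ t ω := fun t ω => by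
    simp only [hχ]
    split_ifs <;> first | omega | norm_num
  have hsum : ∀ ω, √(c₁ * ∑ t ∈ Finset.range (τ ω), 1 / q t ω)
      = ∑ t ∈ Finset.range T, χ t ω * boundIncr c₁ q t ω := fun ω => by
    rw [← sum_boundIncr, sum_range_stopped (hτT ω)]
  have hI₀ : ∀ t < T, ∀ ω, 0 ≤ χ t ω * boundIncr c₁ q t ω := fun t ht ω =>
    mul_nonneg (hχ₀ t ω) (h.boundIncr_nonneg (by linarith) ht ω)
  -- Only the stopped bound is assumed integrable; each of its nonnegative increments is dominated
  -- by it.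
  have hI : ∀ t ∈ Finset.range T, Integrable (fun ω => χ t ω * boundIncr c₁ q t ω) μ := by
    intro t ht
    have ht' := Finset.mem_range.1 ht
    refine hint.mono' ((hχm' t).mul (h.measurable_boundIncr c₁ ht')).aestronglyMeasurable
      (Filter.Eventually.of_forall fun ω => ?_)
    rw [Real.norm_eq_abs, abs_of_nonneg (hI₀ t ht' ω), hsum]
    exact Finset.single_le_sum (f := fun t => χ t ω * boundIncr c₁ q t ω)
      (fun s hs => hI₀ s (Finset.mem_range.1 hs) ω) ht
  have key : ∀ n ≤ T, Integrable (fun ω => χ n ω * stabPotential G S u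
        (baseState G S lo q ℓ A upd n ω)) μ ∧
      ∫ ω, χ n ω * stabPotential G S u (baseState G S lo q ℓ A upd n ω) ∂μ
        + ∑ t ∈ Finset.range n, ∫ ω, χ t ω * ((ℓ t ω (A t ω) - ℓ t ω u) / (1 - lo)) ∂μ
        ≤ (∑ t ∈ Finset.range n, ∫ ω, χ t ω * boundIncr c₁ q t ω ∂μ) / 2 := by
    intro n hn
    induction n with
    | zero =>
      have h0 : ∀ ω, stabPotential G S u (baseState G S lo q ℓ A upd 0 ω) = 0 := fun ω =>
        stabPotential_init hu
      simp [h0]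
    | succ n ih =>
      obtain ⟨i1, i2⟩ := ih (by omega)
      obtain ⟨j1, j2⟩ := h.stopped_step hK hG hκ hc hlo hu hn (hχm n) (hχm' (n + 1)) (hχ₀ (n + 1))
        (hχχ n) (hχ₁ n) i1 (hI n (Finset.mem_range.2 hn))
      refine ⟨j1, ?_⟩
      rw [Finset.sum_range_succ, Finset.sum_range_succ]
      linarith
  have hpos : 0 < 1 - lo := by linarith
  have h1 := (key T le_rfl).2
  have h2 : 0 ≤ ∫ ω, χ T ω * stabPotential G S u (baseState G S lo q ℓ A upd T ω) ∂μ :=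
    integral_nonneg fun ω => mul_nonneg (hχ₀ T ω) (stabPotential_nonneg hK hu _)
  have h3 : ∫ ω, ∑ t ∈ Finset.range (τ ω), (ℓ t ω (A t ω) - ℓ t ω u) ∂μ
      = (1 - lo) * ∑ t ∈ Finset.range T,
        ∫ ω, χ t ω * ((ℓ t ω (A t ω) - ℓ t ω u) / (1 - lo)) ∂μ := by
    have e1 : ∀ ω, ∑ t ∈ Finset.range (τ ω), (ℓ t ω (A t ω) - ℓ t ω u)
        = ∑ t ∈ Finset.range T, χ t ω * (ℓ t ω (A t ω) - ℓ t ω u) := fun ω =>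
      sum_range_stopped (hτT ω) fun t => ℓ t ω (A t ω) - ℓ t ω u
    simp only [e1]
    rw [integral_finsetSum, Finset.mul_sum]
    · refine Finset.sum_congr rfl fun t _ => ?_
      rw [← integral_const_mul]
      refine integral_congr_ae (Filter.Eventually.of_forall fun ω => ?_)
      field_simp
    · intro t ht
      have ht' := Finset.mem_range.1 ht
      refine Integrable.of_mem_Icc (-2) 2 ((hχm' t).mul
        ((h.measurable_loss_action ht').sub (h.measurable_loss ht' u))).aemeasurable
        (Filter.Eventually.of_forall fun ω => ?_)
      have m1 := h.loss_mem t ht' ω (A t ω)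
      have m2 := h.loss_mem t ht' ω u
      simp only [hχ]
      split_ifs
      · rw [one_mul]
        constructor <;> linarith [m1.1, m1.2, m2.1, m2.2]
      · rw [zero_mul]
        constructor <;> norm_num
  have h4 : ∫ ω, √(c₁ * ∑ t ∈ Finset.range (τ ω), 1 / q t ω) ∂μ
      = ∑ t ∈ Finset.range T, ∫ ω, χ t ω * boundIncr c₁ q t ω ∂μ := by
    simp only [hsum]
    exact integral_finsetSum _ hI
  have h5 : 0 ≤ ∑ t ∈ Finset.range T, ∫ ω, χ t ω * boundIncr c₁ q t ω ∂μ :=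
    Finset.sum_nonneg fun t ht => integral_nonneg (hI₀ t (Finset.mem_range.1 ht))
  rw [h3, h4]
  set Y := ∑ t ∈ Finset.range T, ∫ ω, χ t ω * boundIncr c₁ q t ω ∂μ
  set X := ∑ t ∈ Finset.range T, ∫ ω, χ t ω * ((ℓ t ω (A t ω) - ℓ t ω u) / (1 - lo)) ∂μ
  have h6 := mul_le_mul_of_nonneg_left (show X ≤ Y / 2 by linarith) hpos.le
  have h7 := mul_le_mul_of_nonneg_right (show 1 - lo ≤ 2 by linarith) h5
  linarith

end Stability

end GraphBandit

namespace GraphBandit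

/-- Also covers `K = 2`, where `log K` and the complexity are only known to be at least `1/2`. -/
theorem one_le_stabConst {K : ℕ} (hK : 2 ≤ K) (G : Digraph (Fin K)) {κ : ℝ} (hκ : 90000 ≤ κ) :
    1 ≤ stabConst κ G := by
  have hlog : 1 / 2 ≤ Real.log K := by
    have := Real.log_le_log two_pos (by exact_mod_cast hK : (2 : ℝ) ≤ K)
    linarith [Real.log_two_gt_d9]
  have hM : 1 / 2 ≤ complexity G := complexity_ge hK G (by norm_num) hlog
  calc (1 : ℝ) ≤ 90000 * (1 / 2) * (1 / 2) := by norm_num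
    _ ≤ κ * complexity G * Real.log K := by gcongr

end GraphBandit

theorem mainTheorem7 :
    ∃ κ₀ : ℝ, 0 < κ₀ ∧ ∀ κ : ℝ, κ₀ ≤ κ → ∃ c : ℝ, 0 < c ∧
      ∀ (K : ℕ), 2 ≤ K → ∀ G : Digraph (Fin K), StronglyObservable G →
        (∀ x : Fin K, IWStable.{u} G (Finset.univ.erase x) (stabConst κ G) 0) ∧
        ∀ (lo : ℝ), -1 ≤ lo → lo ≤ 0 →
        ∀ sel : Finset (Fin K) → Fin K, (∀ s : Finset (Fin K), s.Nonempty → sel s ∈ s) →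
        ∀ (T : ℕ) (Ω : Type u) (m : MeasurableSpace Ω) (μ : Measure Ω) (_ : IsProbabilityMeasure μ)
          (ℱ : Filtration ℕ m) (ℓ : ℕ → Ω → Fin K → ℝ) (x₁ : Ω → Fin K) (A : ℕ → Ω → Fin K),
          IsRun G (stabConst κ G) lo sel T μ ℱ ℓ x₁ A →
          (∀ u : Fin K, regret T μ ℓ A u ≤ c * √(complexity G * T * Real.log K)) ∧
          (2 ≤ T → ∀ (x : Fin K) (Δ : ℝ) (C : ℕ → ℝ), CorruptedStochastic T μ ℱ ℓ x Δ C →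
            ∀ u : Fin K, regret T μ ℓ A u ≤
              c * (complexity G * Real.log T * Real.log K / Δ
                + √(complexity G * Real.log T * Real.log K / Δ * ∑ t ∈ Finset.range T, C t))) := by
  -- The factor `κ` in the final constant comes from `c₁ = κ M log K`; in the square-root terms only
  -- `√κ ≤ κ` appears.
  refine ⟨90000, by norm_num, fun κ hκ => ⟨400000000 * κ, by positivity, fun K hK G hG => ?_⟩⟩
  have hc := one_le_stabConst hK G hκ
  have hκ₀ : 0 ≤ κ := by linarith
  have hsκ : √κ ≤ κ := by
    rw [Real.sqrt_le_left hκ₀]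
    nlinarith
  refine ⟨iwStable_erase hK hG hκ hc, ?_⟩
  intro lo hlo' hlo sel hsel T Ω m μ hμ ℱ ℓ x₁ A h
  refine ⟨fun u => ?_, fun hT x Δ C hst u => ?_⟩
  · refine (h.regret_le_sqrt hK hG hκ hc hlo' hlo hsel u).trans ?_
    have e : √(stabConst κ G) * √(T : ℝ) = √κ * √(complexity G * T * Real.log K) := by
      rw [← Real.sqrt_mul (by linarith), ← Real.sqrt_mul hκ₀]
      unfold stabConst
      ring_nf
    rw [mul_assoc, e, ← mul_assoc]
    exact mul_le_mul_of_nonneg_right (by linarith) (Real.sqrt_nonneg _)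
  · refine (h.regret_le_stochastic hK hG hκ hc hlo' hlo hsel hT hst u).trans ?_
    set a := complexity G * Real.log T * Real.log K / Δ
    have e : stabConst κ G * Real.log T / Δ = κ * a := by
      unfold stabConst
      ring
    rw [e, mul_assoc κ, Real.sqrt_mul hκ₀, mul_assoc (400000000 : ℝ), mul_add κ]
    have := mul_le_mul_of_nonneg_right hsκ (Real.sqrt_nonneg (a * ∑ t ∈ Finset.range T, C t))
    linarith
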